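/- **Conventions.** Let $I$ be a countable set and $A=(a_{ij})_{i,j\in I}$ a Borcherds–Cartan matrix, i.e. $a_{ii}=2$ or $a_{ii}\in\mathbb Z_{\le 0}$, $a_{ij}\in\mathbb Z_{\le 0}$ for $i\ne j$, and $a_{ij}=0\iff a_{ji}=0$ for $i\neq j$. An index $i$ is real if $a_{ii}=2$ and imaginary if $a_{ii}\le 0$. Let $(A,\{\alpha_i\},\{\alpha_i^\vee\},P,P^\vee)$ be a Borcherds–Cartan datum: $P^\vee$ is a free $\mathbb Z$-module, $P=\mathrm{Hom}_{\mathbb Z}(P^\vee,\mathbb Z)$, $\alpha_i\in P$, $\alpha_i^\vee\in P^\vee$, $\alpha_i^\vee(\alpha_j)=a_{ij}$, and the $\alpha_i$, resp. the $\alpha_i^\vee$, are linearly independent over $\mathbb C$ in $\mathrm{Hom}_{\mathbb Z}(P^\vee,\mathbb C)$, resp. in $P^\vee\otimes\mathbb C$. Put $P^+=\{\lambda\in P\mid \alpha_i^\vee(\lambda)\ge 0\ \forall i\in I\}$ and $r_i(\mu)=\mu-\alpha_i^\vee(\mu)\alpha_i$ for $i\in I$, and let $\mathcal WP^+$ be the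 set of all $r_{i_k}\cdots r_{i_1}\mu$ with $k\ge 0$, $i_1,\dots,i_k\in I$, $\mu\in P^+$. *Paths.* Let $\mathfrak h_{\mathbb R}^*=\mathrm{Hom}_{\mathbb Z}(P^\vee,\mathbb R)$, and let $\mathbb P$ be the set of piecewise-linear continuous maps $\pi:[0,1]\to\mathfrak h_{\mathbb R}^*$ with $\pi(0)=0$ and $\pi(1)\in P$. For $i\in I$ put $H_i^\pi(t)=\alpha_i^\vee(\pi(t))$, $m_i^\pi=\min(H_i^\pi([0,1])\cap\mathbb Z)$ and $f_+=\max\{t\mid H_i^\pi(t)=m_i^\pi\}$. If $f_+=1$, set $f_i\pi=\mathbf 0$. If $f_+<1$, let $f_-=\min\{t\ge f_+\mid H_i^\pi(t)=m_i^\pi+1\}$ and let $(f_i\pi)(t)$ be $\pi(t)$ on $[0,f_+]$, $\pi(t)-(H_i^\pi(t)-m_i^\pi)\alpha_i$ on $[f_+,f_-]$, and $\pi(t)-\alpha_i$ on $[f_-,1]$. Set $f_i\mathbf 0=\mathbf 0$. Let $\mathcal F$ be the monoid of self-maps of $\mathbb P\sqcup\{\mathbf 0\}$ generated by the $f_i$,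 $i\in I$, and write $F_{\mathbf i}=f_{i_k}\cdots f_{i_1}$ for $\mathbf i=(i_k,\dots,i_1)\in I^k$, $k\ge 0$. For $\lambda_1,\dots,\lambda_n\in P$ let $\pi_{\lambda_1,\dots,\lambda_n}$ be the concatenation of the straight-line paths $t\mapsto t\lambda_l$, each run through in time $1/n$. *The Cartan datum.* Let $\tilde I=\{(i,1)\mid i\text{ real}\}\sqcup\{(i,m)\mid i\text{ imaginary},\,m\ge1\}$, and let $\tilde A$ be the matrix indexed by $\tilde I$ with diagonal entries $2$ and with entry $a_{ij}$ at $(i,m)\neq(j,n)$. Take a Cartan datum $(\tilde A,\{\tilde\alpha_{(i,m)}\},\{\tilde\alpha^\vee_{(i,m)}\},\tilde P,\tilde P^\vee)$ (a Borcherds–Cartan datum with matrix $\tilde A$, all of whose indices are real), with root operators $f_{(i,m)}$, which generate the monoid $\tilde{\mathcal F}$. For $\mathbf i=(i_k,\dots,i_1)$ let $(\mathbf i,\mathbf m)=((i_k,m_k),\dots,(i_1,m_1))$ be the ordered index of $\mathbf i$: $m_s=1$ if $i_s$ is real, and $m_s=\#\{x\le s\mid i_x=i_s\}$ if $i_s$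 is imaginary. Let $F_{(\mathbf i,\mathbf m)}=f_{(i_k,m_k)}\cdots f_{(i_1,m_1)}$. **Proposition.** Let $\lambda_1,\dots,\lambda_n\in\mathcal WP^+$, and let $\tilde\lambda_1,\dots,\tilde\lambda_n\in\tilde P$ satisfy $\tilde\alpha_{(i,m)}^\vee(\tilde\lambda_l)=\alpha_i^\vee(\lambda_l)$ for all $(i,m)\in\tilde I$ and all $l$. Then the map $$\widetilde{\ \ }:\ \mathcal F\pi_{\lambda_1,\dots,\lambda_n}\to\tilde{\mathcal F}\pi_{\tilde\lambda_1,\dots,\tilde\lambda_n},\qquad \pi=F_{\mathbf i}\pi_{\lambda_1,\dots,\lambda_n}\mapsto\tilde\pi=F_{(\mathbf i,\mathbf m)}\pi_{\tilde\lambda_1,\dots,\tilde\lambda_n},$$ is well defined and injective. Moreover, it is a quasi-embedding: $\widetilde{f_i\pi}=f_{(i,1)}\tilde\pi$ for $i$ real and $\pi\in\mathcal F\pi_{\lambda_1,\dots,\lambda_n}$, and $\widetilde{f_i\pi}=f_{(i,m)}\tilde\pi$ for $i$ imaginary and $\pi=F_{\mathbf i}\pi_{\lambda_1,\dots,\lambda_n}$,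 where $m-1$ is the number of occurrences of $i$ in $\mathbf i$. -/

import Mathlib

open scoped TensorProduct

/-! # Borcherds--Cartan data -/

/-- Borcherds--Cartan matrices: integral, each diagonal entry is `2` or is at most `0`, the other
entries are at most `0`, and the pattern of zeros is symmetric. -/
structure IsBorcherdsCartan {I : Type*} (A : Matrix I I ℤ) : Prop where
  diag : ∀ i, A i i = 2 ∨ A i i ≤ 0
  offDiag : ∀ i j, i ≠ j → A i j ≤ 0
  zero_iff : ∀ i j, i ≠ j → (A i j = 0 ↔ A j i = 0)

/-- A Borcherds--Cartan datum with matrix `A` and coweight lattice `Y` (that is `P^∨`).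
The weight lattice `P = Hom_ℤ(P^∨, ℤ)` is `Module.Dual ℤ Y`, and `α_i^∨(μ)` is `μ (coroot i)`.
The Cartan subalgebra is `𝔥 = P^∨ ⊗ ℂ`; its dual is `𝔥^* = Hom_ℤ(P^∨, ℂ)`.
An ordinary Cartan datum is one all of whose indices are real (`A i i = 2`). -/
structure BorcherdsCartanDatum {I : Type*} (A : Matrix I I ℤ) (Y : Type*) [AddCommGroup Y] where
  /-- The matrix is a Borcherds--Cartan matrix. -/
  isBorcherdsCartan : IsBorcherdsCartan A
  /-- The simple roots `α_i`. -/
  root : I → Module.Dual ℤ Y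
  /-- The simple coroots `α_i^∨`. -/
  coroot : I → Y
  /-- `α_i^∨(α_j) = a_{ij}`. -/
  root_coroot : ∀ i j, root j (coroot i) = A i j
  /-- The simple roots are linearly independent in `𝔥^*`. -/
  linearIndependent_root :
    LinearIndependent ℂ (fun i => Algebra.linearMap ℤ ℂ ∘ₗ root i : I → (Y →ₗ[ℤ] ℂ))
  /-- The simple coroots are linearly independent in `𝔥`. -/
  linearIndependent_coroot :
    LinearIndependent ℂ (fun i => (1 : ℂ) ⊗ₜ[ℤ] coroot i : I → ℂ ⊗[ℤ] Y)

namespace BorcherdsCartanDatum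

variable {I : Type*} {A : Matrix I I ℤ} {Y : Type*} [AddCommGroup Y]

/-- The dominant integral weights `P^+`. -/
def dominantWeights (D : BorcherdsCartanDatum A Y) : Set (Module.Dual ℤ Y) :=
  {μ | ∀ i, 0 ≤ μ (D.coroot i)}

/-- `r_i μ = μ - α_i^∨(μ) α_i`, for real and for imaginary `i`. -/
def reflection (D : BorcherdsCartanDatum A Y) (i : I) : Module.End ℤ (Module.Dual ℤ Y) where
  toFun μ := μ - μ (D.coroot i) • D.root i
  map_add' μ ν := by
    simp only [LinearMap.add_apply, add_smul]; abel
  map_smul' c μ := by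
    simp only [LinearMap.smul_apply, RingHom.id_apply, smul_sub, smul_assoc]

/-- `𝒲 P^+`, all weights `w μ` with `μ` dominant, where `w` runs over the monoid `𝒲` generated by
all the `r_i`. Only the action of `𝒲` on weights matters here, so `w` is taken in the monoid of
endomorphisms that is generated by the `r_i`. -/
def titsCone (D : BorcherdsCartanDatum A Y) : Set (Module.Dual ℤ Y) :=
  {ν | ∃ w ∈ Submonoid.closure (Set.range D.reflection), ∃ μ ∈ D.dominantWeights, ν = w μ}

end BorcherdsCartanDatum

/-! # The Cartan matrix indexed by the copies of the indices -/

/-- `Ĩ`: one copy `(i, 1)` of each real index, and copies `(i, m)`, `m ≥ 1`, of each imaginary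
index. -/
abbrev TildeIndex {I : Type*} (A : Matrix I I ℤ) : Type _ :=
  {p : I × ℕ // 1 ≤ p.2 ∧ (A p.1 p.1 = 2 → p.2 = 1)}

open Classical in
/-- The matrix `Ã`: the diagonal entries are `2`, and the entry at `(i,m) ≠ (j,n)` is `a_{ij}`. -/
noncomputable def tildeMatrix {I : Type*} (A : Matrix I I ℤ) :
    Matrix (TildeIndex A) (TildeIndex A) ℤ :=
  fun p q => if p = q then 2 else A p.1.1 q.1.1

open Classical in
/-- The index `(i, m)` which is put in front of the ordered index of `𝐢`: `m = 1` if `i` is real,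
and `m - 1` is the number of occurrences of `i` in `𝐢` if `i` is imaginary. -/
noncomputable def nextIndex {I : Type*} (A : Matrix I I ℤ) (i : I) (l : List I) : TildeIndex A :=
  ⟨(i, if A i i = 2 then 1 else l.count i + 1), by
    constructor
    · dsimp only
      split_ifs <;> omega
    · intro h
      exact if_pos h⟩

/-- The ordered index `(𝐢, 𝐦)` of `𝐢 = (i_k, …, i_2, i_1)`, a list whose head is `i_k`: counting
from the right, the `q`-th occurrence of an imaginary index `i` becomes `(i, q)`, and every
occurrence of a real index `i` becomes `(i, 1)`. -/
noncomputable def orderedIndex {I : Type*} (A : Matrix I I ℤ) : List I → List (TildeIndex A)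
  | [] => []
  | i :: l => nextIndex A i l :: orderedIndex A l

/-! # Paths -/

/-- Continuous piecewise-linear maps on `[0,1]`: there are finitely many points such that the map
is affine on each closed subinterval that has none of them in its interior. As the subintervals
are closed, the pieces agree at their common ends. -/
def IsPL {V : Type*} [AddCommGroup V] [Module ℝ V] (g : unitInterval → V) : Prop :=
  ∃ S : Finset ℝ, ∀ a b : unitInterval, a ≤ b → (∀ s ∈ S, ¬((a : ℝ) < s ∧ s < (b : ℝ))) →
    ∃ v w : V, ∀ t : unitInterval, a ≤ t → t ≤ b → g t = v + (t : ℝ) • w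

theorem IsPL.continuous {g : unitInterval → ℝ} (hg : IsPL g) : Continuous g := by
  obtain ⟨S, hS⟩ := hg
  have aff : ∀ a b : unitInterval, a ≤ b → (∀ s ∈ S, ¬((a : ℝ) < s ∧ s < (b : ℝ))) →
      ContinuousOn g (Set.Icc a b) := by
    intro a b hab h
    obtain ⟨v, w, hvw⟩ := hS a b hab h
    have : ContinuousOn (fun t : unitInterval => v + (t : ℝ) • w) (Set.Icc a b) := by fun_prop
    exact this.congr fun t ht => hvw t ht.1 ht.2
  rw [continuous_iff_continuousAt]
  intro x
  rw [continuousAt_iff_continuous_left_right]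
  constructor
  · rcases eq_or_lt_of_le (bot_le : ⊥ ≤ x) with hx | hx
    · have : Set.Iic x = {x} := by rw [← hx]; simp
      rw [this]; exact continuousWithinAt_singleton
    · have hev : ∀ᶠ a : unitInterval in nhdsWithin x (Set.Iio x),
          ∀ s ∈ S, ¬((a : ℝ) < s ∧ s < (x : ℝ)) := by
        refine (Filter.eventually_all_finset S).2 fun s _ => ?_
        by_cases h : s < (x : ℝ)
        · have h1 : ∀ᶠ a : unitInterval in nhds x, s < (a : ℝ) :=
            (continuous_subtype_val.tendsto x).eventually (Ioi_mem_nhds h)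
          filter_upwards [nhdsWithin_le_nhds h1] with a ha h2
          exact absurd h2.1 (not_lt.2 ha.le)
        · exact Filter.Eventually.of_forall fun a h2 => h h2.2
      have : (nhdsWithin x (Set.Iio x)).NeBot := nhdsLT_neBot_of_exists_lt ⟨⊥, hx⟩
      obtain ⟨a, ha, hax⟩ := (hev.and self_mem_nhdsWithin).exists
      exact ((aff a x hax.le ha) x ⟨hax.le, le_rfl⟩).mono_of_mem_nhdsWithin
        (Icc_mem_nhdsLE hax)
  · rcases eq_or_lt_of_le (le_top : x ≤ ⊤) with hx | hx
    · have : Set.Ici x = {x} := by rw [hx]; simp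
      rw [this]; exact continuousWithinAt_singleton
    · have hev : ∀ᶠ b : unitInterval in nhdsWithin x (Set.Ioi x),
          ∀ s ∈ S, ¬((x : ℝ) < s ∧ s < (b : ℝ)) := by
        refine (Filter.eventually_all_finset S).2 fun s _ => ?_
        by_cases h : (x : ℝ) < s
        · have h1 : ∀ᶠ b : unitInterval in nhds x, (b : ℝ) < s :=
            (continuous_subtype_val.tendsto x).eventually (Iio_mem_nhds h)
          filter_upwards [nhdsWithin_le_nhds h1] with b hb h2
          exact absurd h2.2 (not_lt.2 hb.le)
        · exact Filter.Eventually.of_forall fun b h2 => h h2.1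
      have : (nhdsWithin x (Set.Ioi x)).NeBot := nhdsGT_neBot_of_exists_gt ⟨⊤, hx⟩
      obtain ⟨b, hb, hxb⟩ := (hev.and self_mem_nhdsWithin).exists
      exact ((aff x b hxb.le hb) x ⟨le_rfl, hxb.le⟩).mono_of_mem_nhdsWithin
        (Icc_mem_nhdsGE hxb)

/-- The inclusion of the weight lattice `P` in `𝔥_ℝ^* = Hom_ℝ(P^∨ ⊗ ℝ, ℝ) = Hom_ℤ(P^∨, ℝ)`. -/
def realWeight {Y : Type*} [AddCommGroup Y] (μ : Module.Dual ℤ Y) : Y →ₗ[ℤ] ℝ :=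
  Algebra.linearMap ℤ ℝ ∘ₗ μ

theorem realWeight_apply {Y : Type*} [AddCommGroup Y] (μ : Module.Dual ℤ Y) (y : Y) :
    realWeight μ y = ((μ y : ℤ) : ℝ) := rfl

/-- The set `ℙ` of continuous piecewise-linear paths `π : [0,1] → 𝔥_ℝ^*` such that `π(0) = 0` and
`π(1) ∈ P`. -/
@[ext]
structure WeightPath (Y : Type*) [AddCommGroup Y] where
  /-- The underlying map. -/
  toFun : unitInterval → (Y →ₗ[ℤ] ℝ)
  isPL : IsPL toFun
  map_zero : toFun 0 = 0
  map_one : ∃ μ : Module.Dual ℤ Y, toFun 1 = realWeight μ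

namespace WeightPath

variable {Y : Type*} [AddCommGroup Y]

/-- The straight-line path `π_μ(t) = t μ`. -/
noncomputable def straight (μ : Module.Dual ℤ Y) : WeightPath Y where
  toFun t := (t : ℝ) • realWeight μ
  isPL := ⟨∅, fun _ _ _ _ => ⟨0, realWeight μ, fun t _ _ => by simp⟩⟩
  map_zero := by simp
  map_one := ⟨μ, by simp⟩

/-- The concatenation `π_1 ⊗ ⋯ ⊗ π_n`. On `[(m-1)/n, m/n]` it is
`t ↦ π_1(1) + ⋯ + π_{m-1}(1) + π_m(nt - m + 1)`. The formula used here says the same: with `l = m - 1`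
counted from `0`, the argument `nt - l`, cut off to `[0,1]`, is `1` to the right of the `l`-th
subinterval, where the `l`-th summand is `π(1)`, and `0` to the left of it, where the summand
is `π(0) = 0`. -/
noncomputable def concat {n : ℕ} (p : Fin n → WeightPath Y) : WeightPath Y where
  toFun t := ∑ l : Fin n,
    (p l).toFun (Set.projIcc (0 : ℝ) 1 zero_le_one ((n : ℝ) * (t : ℝ) - ((l : ℕ) : ℝ)))
  isPL := by
    rcases Nat.eq_zero_or_pos n with rfl | hn
    · exact ⟨∅, fun _ _ _ _ => ⟨0, 0, fun t _ _ => by simp⟩⟩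
    have hn' : (0 : ℝ) < n := by exact_mod_cast hn
    choose S hS using fun l => (p l).isPL
    classical
    refine ⟨Finset.univ.biUnion fun l : Fin n =>
      ((insert 0 (insert 1 (S l))).image fun s => (s + ((l : ℕ) : ℝ)) / (n : ℝ)),
      fun a b hab h => ?_⟩
    have key : ∀ l : Fin n, ∃ v w : Y →ₗ[ℤ] ℝ, ∀ t : unitInterval, a ≤ t → t ≤ b →
        (p l).toFun (Set.projIcc (0 : ℝ) 1 zero_le_one ((n : ℝ) * (t : ℝ) - ((l : ℕ) : ℝ)))
          = v + (t : ℝ) • w := by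
      intro l
      have hl : ∀ s ∈ insert 0 (insert 1 (S l)),
          ¬((n : ℝ) * (a : ℝ) - ((l : ℕ) : ℝ) < s ∧ s < (n : ℝ) * (b : ℝ) - ((l : ℕ) : ℝ)) := by
        rintro s hs ⟨h1, h2⟩
        refine h ((s + ((l : ℕ) : ℝ)) / (n : ℝ))
          (Finset.mem_biUnion.2 ⟨l, Finset.mem_univ _, Finset.mem_image_of_mem _ hs⟩) ⟨?_, ?_⟩
        · rw [lt_div_iff₀ hn']; linarith
        · rw [div_lt_iff₀ hn']; linarith
      set a' : ℝ := (n : ℝ) * (a : ℝ) - ((l : ℕ) : ℝ) with ha'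
      set b' : ℝ := (n : ℝ) * (b : ℝ) - ((l : ℕ) : ℝ) with hb'
      have hab' : a' ≤ b' := by
        have : (a : ℝ) ≤ (b : ℝ) := hab
        have := mul_le_mul_of_nonneg_left this hn'.le
        linarith
      have ht : ∀ t : unitInterval, a ≤ t → t ≤ b →
          a' ≤ (n : ℝ) * (t : ℝ) - ((l : ℕ) : ℝ) ∧ (n : ℝ) * (t : ℝ) - ((l : ℕ) : ℝ) ≤ b' := by
        intro t h1 h2
        have h1' : (a : ℝ) ≤ (t : ℝ) := h1
        have h2' : (t : ℝ) ≤ (b : ℝ) := h2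
        have := mul_le_mul_of_nonneg_left h1' hn'.le
        have := mul_le_mul_of_nonneg_left h2' hn'.le
        constructor <;> linarith
      have h0 := hl 0 (by simp)
      have h1 := hl 1 (by simp)
      by_cases hb0 : b' ≤ 0
      · refine ⟨(p l).toFun 0, 0, fun t hat htb => ?_⟩
        rw [Set.projIcc_of_le_left _ ((ht t hat htb).2.trans hb0), smul_zero, add_zero]
        rfl
      by_cases ha1 : 1 ≤ a'
      · refine ⟨(p l).toFun 1, 0, fun t hat htb => ?_⟩
        rw [Set.projIcc_of_right_le _ (ha1.trans (ht t hat htb).1), smul_zero, add_zero]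
        rfl
      have ha0 : 0 ≤ a' := by
        by_contra hc
        exact h0 ⟨not_le.1 hc, not_le.1 hb0⟩
      have hb1 : b' ≤ 1 := by
        by_contra hc
        exact h1 ⟨not_le.1 ha1, not_le.1 hc⟩
      obtain ⟨v, w, hvw⟩ := hS l ⟨a', ha0, hab'.trans hb1⟩ ⟨b', ha0.trans hab', hb1⟩ hab'
        (fun s hs => hl s (by simp [hs]))
      refine ⟨v - ((l : ℕ) : ℝ) • w, (n : ℝ) • w, fun t hat htb => ?_⟩
      have hmem : (n : ℝ) * (t : ℝ) - ((l : ℕ) : ℝ) ∈ Set.Icc (0 : ℝ) 1 :=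
        ⟨ha0.trans (ht t hat htb).1, (ht t hat htb).2.trans hb1⟩
      rw [Set.projIcc_of_mem _ hmem, hvw _ (ht t hat htb).1 (ht t hat htb).2]
      module
    choose v w hvw using key
    refine ⟨∑ l, v l, ∑ l, w l, fun t hat htb => ?_⟩
    rw [Finset.smul_sum, ← Finset.sum_add_distrib]
    exact Finset.sum_congr rfl fun l _ => hvw l t hat htb
  map_zero := by
    refine Finset.sum_eq_zero fun l _ => ?_
    rw [Set.projIcc_of_le_left _ (by simp)]
    exact (p l).map_zero
  map_one := by
    choose μ hμ using fun l => (p l).map_one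
    refine ⟨∑ l, μ l, ?_⟩
    have h1 : ∀ l : Fin n, (p l).toFun (Set.projIcc (0 : ℝ) 1 zero_le_one
        ((n : ℝ) * ((1 : unitInterval) : ℝ) - ((l : ℕ) : ℝ))) = realWeight (μ l) := by
      intro l
      have hl : ((l : ℕ) : ℝ) + 1 ≤ (n : ℝ) := by exact_mod_cast l.isLt
      rw [Set.projIcc_of_right_le _ (by simp; linarith)]
      exact hμ l
    rw [Finset.sum_congr rfl fun l _ => h1 l]
    ext y
    simp [realWeight_apply, LinearMap.sum_apply]

/-- `π_{λ_1, …, λ_n} = π_{λ_1} ⊗ ⋯ ⊗ π_{λ_n}`. -/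
noncomputable def ofWeights {n : ℕ} (μ : Fin n → Module.Dual ℤ Y) : WeightPath Y :=
  concat fun l => straight (μ l)

end WeightPath

/-! # Root operators -/

namespace BorcherdsCartanDatum

variable {I : Type*} {A : Matrix I I ℤ} {Y : Type*} [AddCommGroup Y]

/-- `H_i^π(t) = α_i^∨(π(t))`. -/
def height (D : BorcherdsCartanDatum A Y) (i : I) (p : WeightPath Y) (t : unitInterval) : ℝ :=
  p.toFun t (D.coroot i)

/-- `m_i^π`, the minimum of the integers that are values of `H_i^π`. -/
noncomputable def minHeight (D : BorcherdsCartanDatum A Y) (i : I) (p : WeightPath Y) : ℤ :=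
  sInf {z : ℤ | ∃ t, D.height i p t = z}

/-- `f_+^i(π)`, the maximum of the `t` with `H_i^π(t) = m_i^π`. -/
noncomputable def fPlus (D : BorcherdsCartanDatum A Y) (i : I) (p : WeightPath Y) : unitInterval :=
  sSup {t | D.height i p t = D.minHeight i p}

/-- `f_-^i(π)`, the minimum of the `t ≥ f_+^i(π)` with `H_i^π(t) = m_i^π + 1`. -/
noncomputable def fMinus (D : BorcherdsCartanDatum A Y) (i : I) (p : WeightPath Y) : unitInterval :=
  sInf {t | D.fPlus i p ≤ t ∧ D.height i p t = D.minHeight i p + 1}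

theorem isPL_height (D : BorcherdsCartanDatum A Y) (i : I) (p : WeightPath Y) :
    IsPL (D.height i p) := by
  obtain ⟨S, hS⟩ := p.isPL
  refine ⟨S, fun a b hab h => ?_⟩
  obtain ⟨v, w, hvw⟩ := hS a b hab h
  exact ⟨v (D.coroot i), w (D.coroot i), fun t h1 h2 => by simp [height, hvw t h1 h2]⟩

theorem continuous_height (D : BorcherdsCartanDatum A Y) (i : I) (p : WeightPath Y) :
    Continuous (D.height i p) :=
  (D.isPL_height i p).continuous

/-- `m_i^π` is attained and is a lower bound. -/
theorem isLeast_minHeight (D : BorcherdsCartanDatum A Y) (i : I) (p : WeightPath Y) :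
    IsLeast {z : ℤ | ∃ t, D.height i p t = z} (D.minHeight i p) := by
  have hne : {z : ℤ | ∃ t, D.height i p t = z}.Nonempty :=
    ⟨0, 0, by simp [height, p.map_zero]⟩
  have hbdd : BddBelow {z : ℤ | ∃ t, D.height i p t = z} := by
    obtain ⟨x, -, hx⟩ := isCompact_univ.exists_isMinOn Set.univ_nonempty
      (D.continuous_height i p).continuousOn
    refine ⟨⌊D.height i p x⌋, ?_⟩
    rintro z ⟨t, ht⟩
    have h1 : D.height i p x ≤ D.height i p t := hx (Set.mem_univ t)
    rw [ht] at h1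
    exact_mod_cast (Int.floor_le _).trans h1
  exact ⟨Int.csInf_mem hne hbdd, fun z hz => csInf_le hbdd hz⟩

/-- `f_+^i(π)` is attained. -/
theorem isGreatest_fPlus (D : BorcherdsCartanDatum A Y) (i : I) (p : WeightPath Y) :
    IsGreatest {t | D.height i p t = D.minHeight i p} (D.fPlus i p) := by
  have hcl : IsClosed {t | D.height i p t = D.minHeight i p} :=
    isClosed_eq (D.continuous_height i p) continuous_const
  exact hcl.isCompact.isGreatest_sSup (D.isLeast_minHeight i p).1

/-- If `f_+^i(π) < 1`, then `f_-^i(π)` is attained. -/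
theorem isLeast_fMinus (D : BorcherdsCartanDatum A Y) (i : I) (p : WeightPath Y)
    (h : D.fPlus i p < 1) :
    IsLeast {t | D.fPlus i p ≤ t ∧ D.height i p t = D.minHeight i p + 1} (D.fMinus i p) := by
  have hcl : IsClosed {t | D.fPlus i p ≤ t ∧ D.height i p t = D.minHeight i p + 1} :=
    isClosed_Ici.inter (isClosed_eq (D.continuous_height i p) continuous_const)
  refine hcl.isCompact.isLeast_sInf ?_
  obtain ⟨μ, hμ⟩ := p.map_one
  have h1 : D.height i p 1 = ((μ (D.coroot i) : ℤ) : ℝ) := by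
    rw [height, hμ, realWeight_apply]
  have hle : D.minHeight i p ≤ μ (D.coroot i) := (D.isLeast_minHeight i p).2 ⟨1, h1⟩
  have hne : D.minHeight i p ≠ μ (D.coroot i) := by
    intro he
    exact absurd ((D.isGreatest_fPlus i p).2 (show D.height i p 1 = D.minHeight i p by
      rw [h1, he])) (not_le.2 h)
  have hlt : D.minHeight i p + 1 ≤ μ (D.coroot i) := by omega
  have hmem : ((D.minHeight i p : ℝ) + 1) ∈
      Set.Icc (D.height i p (D.fPlus i p)) (D.height i p 1) := by
    rw [h1, (D.isGreatest_fPlus i p).1]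
    exact ⟨by linarith, by exact_mod_cast hlt⟩
  obtain ⟨t, ht, hteq⟩ := intermediate_value_Icc h.le (D.continuous_height i p).continuousOn hmem
  exact ⟨t, ht.1, hteq⟩

open Classical in
/-- The root operator `f_i : ℙ → ℙ ⊔ {𝟎}`, for real and for imaginary `i`; `none` is `𝟎`. -/
noncomputable def rootOperator (D : BorcherdsCartanDatum A Y) (i : I) (p : WeightPath Y) :
    Option (WeightPath Y) :=
  if h : D.fPlus i p < 1 then
    some
      { toFun := fun t =>
          if t ≤ D.fPlus i p then p.toFun t
          else if t ≤ D.fMinus i p then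
            p.toFun t - (D.height i p t - D.minHeight i p) • realWeight (D.root i)
          else p.toFun t - realWeight (D.root i)
        isPL := by
          have hm := D.isLeast_fMinus i p h
          have hp := (D.isGreatest_fPlus i p).1
          have hpm : D.fPlus i p ≤ D.fMinus i p := hm.1.1
          obtain ⟨S, hS⟩ := p.isPL
          refine ⟨insert ((D.fPlus i p : unitInterval) : ℝ)
            (insert ((D.fMinus i p : unitInterval) : ℝ) S), fun a b hab hab' => ?_⟩
          obtain ⟨v, w, hvw⟩ := hS a b hab fun s hs => hab' s (by simp [hs])
          have h1 : ¬(a < D.fPlus i p ∧ D.fPlus i p < b) :=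
            hab' _ (Finset.mem_insert_self _ _)
          have h2 : ¬(a < D.fMinus i p ∧ D.fMinus i p < b) :=
            hab' _ (Finset.mem_insert_of_mem (Finset.mem_insert_self _ _))
          by_cases hb : b ≤ D.fPlus i p
          · exact ⟨v, w, fun t hat htb => by
              dsimp only; rw [if_pos (htb.trans hb)]; exact hvw t hat htb⟩
          have ha : D.fPlus i p ≤ a := not_lt.1 fun hc => h1 ⟨hc, not_le.1 hb⟩
          by_cases hb2 : b ≤ D.fMinus i p
          · refine ⟨v - (v (D.coroot i) - D.minHeight i p) • realWeight (D.root i),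
              w - w (D.coroot i) • realWeight (D.root i), fun t hat htb => ?_⟩
            have hH : D.height i p t = v (D.coroot i) + (t : ℝ) * w (D.coroot i) := by
              simp [height, hvw t hat htb]
            have e : p.toFun t - (D.height i p t - D.minHeight i p) • realWeight (D.root i) =
                v - (v (D.coroot i) - D.minHeight i p) • realWeight (D.root i) +
                  (t : ℝ) • (w - w (D.coroot i) • realWeight (D.root i)) := by
              rw [hH, hvw t hat htb]; module
            dsimp only
            by_cases ht : t ≤ D.fPlus i p
            · have hte : t = D.fPlus i p := le_antisymm ht (ha.trans hat)
              rw [if_pos ht, ← e, hte, hp, sub_self, zero_smul, sub_zero]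
            · rw [if_neg ht, if_pos (htb.trans hb2), e]
          · have ha2 : D.fMinus i p ≤ a := not_lt.1 fun hc => h2 ⟨hc, not_le.1 hb2⟩
            have hne : ∀ t, D.height i p t = D.minHeight i p + 1 → t ≠ D.fPlus i p := by
              rintro t ht rfl
              rw [hp] at ht
              linarith
            refine ⟨v - realWeight (D.root i), w, fun t hat htb => ?_⟩
            have hlt : ¬ t ≤ D.fPlus i p := by
              intro ht
              exact hne _ hm.1.2 (le_antisymm ((ha2.trans hat).trans ht) hpm)
            dsimp only
            rw [if_neg hlt]
            by_cases ht : t ≤ D.fMinus i p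
            · have hte : t = D.fMinus i p := le_antisymm ht (ha2.trans hat)
              have hH : D.height i p t - D.minHeight i p = 1 := by
                rw [hte, hm.1.2]; ring
              rw [if_pos ht, hH, hvw t hat htb]
              module
            · rw [if_neg ht, hvw t hat htb]
              module
        map_zero := by
          rw [if_pos (show (0 : unitInterval) ≤ D.fPlus i p from bot_le)]
          exact p.map_zero
        map_one := by
          obtain ⟨μ, hμ⟩ := p.map_one
          refine ⟨μ - D.root i, ?_⟩
          have e : realWeight (μ - D.root i) = p.toFun 1 - realWeight (D.root i) := by
            rw [hμ]; ext y; simp [realWeight_apply]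
          rw [if_neg (not_le.2 h), e]
          by_cases h1 : 1 ≤ D.fMinus i p
          · have hm := (D.isLeast_fMinus i p h).1.2
            have h1' : D.fMinus i p = 1 := le_antisymm le_top h1
            rw [h1'] at hm
            rw [if_pos h1, hm, add_sub_cancel_left, one_smul]
          · rw [if_neg h1] }
  else none

/-- `f_i` as a self-map of `ℙ ⊔ {𝟎}`, with `f_i 𝟎 = 𝟎`. -/
noncomputable def f (D : BorcherdsCartanDatum A Y) (i : I) : Function.End (Option (WeightPath Y)) :=
  fun x => x.bind (D.rootOperator i)

/-- The monoid `ℱ` generated by the root operators `f_i`, under composition. -/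
def rootMonoid (D : BorcherdsCartanDatum A Y) : Submonoid (Function.End (Option (WeightPath Y))) :=
  Submonoid.closure (Set.range D.f)

/-- `F_𝐢 = f_{i_k} ⋯ f_{i_2} f_{i_1}`, as an element of `ℱ`, for `𝐢 = (i_k, …, i_2, i_1)`. -/
noncomputable def word (D : BorcherdsCartanDatum A Y) (l : List I) : D.rootMonoid :=
  (l.map fun i => (⟨D.f i, Submonoid.subset_closure ⟨i, rfl⟩⟩ : D.rootMonoid)).prod

/-- The set `ℱ π ⊆ ℙ ⊔ {𝟎}`. -/
def orbit (D : BorcherdsCartanDatum A Y) (p : WeightPath Y) : Set (Option (WeightPath Y)) :=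
  {x | ∃ F : D.rootMonoid, F.1 (some p) = x}

/-- `F_𝐢 π`, as an element of `ℱ π`. -/
noncomputable def applyWord (D : BorcherdsCartanDatum A Y) (l : List I) (p : WeightPath Y) :
    D.orbit p :=
  ⟨(D.word l).1 (some p), D.word l, rfl⟩

/-- The action of `f_i` on `ℱ π`. -/
noncomputable def fOrbit (D : BorcherdsCartanDatum A Y) (i : I) {p : WeightPath Y} (x : D.orbit p) :
    D.orbit p :=
  ⟨D.f i x.1, by
    obtain ⟨F, hF⟩ := x.2
    exact ⟨⟨D.f i, Submonoid.subset_closure ⟨i, rfl⟩⟩ * F, by rw [← hF]; rfl⟩⟩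

end BorcherdsCartanDatum

/-! Each of the two paths of a word is its initial path minus a combination of simple roots, and one
family `c` of coefficients, indexed by `TildeIndex A`, serves both (`Realizes`). The relevant
heights agree: `A` and the tilde matrix differ only at the diagonal entry of an imaginary copy, and
the copy about to be used still has coefficient zero. A root operator depends on the height alone,
so the two paths vanish together and otherwise acquire the same new coefficient (`word_twin`). The
simple roots of the Cartan datum are independent, so the twin determines `c` and hence the original
path; this is injectivity.

Well-definedness is the hard direction, because the original path determines only the sum of the
coefficients over the copies of an imaginary index. The summands can be recovered. On each of the
`n` subintervals every one of them is a ramp `min 1 (a τ)` or the constant 1, later copies dominate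
earlier ones, and a sum of ramps determines the ramps up to order (`eq_of_sum_ramp_eq`).

The ramps come from Lakshmibai-Seshadri theory for the tilde matrix. Within a subinterval the
velocities on the two sides of a time are joined by a chain of Bruhat covers with an integrality
condition, and root operators preserve this (`IsLS.add_bump`). All velocities have finitely many
inversions, which for the initial weights is where membership in the Tits cone enters
(`finite_inversions_titsCone`). An unused copy of an imaginary index has infinitely many
indistinguishable companions, so a negative slope of its height would produce infinitely many
inversions. Hence this height `H` is monotone and the new coefficient is `min 1 H`
(`IsProfile.bump_eq_min`). Along a chain the slope of `H` can only drop, and on a subinterval where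
`H` starts from 0 integrality forbids a drop before `H` reaches 1 (`IsFresh.exists_ramp`).

Weights are written `Λ - x` with `x` in the root lattice, and the number of inversions serves as
their length. The input on roots is that a real root and its coroot have a common sign
(`act_nonneg_or_nonpos`). -/

/-! # Roots of a Cartan matrix -/

namespace CartanRoot

open Finsupp

variable {J : Type*} (C : Matrix J J ℤ)

/-- The pairing of the root lattice with the coroot lattice. -/
noncomputable def pairing : (J →₀ ℤ) →ₗ[ℤ] (J →₀ ℤ) →ₗ[ℤ] ℤ :=
  linearCombination ℤ fun k => linearCombination ℤ fun j => C j k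

@[simp] theorem pairing_single (k j : J) : pairing C (single k 1) (single j 1) = C j k := by
  simp [pairing]

/-- The simple reflection on the root lattice. -/
noncomputable def sx (a : J) : Module.End ℤ (J →₀ ℤ) :=
  LinearMap.id - ((pairing C).flip (single a 1)).smulRight (single a 1)

/-- The simple reflection on the coroot lattice. -/
noncomputable def sy (a : J) : Module.End ℤ (J →₀ ℤ) :=
  LinearMap.id - (pairing C (single a 1)).smulRight (single a 1)

theorem sx_apply (a : J) (x : J →₀ ℤ) :
    sx C a x = x - pairing C x (single a 1) • single a 1 := rfl

theorem sy_apply (a : J) (y : J →₀ ℤ) :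
    sy C a y = y - pairing C (single a 1) y • single a 1 := rfl

/-- The simultaneous action of a word in the simple reflections on roots and coroots. -/
noncomputable def act (w : List J) : Module.End ℤ (J →₀ ℤ) × Module.End ℤ (J →₀ ℤ) :=
  (w.map fun a => (sx C a, sy C a)).prod

@[simp] theorem act_nil : act C [] = 1 := rfl

theorem act_append (u v : List J) : act C (u ++ v) = act C u * act C v := by simp [act]

theorem act_cons (a : J) (v : List J) : act C (a :: v) = act C [a] * act C v := by simp [act]

theorem act_singleton (a : J) : act C [a] = (sx C a, sy C a) := by simp [act]

variable {C} (hd : ∀ j, C j j = 2)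

include hd in
theorem act_mul_self (a : J) : act C [a] * act C [a] = 1 := by
  rw [act_singleton]
  ext1 <;> refine LinearMap.ext fun x => ?_
  · simp only [Prod.fst_mul, Module.End.mul_apply, sx_apply, map_sub, map_smul,
      LinearMap.sub_apply, LinearMap.smul_apply, pairing_single, hd, Prod.fst_one,
      Module.End.one_apply]
    module
  · simp only [Prod.snd_mul, Module.End.mul_apply, sy_apply, map_sub, map_smul,
      pairing_single, hd, Prod.snd_one,
      Module.End.one_apply]
    module

/-! ### Rank two: alternating words in two reflections. -/

/-- The alternating word in `s` and `t` of the given length that ends with `t`. -/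
def alt (s t : J) : ℕ → List J
  | 0 => []
  | k + 1 => alt t s k ++ [t]

@[simp] theorem length_alt (s t : J) (k : ℕ) : (alt s t k).length = k := by
  induction k generalizing s t with
  | zero => simp [alt]
  | succ k ih => simp [alt, ih]

theorem exists_alt_add (s t : J) (j k : ℕ) : ∃ y, y.length = j ∧ alt s t (j + k) = y ++ alt s t k := by
  induction k generalizing s t with
  | zero => exact ⟨alt s t j, by simp [alt]⟩
  | succ k ih =>
    obtain ⟨y, hy, h⟩ := ih t s
    exact ⟨y, hy, by rw [← add_assoc, alt, h, alt, List.append_assoc]⟩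

/-- The coefficients of `s` and `t` in the image of `x + P s + Q t` under an alternating word, where
`x` has the pairings `hs` and `ht` with the simple coroots. -/
def altCoeff (A B : ℤ) : ℕ → ℤ → ℤ → ℤ → ℤ → ℤ × ℤ
  | 0, _, _, P, Q => (P, Q)
  | k + 1, hs, ht, P, Q => (altCoeff B A k ht hs (-ht - Q + B * P) P).swap

-- The general `x` allows two uses: `P = Q = 0` compares the actions of two words, and `x = 0`, `P =
-- 1` computes the image of a simple root.
include hd in
theorem act_alt_fst (s t : J) (k : ℕ) (x : J →₀ ℤ) (P Q : ℤ) :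
    (act C (alt s t k)).1 (x + P • single s 1 + Q • single t 1) =
      x + (altCoeff (-C s t) (-C t s) k (pairing C x (single s 1)) (pairing C x (single t 1)) P Q).1 •
        single s 1 +
      (altCoeff (-C s t) (-C t s) k (pairing C x (single s 1)) (pairing C x (single t 1)) P Q).2 •
        single t 1 := by
  induction k generalizing s t P Q with
  | zero => simp [alt, altCoeff]
  | succ k ih =>
    have h : (act C [t]).1 (x + P • single s 1 + Q • single t 1) =
        x + (-pairing C x (single t 1) - Q + (-C t s) * P) • single t 1 + P • single s 1 := by
      simp only [act_singleton, sx_apply, map_add, map_smul, LinearMap.add_apply,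
        LinearMap.smul_apply, pairing_single, hd, smul_eq_mul]
      module
    rw [alt, act_append, Prod.fst_mul, Module.End.mul_apply, h, ih, altCoeff]
    simp only [Prod.fst_swap, Prod.snd_swap]
    abel

include hd in
theorem act_alt_snd (s t : J) (k : ℕ) (x : J →₀ ℤ) (P Q : ℤ) :
    (act C (alt s t k)).2 (x + P • single s 1 + Q • single t 1) =
      x + (altCoeff (-C t s) (-C s t) k (pairing C (single s 1) x) (pairing C (single t 1) x) P Q).1 •
        single s 1 +
      (altCoeff (-C t s) (-C s t) k (pairing C (single s 1) x) (pairing C (single t 1) x) P Q).2 •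
        single t 1 := by
  induction k generalizing s t P Q with
  | zero => simp [alt, altCoeff]
  | succ k ih =>
    have h : (act C [t]).2 (x + P • single s 1 + Q • single t 1) =
        x + (-pairing C (single t 1) x - Q + (-C s t) * P) • single t 1 + P • single s 1 := by
      simp only [act_singleton, sy_apply, map_add, map_smul, pairing_single, hd, smul_eq_mul]
      module
    rw [alt, act_append, Prod.snd_mul, Module.End.mul_apply, h, ih, altCoeff]
    simp only [Prod.fst_swap, Prod.snd_swap]
    abel

/-- The inequality `2 * Q ≤ B * P` is an invariant. It makes the new coefficient `B * P - Q`
nonnegative, and `4 ≤ A * B` carries it to the next step with `A` and `B` exchanged. -/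
theorem altCoeff_nonneg_of_four_le {A B : ℤ} (hA : 0 ≤ A) (hB : 0 ≤ B) (h : 4 ≤ A * B) (k : ℕ)
    {P Q : ℤ} (hP : 0 ≤ P) (hQ : 0 ≤ Q) (hPQ : 2 * Q ≤ B * P) :
    0 ≤ (altCoeff A B k 0 0 P Q).1 ∧ 0 ≤ (altCoeff A B k 0 0 P Q).2 := by
  induction k generalizing A B P Q with
  | zero => simp [altCoeff, hP, hQ]
  | succ k ih =>
    rw [altCoeff]
    have := ih (A := B) (B := A) (P := -0 - Q + B * P) (Q := P) hB hA (by linarith) (by nlinarith) hP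
      (by nlinarith [mul_le_mul_of_nonneg_left hPQ hA, mul_le_mul_of_nonneg_right h hP])
    exact ⟨this.2, this.1⟩

/-- The order of the product of two simple reflections, for small entries of the matrix. -/
theorem exists_braid {A B : ℤ} (hA : 0 ≤ A) (hB : 0 ≤ B) (hAB : A = 0 ↔ B = 0) (h : A * B < 4) :
    ∃ m, 1 ≤ m ∧ (∀ hs ht, altCoeff A B m hs ht 0 0 = (altCoeff B A m ht hs 0 0).swap ∧
        altCoeff B A m hs ht 0 0 = (altCoeff A B m ht hs 0 0).swap) ∧
      ∀ k < m, (0 ≤ (altCoeff A B k 0 0 1 0).1 ∧ 0 ≤ (altCoeff A B k 0 0 1 0).2) ∧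
        (0 ≤ (altCoeff B A k 0 0 1 0).1 ∧ 0 ≤ (altCoeff B A k 0 0 1 0).2) := by
  have hA4 : A < 4 := by
    by_contra hc
    rcases hB.eq_or_lt with h0 | h0
    · have := hAB.2 h0.symm; omega
    · nlinarith
  have hB4 : B < 4 := by
    by_contra hc
    rcases hA.eq_or_lt with h0 | h0
    · have := hAB.1 h0.symm; omega
    · nlinarith
  -- The surviving cases are the types A₁ × A₁, A₂, B₂ and G₂, the last two in both orientations,
  -- with `m` equal to 2, 3, 4 and 6.
  interval_cases A <;> interval_cases B <;> try (exfalso; omega)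
  · refine ⟨2, by norm_num, fun hs ht => ?_, fun k hk => ?_⟩
    · simp [altCoeff]
    · interval_cases k <;> simp [altCoeff]
  · refine ⟨3, by norm_num, fun hs ht => ?_, fun k hk => ?_⟩
    · simp [altCoeff]; omega
    · interval_cases k <;> simp [altCoeff]
  · refine ⟨4, by norm_num, fun hs ht => ?_, fun k hk => ?_⟩
    · simp [altCoeff]; omega
    · interval_cases k <;> simp [altCoeff]
  · refine ⟨6, by norm_num, fun hs ht => ?_, fun k hk => ?_⟩
    · simp [altCoeff]; omega
    · interval_cases k <;> simp [altCoeff]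
  · refine ⟨4, by norm_num, fun hs ht => ?_, fun k hk => ?_⟩
    · simp [altCoeff]; omega
    · interval_cases k <;> simp [altCoeff]
  · refine ⟨6, by norm_num, fun hs ht => ?_, fun k hk => ?_⟩
    · simp [altCoeff]; omega
    · interval_cases k <;> simp [altCoeff]

end CartanRoot

/-! ### Reduced words and the sign of real roots. -/

namespace CartanRoot

open Finsupp

variable {J : Type*} {C : Matrix J J ℤ} (hd : ∀ j, C j j = 2)

-- This is the braid relation. There are two hypotheses because passing from roots to coroots
-- exchanges the two off-diagonal entries.
include hd in
theorem act_alt_eq (s t : J) (m : ℕ)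
    (h : ∀ hs ht, altCoeff (-C s t) (-C t s) m hs ht 0 0 =
      (altCoeff (-C t s) (-C s t) m ht hs 0 0).swap)
    (h' : ∀ hs ht, altCoeff (-C t s) (-C s t) m hs ht 0 0 =
      (altCoeff (-C s t) (-C t s) m ht hs 0 0).swap) :
    act C (alt s t m) = act C (alt t s m) := by
  ext1 <;> refine LinearMap.ext fun x => ?_
  · have h1 := act_alt_fst hd s t m x 0 0
    have h2 := act_alt_fst hd t s m x 0 0
    simp only [zero_smul, add_zero] at h1 h2
    rw [h1, h2, h, Prod.fst_swap, Prod.snd_swap]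
    abel
  · have h1 := act_alt_snd hd s t m x 0 0
    have h2 := act_alt_snd hd t s m x 0 0
    simp only [zero_smul, add_zero] at h1 h2
    rw [h1, h2, h', Prod.fst_swap, Prod.snd_swap]
    abel

-- If the last letter were `s`, deleting it would give a word for `u ++ [s]` shorter than `u`. So it
-- is `t`, and the word without it satisfies the same hypotheses with `s` and `t` exchanged.
include hd in
theorem eq_alt_of_reduced (s t : J) (u : List J) (hu : ∀ r ∈ u, r = s ∨ r = t)
    (h1 : ∀ v, act C v = act C u → u.length ≤ v.length)
    (h2 : ∀ v, act C v = act C (u ++ [s]) → u.length ≤ v.length) : u = alt s t u.length := by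
  induction u using List.reverseRecOn generalizing s t with
  | nil => simp [alt]
  | append_singleton u r ih =>
    have hr : r = t := by
      refine (hu r (by simp)).resolve_left ?_
      rintro rfl
      have := h2 u (by rw [act_append, act_append, mul_assoc, act_mul_self hd, mul_one])
      simp at this
    subst hr
    have hu' := ih r s (fun q hq => (hu q (by simp [hq])).symm)
      (fun v hv => by
        have := h1 (v ++ [r]) (by rw [act_append, act_append, hv])
        simpa using this)
      (fun v hv => by
        have := h1 v hv
        simp at this
        omega)
    rw [List.length_append, List.length_singleton, alt, ← hu']

-- The word is alternating. If the product of the off-diagonal entries is at least 4, all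
-- coefficients stay nonnegative; otherwise they do so below the order `m` of the braid relation,
-- and a word of length at least `m` would contradict `h2`.
include hd in
theorem exists_nonneg_of_reduced (hC : IsBorcherdsCartan C) {s t : J} (hst : s ≠ t) (u : List J)
    (hu : ∀ r ∈ u, r = s ∨ r = t)
    (h1 : ∀ v, act C v = act C u → u.length ≤ v.length)
    (h2 : ∀ v, act C v = act C (u ++ [s]) → u.length ≤ v.length) :
    (∃ p q : ℤ, 0 ≤ p ∧ 0 ≤ q ∧ (act C u).1 (single s 1) = p • single s 1 + q • single t 1) ∧
    (∃ p q : ℤ, 0 ≤ p ∧ 0 ≤ q ∧ (act C u).2 (single s 1) = p • single s 1 + q • single t 1) := by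
  have hu' := eq_alt_of_reduced hd s t u hu h1 h2
  set k := u.length with hk
  have hA : 0 ≤ -C s t := by linarith [hC.offDiag s t hst]
  have hB : 0 ≤ -C t s := by linarith [hC.offDiag t s hst.symm]
  have hAB : -C s t = 0 ↔ -C t s = 0 := by
    rw [neg_eq_zero, neg_eq_zero]; exact hC.zero_iff s t hst
  have key : (0 ≤ (altCoeff (-C s t) (-C t s) k 0 0 1 0).1 ∧
        0 ≤ (altCoeff (-C s t) (-C t s) k 0 0 1 0).2) ∧
      (0 ≤ (altCoeff (-C t s) (-C s t) k 0 0 1 0).1 ∧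
        0 ≤ (altCoeff (-C t s) (-C s t) k 0 0 1 0).2) := by
    rcases le_or_gt 4 (-C s t * -C t s) with h4 | h4
    · exact ⟨altCoeff_nonneg_of_four_le hA hB h4 k zero_le_one le_rfl (by linarith),
        altCoeff_nonneg_of_four_le hB hA (by linarith) k zero_le_one le_rfl (by linarith)⟩
    · obtain ⟨m, hm, hbr, hpos⟩ := exists_braid hA hB hAB h4
      refine hpos k ?_
      by_contra hc
      obtain ⟨j, hj⟩ := Nat.exists_eq_add_of_le' (not_lt.1 hc)
      obtain ⟨y, hy, hyk⟩ := exists_alt_add s t j m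
      obtain ⟨m, rfl⟩ := Nat.exists_eq_add_of_le' hm
      -- Here `m` is the order minus one. The braid relation makes the final block of `u` end in
      -- `s`, and this `s` cancels against the one in `u ++ [s]`.
      have := h2 (y ++ alt s t m) (by
        rw [hu', hj, hyk, act_append, act_append, act_append,
          act_alt_eq hd s t _ (fun hs ht => (hbr hs ht).1) (fun hs ht => (hbr hs ht).2), alt,
          act_append, mul_assoc, mul_assoc, act_mul_self hd, mul_one])
      rw [List.length_append, length_alt, hy] at this
      omega
  rw [hu']
  constructor
  · have := act_alt_fst hd s t k 0 1 0
    simp only [one_smul, zero_smul, zero_add, add_zero, map_zero, LinearMap.zero_apply] at this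
    exact ⟨_, _, key.1.1, key.1.2, this⟩
  · have := act_alt_snd hd s t k 0 1 0
    simp only [one_smul, zero_smul, zero_add, add_zero, map_zero] at this
    exact ⟨_, _, key.2.1, key.2.2, this⟩

-- Factor the word as `v ++ u`, where `u` uses only `s` and the last letter `t`, lengths add up, and
-- `v` is as short as possible. Induction applies to `v` with both `s` and `t`, the rank-two case
-- applies to `u`, and nonnegative combinations of nonnegative vectors are nonnegative. Lengths are
-- measured among words with the same `act`, so no Coxeter presentation is involved.
include hd in
theorem act_nonneg_of_reduced (hC : IsBorcherdsCartan C) (w : List J)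
    (h1 : ∀ v, act C v = act C w → w.length ≤ v.length) (s : J)
    (h2 : ∀ v, act C v = act C (w ++ [s]) → w.length ≤ v.length) :
    0 ≤ (act C w).1 (single s 1) ∧ 0 ≤ (act C w).2 (single s 1) := by
  induction hN : w.length using Nat.strong_induction_on generalizing w s with
  | _ N ih =>
  have hs : (0 : J →₀ ℤ) ≤ single s 1 := single_nonneg.2 zero_le_one
  rcases List.eq_nil_or_concat' w with rfl | ⟨w', t, rfl⟩
  · simpa using hs
  have hst : s ≠ t := by
    rintro rfl
    have := h2 w' (by rw [act_append, act_append, mul_assoc, act_mul_self hd, mul_one])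
    simp at this
  let P : ℕ → Prop := fun k => ∃ v u, v.length = k ∧ act C (v ++ u) = act C (w' ++ [t]) ∧
    v.length + u.length = N ∧ ∀ r ∈ u, r = s ∨ r = t
  have hP : P w'.length := ⟨w', [t], rfl, rfl, by simpa using hN, by simp⟩
  classical
  obtain ⟨v, u, hvk, hvu, hlen, hu⟩ := Nat.find_spec ⟨_, hP⟩
  have hlt : v.length < N := by
    have h3 := Nat.find_le (h := ⟨_, hP⟩) hP
    simp only [List.length_append, List.length_singleton] at hN
    omega
  have hred : ∀ x, act C x = act C v → v.length ≤ x.length := by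
    intro x hx
    have := h1 (x ++ u) (by rw [act_append, hx, ← act_append, hvu])
    rw [hN, List.length_append] at this
    omega
  have hasc : ∀ r, r = s ∨ r = t → ∀ x, act C x = act C (v ++ [r]) → v.length ≤ x.length := by
    intro r hr x hx
    by_contra hc
    -- A word `x` for `v ++ [r]` shorter than `v` would allow `r` to be moved into the second
    -- factor, against the minimality of `v`.
    have hx' : act C (x ++ (r :: u)) = act C (w' ++ [t]) := by
      rw [act_append, hx, act_append, act_cons C r u, mul_assoc, ← mul_assoc (act C [r]),
        act_mul_self hd, one_mul, ← act_append, hvu]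
    have h3 := h1 _ hx'
    simp only [List.length_append, List.length_cons, List.length_singleton] at h3 hN
    have : P x.length := ⟨x, r :: u, rfl, hx', by simp; omega, by
      intro q hq
      rcases List.mem_cons.1 hq with rfl | hq
      · exact hr
      · exact hu q hq⟩
    have := Nat.find_le (h := ⟨_, hP⟩) this
    omega
  obtain ⟨ps1, ps2⟩ := ih _ hlt v hred s (hasc s (Or.inl rfl)) rfl
  obtain ⟨pt1, pt2⟩ := ih _ hlt v hred t (hasc t (Or.inr rfl)) rfl
  obtain ⟨⟨p, q, hp, hq, e⟩, ⟨p', q', hp', hq', e'⟩⟩ := exists_nonneg_of_reduced hd hC hst u hu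
    (fun x hx => by
      have := h1 (v ++ x) (by rw [act_append, hx, ← act_append, hvu])
      rw [hN, List.length_append] at this
      omega)
    (fun x hx => by
      have := h2 (v ++ x) (by rw [act_append, hx, act_append, ← mul_assoc, ← act_append, hvu,
        ← act_append])
      rw [hN, List.length_append] at this
      omega)
  rw [← hvu, act_append]
  constructor
  · rw [Prod.fst_mul, Module.End.mul_apply, e, map_add, map_smul, map_smul]
    exact add_nonneg (smul_nonneg hp ps1) (smul_nonneg hq pt1)
  · rw [Prod.snd_mul, Module.End.mul_apply, e', map_add, map_smul, map_smul]
    exact add_nonneg (smul_nonneg hp' ps2) (smul_nonneg hq' pt2)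

theorem exists_reduced (w : List J) :
    ∃ u, act C u = act C w ∧ ∀ v, act C v = act C u → u.length ≤ v.length := by
  classical
  have h : ∃ k, ∃ u, u.length = k ∧ act C u = act C w := ⟨_, w, rfl, rfl⟩
  obtain ⟨u, hu, huw⟩ := Nat.find_spec h
  exact ⟨u, huw, fun v hv => hu ▸ Nat.find_le (h := h) ⟨v, rfl, hv.trans huw⟩⟩

include hd in
/-- A real root and its coroot are both nonnegative or both nonpositive. -/
theorem act_nonneg_or_nonpos (hC : IsBorcherdsCartan C) (w : List J) (s : J) :
    (0 ≤ (act C w).1 (single s 1) ∧ 0 ≤ (act C w).2 (single s 1)) ∨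
      ((act C w).1 (single s 1) ≤ 0 ∧ (act C w).2 (single s 1) ≤ 0) := by
  obtain ⟨u, huw, hu⟩ := exists_reduced (C := C) w
  rw [← huw]
  by_cases h : ∀ v, act C v = act C (u ++ [s]) → u.length ≤ v.length
  · exact Or.inl (act_nonneg_of_reduced hd hC u hu s h)
  · right
    -- In the descending case the nonnegative case applies to `x`, and the sign changes because a
    -- simple reflection negates its own root and coroot.
    obtain ⟨x, hx, hxr⟩ := exists_reduced (C := C) (u ++ [s])
    have hxs : act C (x ++ [s]) = act C u := by
      rw [act_append, hx, act_append, mul_assoc, act_mul_self hd, mul_one]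
    have hlt : x.length < u.length := by
      push Not at h
      obtain ⟨y, hy, hyl⟩ := h
      exact (hxr y (hy.trans hx.symm)).trans_lt hyl
    have := act_nonneg_of_reduced hd hC x hxr s
      (fun v hv => hlt.le.trans (hu v (hv.trans hxs)))
    rw [← hxs, act_append, Prod.fst_mul, Prod.snd_mul, Module.End.mul_apply, Module.End.mul_apply,
      act_singleton]
    have e1 : sx C s (single s 1) = -single s 1 := by
      rw [sx_apply, pairing_single, hd]; module
    have e2 : sy C s (single s 1) = -single s 1 := by
      rw [sy_apply, pairing_single, hd]; module
    dsimp only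
    rw [e1, e2, map_neg, map_neg]
    exact ⟨neg_nonpos.2 this.1, neg_nonpos.2 this.2⟩

end CartanRoot

/-! ### Reflections in real roots and positive roots. -/

namespace CartanRoot

open Finsupp

variable {J : Type*} (C : Matrix J J ℤ)

/-- The reflection in a real root, acting on pairs of a root and its coroot. -/
noncomputable def reflect (ρ σ : (J →₀ ℤ) × (J →₀ ℤ)) : (J →₀ ℤ) × (J →₀ ℤ) :=
  (σ.1 - pairing C σ.1 ρ.2 • ρ.1, σ.2 - pairing C ρ.1 σ.2 • ρ.2)

/-- The pair of a simple root and its coroot. -/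
noncomputable def simple (a : J) : (J →₀ ℤ) × (J →₀ ℤ) := (single a 1, single a 1)

/-- The pairs of a real root and its coroot. -/
def IsRoot (ρ : (J →₀ ℤ) × (J →₀ ℤ)) : Prop :=
  ∃ w s, ρ = ((act C w).1 (single s 1), (act C w).2 (single s 1))

/-- The pairs of a positive real root and its coroot. -/
def IsPosRoot (ρ : (J →₀ ℤ) × (J →₀ ℤ)) : Prop := IsRoot C ρ ∧ 0 ≤ ρ

variable {C}

theorem isRoot_simple (a : J) : IsRoot C (simple a) := ⟨[], a, by simp [simple]⟩

theorem isPosRoot_simple (a : J) : IsPosRoot C (simple a) :=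
  ⟨isRoot_simple a, single_nonneg.2 zero_le_one, single_nonneg.2 zero_le_one⟩

theorem IsRoot.reflect_simple {ρ : (J →₀ ℤ) × (J →₀ ℤ)} (h : IsRoot C ρ) (a : J) :
    IsRoot C (reflect C (simple a) ρ) := by
  obtain ⟨w, s, rfl⟩ := h
  exact ⟨a :: w, s, by rw [act_cons, act_singleton]; rfl⟩

variable (hd : ∀ j, C j j = 2)

theorem pairing_reflect {ρ : (J →₀ ℤ) × (J →₀ ℤ)} (hρ : pairing C ρ.1 ρ.2 = 2)
    (σ τ : (J →₀ ℤ) × (J →₀ ℤ)) :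
    pairing C (reflect C ρ σ).1 (reflect C ρ τ).2 = pairing C σ.1 τ.2 := by
  simp only [reflect, map_sub, map_smul, LinearMap.sub_apply, LinearMap.smul_apply, hρ, smul_eq_mul]
  ring

theorem reflect_reflect {ρ : (J →₀ ℤ) × (J →₀ ℤ)} (hρ : pairing C ρ.1 ρ.2 = 2)
    (σ : (J →₀ ℤ) × (J →₀ ℤ)) : reflect C ρ (reflect C ρ σ) = σ := by
  ext1
  · simp only [reflect, map_sub, map_smul, LinearMap.sub_apply, LinearMap.smul_apply, hρ]
    module
  · simp only [reflect, map_sub, map_smul, hρ]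
    module

theorem reflect_conj {ρ : (J →₀ ℤ) × (J →₀ ℤ)} (hρ : pairing C ρ.1 ρ.2 = 2)
    (σ τ : (J →₀ ℤ) × (J →₀ ℤ)) :
    reflect C (reflect C ρ σ) (reflect C ρ τ) = reflect C ρ (reflect C σ τ) := by
  ext1
  · simp only [reflect, map_sub, map_smul, LinearMap.sub_apply, LinearMap.smul_apply, hρ, smul_eq_mul]
    module
  · simp only [reflect, map_sub, map_smul, LinearMap.sub_apply, LinearMap.smul_apply, hρ, smul_eq_mul]
    module

include hd in
theorem pairing_simple (a : J) : pairing C (simple a).1 (simple a).2 = 2 := by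
  simp [simple, hd]

theorem IsRoot.induction {P : (J →₀ ℤ) × (J →₀ ℤ) → Prop} (h1 : ∀ s, P (simple s))
    (h2 : ∀ a ρ, IsRoot C ρ → P ρ → P (reflect C (simple a) ρ)) {ρ} (h : IsRoot C ρ) : P ρ := by
  obtain ⟨w, s, rfl⟩ := h
  induction w with
  | nil => exact h1 s
  | cons a w ih =>
    have := h2 a _ ⟨w, s, rfl⟩ ih
    rw [act_cons, act_singleton]
    exact this

include hd in
theorem IsRoot.pairing_self {ρ : (J →₀ ℤ) × (J →₀ ℤ)} (h : IsRoot C ρ) :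
    pairing C ρ.1 ρ.2 = 2 := by
  refine IsRoot.induction (P := fun ρ => pairing C ρ.1 ρ.2 = 2) (pairing_simple hd) ?_ h
  intro a ρ _ ih
  rw [pairing_reflect (pairing_simple hd a), ih]

-- The reflection in a reflected root is a conjugate of the reflection in the root, so induction on
-- `ρ` reduces the claim to simple reflections.
include hd in
theorem IsRoot.reflect {ρ σ : (J →₀ ℤ) × (J →₀ ℤ)} (hρ : IsRoot C ρ) (hσ : IsRoot C σ) :
    IsRoot C (reflect C ρ σ) := by
  refine IsRoot.induction (P := fun ρ => ∀ σ, IsRoot C σ → IsRoot C (CartanRoot.reflect C ρ σ))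
    (fun s σ h => h.reflect_simple s) ?_ hρ σ hσ
  intro a ρ _ ih σ hσ
  have h := (ih _ (hσ.reflect_simple a)).reflect_simple a
  rwa [← reflect_conj (pairing_simple hd a), reflect_reflect (pairing_simple hd a)] at h

include hd in
theorem IsRoot.ne_zero {ρ : (J →₀ ℤ) × (J →₀ ℤ)} (h : IsRoot C ρ) : ρ.1 ≠ 0 ∧ ρ.2 ≠ 0 := by
  have := h.pairing_self hd
  constructor <;> intro h0 <;> simp [h0] at this

variable (hC : IsBorcherdsCartan C)

include hd hC in
theorem IsRoot.pos_or_neg {ρ : (J →₀ ℤ) × (J →₀ ℤ)} (h : IsRoot C ρ) :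
    IsPosRoot C ρ ∨ ρ ≤ 0 := by
  obtain ⟨w, s, rfl⟩ := h
  rcases act_nonneg_or_nonpos hd hC w s with h | h
  · exact Or.inl ⟨⟨w, s, rfl⟩, h⟩
  · exact Or.inr h

/-- Only the coordinate at `a` changes, so every other coordinate is both nonnegative and
nonpositive. -/
theorem exists_eq_single {x : J →₀ ℤ} (a : J) (c : ℤ) (h : 0 ≤ x) (h' : x - c • single a 1 ≤ 0) :
    x = (x a) • single a 1 := by
  classical
  ext j
  by_cases hj : a = j
  · subst hj; simp
  · have := h' j
    have h0 := h j
    simp [hj] at this h0 ⊢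
    omega

include hd hC in
/-- A simple reflection permutes the other positive roots. -/
theorem IsPosRoot.reflect_simple {ρ : (J →₀ ℤ) × (J →₀ ℤ)} (h : IsPosRoot C ρ) {a : J}
    (ha : ρ ≠ simple a) : IsPosRoot C (CartanRoot.reflect C (simple a) ρ) := by
  refine ((h.1.reflect_simple a).pos_or_neg hd hC).resolve_right fun hn => ha ?_
  have e1 := exists_eq_single a _ h.2.1 hn.1
  have e2 := exists_eq_single a _ h.2.2 hn.2
  have h2 := h.1.pairing_self hd
  have p1 : 0 ≤ ρ.1 a := h.2.1 a
  have p2 : 0 ≤ ρ.2 a := h.2.2 a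
  rw [e1, e2] at h2
  simp only [map_smul, LinearMap.smul_apply, pairing_single, hd, smul_eq_mul] at h2
  -- The root and the coroot are now multiples of the simple ones, and their pairing 2 forces the
  -- two nonnegative factors to be 1.
  have h3 : ρ.1 a * ρ.2 a = 1 := by linarith
  have h4 : ρ.1 a = 1 := Int.eq_one_of_mul_eq_one_right p1 h3
  have h5 : ρ.2 a = 1 := by rw [h4] at h3; linarith
  ext1
  · rw [e1, h4, one_smul]; rfl
  · rw [e2, h5, one_smul]; rfl

/-! ### Weights and their inversions -/

/-- The value at a coroot of the weight `Λ - x`, where `x` is in the root lattice. -/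
noncomputable def ht (C : Matrix J J ℤ) (Λ : (J →₀ ℤ) →ₗ[ℤ] ℤ) (x y : J →₀ ℤ) : ℤ := Λ y - pairing C x y

/-- The reflection of the weight `Λ - x` in a real root. -/
noncomputable def move (C : Matrix J J ℤ) (Λ : (J →₀ ℤ) →ₗ[ℤ] ℤ) (ρ : (J →₀ ℤ) × (J →₀ ℤ))
    (x : J →₀ ℤ) : J →₀ ℤ := x + ht C Λ x ρ.2 • ρ.1

/-- The positive coroots that are negative on the weight `Λ - x`. -/
def inversions (C : Matrix J J ℤ) (Λ : (J →₀ ℤ) →ₗ[ℤ] ℤ) (x : J →₀ ℤ) :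
    Set ((J →₀ ℤ) × (J →₀ ℤ)) :=
  {ρ | IsPosRoot C ρ ∧ ht C Λ x ρ.2 < 0}

variable {Λ : (J →₀ ℤ) →ₗ[ℤ] ℤ}

theorem ht_move {ρ : (J →₀ ℤ) × (J →₀ ℤ)} (hρ : pairing C ρ.1 ρ.2 = 2) (x : J →₀ ℤ)
    (σ : (J →₀ ℤ) × (J →₀ ℤ)) :
    ht C Λ (move C Λ ρ x) (reflect C ρ σ).2 = ht C Λ x σ.2 := by
  simp only [ht, move, reflect, map_sub, map_add, map_smul, LinearMap.add_apply,
    LinearMap.smul_apply, hρ, smul_eq_mul]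
  ring

theorem ht_move_self {ρ : (J →₀ ℤ) × (J →₀ ℤ)} (hρ : pairing C ρ.1 ρ.2 = 2) (x : J →₀ ℤ) :
    ht C Λ (move C Λ ρ x) ρ.2 = -ht C Λ x ρ.2 := by
  simp only [ht, move, map_add, map_smul, LinearMap.add_apply, LinearMap.smul_apply, hρ, smul_eq_mul]
  ring

theorem ht_move' {ρ : (J →₀ ℤ) × (J →₀ ℤ)} (hρ : pairing C ρ.1 ρ.2 = 2) (x : J →₀ ℤ)
    (σ : (J →₀ ℤ) × (J →₀ ℤ)) :
    ht C Λ (move C Λ ρ x) σ.2 = ht C Λ x (reflect C ρ σ).2 := by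
  rw [← ht_move hρ x (reflect C ρ σ), reflect_reflect hρ]

theorem move_move {ρ : (J →₀ ℤ) × (J →₀ ℤ)} (hρ : pairing C ρ.1 ρ.2 = 2) (x : J →₀ ℤ) :
    move C Λ ρ (move C Λ ρ x) = x := by
  rw [move, ht_move_self hρ, move]
  module

theorem move_conj {ρ : (J →₀ ℤ) × (J →₀ ℤ)} (hρ : pairing C ρ.1 ρ.2 = 2)
    (σ : (J →₀ ℤ) × (J →₀ ℤ)) (x : J →₀ ℤ) :
    move C Λ (reflect C ρ σ) (move C Λ ρ x) = move C Λ ρ (move C Λ σ x) := by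
  have h : ht C Λ (move C Λ ρ x) (reflect C ρ σ).2 = ht C Λ x σ.2 := ht_move hρ x σ
  rw [move, h, move, move, move]
  simp only [ht, map_add, map_smul, LinearMap.add_apply, LinearMap.smul_apply, smul_eq_mul, reflect]
  module

theorem reflect_self {ρ : (J →₀ ℤ) × (J →₀ ℤ)} (hρ : pairing C ρ.1 ρ.2 = 2) : reflect C ρ ρ = -ρ := by
  ext1
  · simp only [reflect, hρ, Prod.fst_neg]; module
  · simp only [reflect, hρ, Prod.snd_neg]; module

theorem eq_neg_of_reflect_eq {ρ σ : (J →₀ ℤ) × (J →₀ ℤ)} (hρ : pairing C ρ.1 ρ.2 = 2)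
    (h : reflect C ρ σ = ρ) : σ = -ρ := by
  have := congrArg (reflect C ρ) h
  rwa [reflect_reflect hρ, reflect_self hρ] at this

-- The simple reflection permutes the positive roots other than its own, and its own coroot turns
-- negative on the new weight.
include hd hC in
theorem inversions_move_simple {a : J} {x : J →₀ ℤ} (h : 0 < ht C Λ x (single a 1)) :
    inversions C Λ (move C Λ (simple a) x) =
      insert (simple a) (reflect C (simple a) '' inversions C Λ x) := by
  have h2 := pairing_simple hd a
  have hself : ht C Λ (move C Λ (simple a) x) (simple a).2 < 0 := by
    rw [ht_move_self h2]; exact neg_neg_of_pos h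
  ext ρ
  constructor
  · rintro ⟨hp, hn⟩
    by_cases hρ : ρ = simple a
    · exact Or.inl hρ
    · exact Or.inr ⟨_, ⟨hp.reflect_simple hd hC hρ, by rwa [← ht_move' h2]⟩, reflect_reflect h2 _⟩
  · rintro (rfl | ⟨σ, ⟨hp, hn⟩, rfl⟩)
    · exact ⟨isPosRoot_simple a, hself⟩
    · refine ⟨hp.reflect_simple hd hC ?_, by rwa [ht_move h2]⟩
      rintro rfl
      exact absurd h (not_lt.2 hn.le)

theorem reflect_injective {ρ : (J →₀ ℤ) × (J →₀ ℤ)} (hρ : pairing C ρ.1 ρ.2 = 2) :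
    Function.Injective (reflect C ρ) :=
  Function.LeftInverse.injective (reflect_reflect hρ)

include hd hC in
theorem finite_inversions_move_simple {x : J →₀ ℤ} (h : (inversions C Λ x).Finite) (a : J) :
    (inversions C Λ (move C Λ (simple a) x)).Finite := by
  have h2 := pairing_simple hd a
  refine ((h.image (reflect C (simple a))).insert (simple a)).subset ?_
  rintro ρ ⟨hp, hn⟩
  by_cases hρ : ρ = simple a
  · exact Or.inl hρ
  · exact Or.inr ⟨_, ⟨hp.reflect_simple hd hC hρ, by rwa [← ht_move' h2]⟩, reflect_reflect h2 _⟩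

include hd hC in
theorem ncard_inversions_move_simple {a : J} {x : J →₀ ℤ} (hfin : (inversions C Λ x).Finite)
    (h : 0 < ht C Λ x (single a 1)) :
    (inversions C Λ (move C Λ (simple a) x)).ncard = (inversions C Λ x).ncard + 1 := by
  have h2 := pairing_simple hd a
  rw [inversions_move_simple hd hC h, Set.ncard_insert_of_notMem _ (hfin.image _),
    Set.ncard_image_of_injective _ (reflect_injective h2)]
  rintro ⟨σ, ⟨hp, hn⟩, hσ⟩
  have : σ = -simple a := eq_neg_of_reflect_eq h2 hσ
  have h0 := hp.2.1 a
  rw [this] at h0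
  simp [simple] at h0

-- The inversions of the old weight inject into those of the new one other than `ρ`: send `σ` to its
-- reflection in `ρ` if this is positive, and keep `σ` otherwise. In the latter case the value of
-- the new weight at `σ` is even smaller than that of the old one.
include hd hC in
theorem ncard_inversions_move_lt {ρ : (J →₀ ℤ) × (J →₀ ℤ)} (hρ : IsPosRoot C ρ) {x : J →₀ ℤ}
    (h : 0 < ht C Λ x ρ.2) (hfin : (inversions C Λ (move C Λ ρ x)).Finite) :
    (inversions C Λ x).ncard + 1 ≤ (inversions C Λ (move C Λ ρ x)).ncard := by
  classical
  have h2 := hρ.1.pairing_self hd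
  let g : (J →₀ ℤ) × (J →₀ ℤ) → (J →₀ ℤ) × (J →₀ ℤ) := fun σ =>
    if 0 ≤ reflect C ρ σ then reflect C ρ σ else σ
  have hg0 : ∀ σ, 0 ≤ reflect C ρ σ → g σ = reflect C ρ σ := fun σ h => if_pos h
  have hg1 : ∀ σ, ¬ 0 ≤ reflect C ρ σ → g σ = σ := fun σ h => if_neg h
  have hρmem : ρ ∈ inversions C Λ (move C Λ ρ x) := ⟨hρ, by rw [ht_move_self h2]; omega⟩
  have hmem : ∀ σ ∈ inversions C Λ x, g σ ∈ inversions C Λ (move C Λ ρ x) \ {ρ} := by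
    rintro σ ⟨hp, hn⟩
    by_cases hs : 0 ≤ reflect C ρ σ
    · rw [hg0 σ hs]
      refine ⟨⟨⟨hρ.1.reflect hd hp.1, hs⟩, by rwa [ht_move h2]⟩, fun he => ?_⟩
      have : σ = -ρ := eq_neg_of_reflect_eq h2 he
      have h3 := hp.2.1
      rw [this] at h3
      exact (hρ.1.ne_zero hd).1 (le_antisymm (neg_nonneg.1 h3) hρ.2.1)
    · rw [hg1 σ hs]
      have hneg := ((hρ.1.reflect hd hp.1).pos_or_neg hd hC).resolve_left fun h => hs h.2
      refine ⟨⟨hp, ?_⟩, ?_⟩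
      · rw [ht_move' h2]
        -- Otherwise reflecting would only enlarge the positive coroot `σ.2`, and the result could
        -- not be nonpositive.
        have hc : 0 < pairing C ρ.1 σ.2 := by
          by_contra hc
          have h3 : σ.2 ≤ (reflect C ρ σ).2 := by
            have : 0 ≤ (-pairing C ρ.1 σ.2) • ρ.2 := smul_nonneg (by omega) hρ.2.2
            have h4 : (reflect C ρ σ).2 = σ.2 + (-pairing C ρ.1 σ.2) • ρ.2 := by
              simp only [reflect]; module
            rw [h4]
            exact le_add_of_nonneg_right this
          exact (hp.1.ne_zero hd).2 (le_antisymm (h3.trans hneg.2) hp.2.2)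
        have h4 : ht C Λ x (reflect C ρ σ).2 = ht C Λ x σ.2 - pairing C ρ.1 σ.2 * ht C Λ x ρ.2 := by
          simp only [ht, reflect, map_sub, map_smul, smul_eq_mul]
          ring
        rw [h4]
        have := mul_pos hc h
        omega
      · rintro rfl
        exact absurd hn (not_lt.2 h.le)
  have hinj : Set.InjOn g (inversions C Λ x) := by
    rintro σ ⟨hp, hn⟩ τ ⟨hp', hn'⟩ he
    by_cases hs : 0 ≤ reflect C ρ σ <;> by_cases ht : 0 ≤ reflect C ρ τ
    · rw [hg0 σ hs, hg0 τ ht] at he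
      exact reflect_injective h2 he
    · rw [hg0 σ hs, hg1 τ ht] at he
      rw [← he, reflect_reflect h2] at ht
      exact absurd hp.2 ht
    · rw [hg1 σ hs, hg0 τ ht] at he
      rw [he, reflect_reflect h2] at hs
      exact absurd hp'.2 hs
    · rwa [hg1 σ hs, hg1 τ ht] at he
  have h5 := Set.ncard_le_ncard_of_injOn g hmem hinj (hfin.sdiff)
  have h6 := Set.ncard_sdiff_singleton_add_one hρmem hfin
  omega

end CartanRoot

/-! ### Bruhat covers and chains of weights. -/

namespace CartanRoot

open Finsupp

variable {J : Type*}

/-- The weights `Λ - x` and `Λ - x'` are related by a reflection in a positive real root, which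
lowers the weight, is a covering in the Bruhat order, and is integral at time `T`. -/
def Step (C : Matrix J J ℤ) (Λ : (J →₀ ℤ) →ₗ[ℤ] ℤ) (T : ℝ) (x x' : J →₀ ℤ) : Prop :=
  ∃ ρ, IsPosRoot C ρ ∧ 0 < ht C Λ x ρ.2 ∧ (∃ z : ℤ, T * ht C Λ x ρ.2 = z) ∧ x' = move C Λ ρ x ∧
    (inversions C Λ x).Finite ∧ (inversions C Λ x').Finite ∧
    (inversions C Λ x').ncard = (inversions C Λ x).ncard + 1

/-- The `T`-chains of Lakshmibai--Seshadri paths. -/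
def Chain (C : Matrix J J ℤ) (Λ : (J →₀ ℤ) →ₗ[ℤ] ℤ) (T : ℝ) : (J →₀ ℤ) → (J →₀ ℤ) → Prop :=
  Relation.ReflTransGen (Step C Λ T)

variable {C : Matrix J J ℤ} {Λ : (J →₀ ℤ) →ₗ[ℤ] ℤ} {T : ℝ}

theorem Step.le {x x' : J →₀ ℤ} (h : Step C Λ T x x') : x ≤ x' := by
  obtain ⟨ρ, hρ, hpos, -, rfl, -⟩ := h
  exact le_add_of_nonneg_right (smul_nonneg hpos.le hρ.2.1)

theorem Chain.le {x x' : J →₀ ℤ} (h : Chain C Λ T x x') : x ≤ x' := by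
  induction h with
  | refl => exact le_rfl
  | tail _ h ih => exact ih.trans h.le

/-- The two weights differ by an integral multiple of a root, and `T` times the multiplier is an
integer. Hence integrality conditions can be transported along a chain. -/
theorem Step.exists_int {x x' : J →₀ ℤ} (h : Step C Λ T x x') (y : J →₀ ℤ) :
    ∃ z : ℤ, T * ht C Λ x' y = T * ht C Λ x y + z := by
  obtain ⟨ρ, -, -, ⟨z, hz⟩, rfl, -⟩ := h
  refine ⟨-(z * pairing C ρ.1 y), ?_⟩
  have : ht C Λ (move C Λ ρ x) y = ht C Λ x y - ht C Λ x ρ.2 * pairing C ρ.1 y := by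
    simp only [move, ht, map_add, map_smul, LinearMap.add_apply, LinearMap.smul_apply, smul_eq_mul]
    ring
  rw [this]
  push_cast
  rw [← hz]
  ring

theorem Chain.exists_int {x x' : J →₀ ℤ} (h : Chain C Λ T x x') (y : J →₀ ℤ) :
    ∃ z : ℤ, T * ht C Λ x' y = T * ht C Λ x y + z := by
  induction h with
  | refl => exact ⟨0, by simp⟩
  | tail _ h ih =>
    obtain ⟨z, hz⟩ := ih
    obtain ⟨w, hw⟩ := h.exists_int y
    exact ⟨z + w, by rw [hw, hz]; push_cast; ring⟩

variable (hd : ∀ j, C j j = 2) (hC : IsBorcherdsCartan C)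

include hd hC in
theorem Step.of_simple {x : J →₀ ℤ} {a : J} (hfin : (inversions C Λ x).Finite)
    (h : 0 < ht C Λ x (single a 1)) (hT : ∃ z : ℤ, T * ht C Λ x (single a 1) = z) :
    Step C Λ T x (move C Λ (simple a) x) :=
  ⟨simple a, isPosRoot_simple a, h, hT, rfl, hfin, finite_inversions_move_simple hd hC hfin a,
    ncard_inversions_move_simple hd hC hfin h⟩

theorem move_simple_of_ht_eq_zero {x : J →₀ ℤ} {a : J} (h : ht C Λ x (single a 1) = 0) :
    move C Λ (simple a) x = x := by
  rw [move, simple]; simp [h]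

-- This is the lifting property of covers. If `k` is the number of inversions at `x`, there are `k +
-- 1` both at `x'` and at the simple reflection of `x`. The reflection in the transported root then
-- gives at least `k + 2` at the simple reflection of `x'`, which excludes a nonpositive value of
-- `x'` at the simple coroot.
include hd hC in
theorem Step.reflect_or_eq {x x' : J →₀ ℤ} (h : Step C Λ T x x') {a : J}
    (ha : 0 < ht C Λ x (single a 1)) :
    (0 < ht C Λ x' (single a 1) ∧
        Step C Λ T (move C Λ (simple a) x) (move C Λ (simple a) x')) ∨
      (x' = move C Λ (simple a) x ∧ ∃ z : ℤ, T * ht C Λ x (single a 1) = z) := by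
  obtain ⟨ρ, hρ, hpos, hT, rfl, hf, hf', hcard⟩ := h
  have h2 := pairing_simple hd a
  by_cases hρa : ρ = simple a
  · subst hρa
    exact Or.inr ⟨rfl, hT⟩
  left
  have hρ' := hρ.reflect_simple hd hC hρa
  have c1 := ncard_inversions_move_simple hd hC hf ha
  have e := move_conj (Λ := Λ) h2 ρ x
  have hpos' : 0 < ht C Λ (move C Λ (simple a) x) (reflect C (simple a) ρ).2 := by
    rwa [ht_move h2]
  have hf1 := finite_inversions_move_simple hd hC hf a
  have hf2 := finite_inversions_move_simple hd hC hf' a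
  have c2 := ncard_inversions_move_lt hd hC hρ' hpos' (by rwa [e])
  rw [e] at c2
  rcases lt_trichotomy (ht C Λ (move C Λ ρ x) (single a 1)) 0 with h0 | h0 | h0
  · have hself := ht_move_self (Λ := Λ) h2 (move C Λ ρ x)
    have c3 := ncard_inversions_move_simple (a := a) hd hC hf2 (by
      have : ht C Λ (move C Λ (simple a) (move C Λ ρ x)) (single a 1) =
        -ht C Λ (move C Λ ρ x) (single a 1) := hself
      rw [this]; omega)
    rw [move_move h2] at c3
    omega
  · rw [move_simple_of_ht_eq_zero h0] at c2
    omega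
  · refine ⟨h0, reflect C (simple a) ρ, hρ', hpos', by rwa [ht_move h2], e.symm, hf1, hf2, ?_⟩
    rw [ncard_inversions_move_simple hd hC hf' h0, c1, hcard]

-- All steps are reflected until one of them is itself the simple reflection. From there on, the
-- reflected chain meets the original one and follows it.
include hd hC in
theorem Chain.reflect_or {x x' : J →₀ ℤ} (h : Chain C Λ T x x') {a : J}
    (ha : 0 < ht C Λ x (single a 1)) :
    (0 < ht C Λ x' (single a 1) ∧
        Chain C Λ T (move C Λ (simple a) x) (move C Λ (simple a) x')) ∨
      ((∃ z : ℤ, T * ht C Λ x (single a 1) = z) ∧ Chain C Λ T (move C Λ (simple a) x) x') := by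
  induction h with
  | refl => exact Or.inl ⟨ha, Relation.ReflTransGen.refl⟩
  | @tail y y' hxy h ih =>
    rcases ih with ⟨hy, hc⟩ | ⟨hT, hc⟩
    · rcases h.reflect_or_eq hd hC hy with ⟨hy', hs⟩ | ⟨rfl, z, hz⟩
      · exact Or.inl ⟨hy', hc.tail hs⟩
      · obtain ⟨w, hw⟩ := Chain.exists_int hxy (single a 1)
        exact Or.inr ⟨⟨z - w, by push_cast; linarith⟩, hc⟩
    · exact Or.inr ⟨hT, hc.tail h⟩

include hd hC in
theorem Chain.exists_int_of_sign_change {x x' : J →₀ ℤ} (h : Chain C Λ T x x') {a : J}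
    (ha : 0 ≤ ht C Λ x (single a 1)) (ha' : ht C Λ x' (single a 1) ≤ 0) :
    ∃ z : ℤ, T * ht C Λ x (single a 1) = z := by
  rcases ha.eq_or_lt with h0 | h0
  · exact ⟨0, by simp [← h0]⟩
  rcases h.reflect_or hd hC h0 with ⟨h1, -⟩ | ⟨h1, -⟩
  · omega
  · exact h1

-- The source of a chain will be the right-hand velocity at a time and its target the left-hand one.
-- This lemma treats the time `fp`, where only the right side is reflected; `Chain.move_right`
-- treats `fm`, where only the left side is, and `Chain.move_both` the times between.
include hd hC in
theorem Chain.move_left {x x' : J →₀ ℤ} (h : Chain C Λ T x x') {a : J}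
    (ha : 0 ≤ ht C Λ x (single a 1)) (ha' : ht C Λ x' (single a 1) ≤ 0) :
    Chain C Λ T (move C Λ (simple a) x) x' := by
  rcases ha.eq_or_lt with h0 | h0
  · rwa [move_simple_of_ht_eq_zero h0.symm]
  rcases h.reflect_or hd hC h0 with ⟨h1, -⟩ | ⟨-, h1⟩
  · omega
  · exact h1

include hd hC in
theorem Chain.move_right {x x' : J →₀ ℤ} (h : Chain C Λ T x x') {a : J}
    (hfin : (inversions C Λ x').Finite)
    (ha' : 0 ≤ ht C Λ x' (single a 1)) (hT : ∃ z : ℤ, T * ht C Λ x' (single a 1) = z) :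
    Chain C Λ T x (move C Λ (simple a) x') := by
  rcases ha'.eq_or_lt with h0 | h0
  · rwa [move_simple_of_ht_eq_zero h0.symm]
  · exact h.tail (Step.of_simple hd hC hfin h0 hT)

include hd hC in
theorem Chain.move_both {x x' : J →₀ ℤ} (h : Chain C Λ T x x') {a : J}
    (hfin : (inversions C Λ x').Finite)
    (ha : 0 ≤ ht C Λ x (single a 1)) (ha' : 0 ≤ ht C Λ x' (single a 1)) :
    Chain C Λ T (move C Λ (simple a) x) (move C Λ (simple a) x') := by
  obtain ⟨w, hw⟩ := h.exists_int (single a 1)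
  rcases ha.eq_or_lt with h0 | h0
  · rw [move_simple_of_ht_eq_zero h0.symm]
    exact h.move_right hd hC hfin ha' ⟨w, by rw [hw, ← h0]; simp⟩
  · rcases h.reflect_or hd hC h0 with ⟨-, h1⟩ | ⟨⟨z, hz⟩, h1⟩
    · exact h1
    · exact h1.move_right hd hC hfin ha' ⟨z + w, by rw [hw, hz]; push_cast; ring⟩

end CartanRoot

open Filter Topology

/-! ### The profile of a root operator -/

/-- The coefficient of the simple root that a root operator subtracts, for a path with height `h`. -/
noncomputable def bump (h : unitInterval → ℝ) (m : ℤ) (fp fm t : unitInterval) : ℝ :=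
  open Classical in if t ≤ fp then 0 else if t ≤ fm then h t - m else 1

/-- `m`, `fp` and `fm` are the data of the root operator for a path with height `h`, on which
it does not vanish. -/
structure IsProfile (h : unitInterval → ℝ) (m : ℤ) (fp fm : unitInterval) : Prop where
  continuous : Continuous h
  exists_int_one : ∃ z : ℤ, h 1 = z
  isLeast : IsLeast {z : ℤ | ∃ t, h t = z} m
  isGreatest : IsGreatest {t | h t = m} fp
  lt_one : fp < 1
  isLeast' : IsLeast {t | fp ≤ t ∧ h t = m + 1} fm

namespace IsProfile

variable {h : unitInterval → ℝ} {m : ℤ} {fp fm t : unitInterval} (H : IsProfile h m fp fm)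

include H

theorem lt : fp < fm := by
  refine lt_of_le_of_ne H.isLeast'.1.1 fun he => ?_
  have h1 : h fp = m := H.isGreatest.1
  have h2 : h fm = m + 1 := H.isLeast'.1.2
  rw [← he, h1] at h2
  linarith

/-- The height ends at an integer that is at least `m`, so a value at most `m` after `fp` would
force the value `m` to be taken again. -/
theorem lt_height (ht : fp < t) : (m : ℝ) < h t := by
  by_contra hc
  obtain ⟨z, hz⟩ := H.exists_int_one
  have hmz : m ≤ z := H.isLeast.2 ⟨1, hz⟩
  have hmem : (m : ℝ) ∈ Set.Icc (h t) (h 1) :=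
    ⟨not_lt.1 hc, by rw [hz]; exact_mod_cast hmz⟩
  obtain ⟨s, hs, hsm⟩ := intermediate_value_Icc (le_top : t ≤ 1) H.continuous.continuousOn hmem
  exact absurd (H.isGreatest.2 hsm) (not_le.2 (ht.trans_le hs.1))

theorem height_lt (ht : fp ≤ t) (ht' : t < fm) : h t < m + 1 := by
  by_contra hc
  have h1 : h fp = m := H.isGreatest.1
  have hmem : (m : ℝ) + 1 ∈ Set.Icc (h fp) (h t) := ⟨by rw [h1]; linarith, not_lt.1 hc⟩
  obtain ⟨s, hs, hsm⟩ := intermediate_value_Icc ht H.continuous.continuousOn hmem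
  exact absurd (H.isLeast'.2 ⟨hs.1, hsm⟩) (not_le.2 (hs.2.trans_lt ht'))

theorem bump_of_le (ht : t ≤ fp) : bump h m fp fm t = 0 := if_pos ht

theorem bump_of_mem (ht : fp ≤ t) (ht' : t ≤ fm) : bump h m fp fm t = h t - m := by
  rcases ht.eq_or_lt with rfl | h1
  · have h1 : h fp = m := H.isGreatest.1
    rw [H.bump_of_le le_rfl, h1, sub_self]
  · rw [bump, if_neg (not_le.2 h1), if_pos ht']

theorem bump_of_ge (ht : fm ≤ t) : bump h m fp fm t = 1 := by
  rcases ht.eq_or_lt with rfl | h1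
  · have h1 : h fm = m + 1 := H.isLeast'.1.2
    rw [H.bump_of_mem H.lt.le le_rfl, h1]; ring
  · rw [bump, if_neg (not_le.2 (H.lt.trans h1)), if_neg (not_le.2 h1)]

theorem bump_nonneg : 0 ≤ bump h m fp fm t := by
  rcases le_total t fp with h1 | h1
  · rw [H.bump_of_le h1]
  rcases le_total t fm with h2 | h2
  · rw [H.bump_of_mem h1 h2]
    rcases h1.eq_or_lt with rfl | h1
    · have h1 : h fp = m := H.isGreatest.1
      rw [h1, sub_self]
    · linarith [H.lt_height h1]
  · rw [H.bump_of_ge h2]; exact zero_le_one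

theorem bump_one : bump h m fp fm 1 = 1 := H.bump_of_ge le_top

end IsProfile

/-! ### Signs of one-sided slopes. -/

section Slope

variable {h : unitInterval → ℝ} {n : ℕ} {t : unitInterval} {d : ℝ}

theorem slope_right_nonneg (hn : 0 < n) (hg : ∀ᶠ s : unitInterval in 𝓝[>] t, h s = h t + n * ((s : ℝ) - t) * d)
    (hf : ∃ᶠ s in 𝓝[>] t, h t ≤ h s) : 0 ≤ d := by
  obtain ⟨s, ⟨hs1, hs2⟩, hs3⟩ := ((hf.and_eventually hg).and_eventually self_mem_nhdsWithin).exists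
  have : (t : ℝ) < s := hs3
  have hpos : (0 : ℝ) < n * ((s : ℝ) - t) := mul_pos (by exact_mod_cast hn) (by linarith)
  by_contra hc
  nlinarith [mul_neg_of_pos_of_neg hpos (not_le.1 hc)]

theorem slope_left_nonneg (hn : 0 < n) (hg : ∀ᶠ s : unitInterval in 𝓝[<] t, h s = h t + n * ((s : ℝ) - t) * d)
    (hf : ∃ᶠ s in 𝓝[<] t, h s ≤ h t) : 0 ≤ d := by
  obtain ⟨s, ⟨hs1, hs2⟩, hs3⟩ := ((hf.and_eventually hg).and_eventually self_mem_nhdsWithin).exists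
  have : (s : ℝ) < t := hs3
  have hpos : (0 : ℝ) < n * ((t : ℝ) - s) := mul_pos (by exact_mod_cast hn) (by linarith)
  by_contra hc
  nlinarith [mul_neg_of_pos_of_neg hpos (not_le.1 hc)]

theorem slope_left_nonpos (hn : 0 < n) (hg : ∀ᶠ s : unitInterval in 𝓝[<] t, h s = h t + n * ((s : ℝ) - t) * d)
    (hf : ∃ᶠ s in 𝓝[<] t, h t ≤ h s) : d ≤ 0 := by
  obtain ⟨s, ⟨hs1, hs2⟩, hs3⟩ := ((hf.and_eventually hg).and_eventually self_mem_nhdsWithin).exists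
  have : (s : ℝ) < t := hs3
  have hpos : (0 : ℝ) < n * ((t : ℝ) - s) := mul_pos (by exact_mod_cast hn) (by linarith)
  by_contra hc
  nlinarith [mul_pos hpos (not_le.1 hc)]

end Slope

/-! ### Coefficients of concatenated Lakshmibai-Seshadri paths. -/

namespace CartanRoot

open Finsupp

variable {J : Type*}

/-- The inclusion of the root lattice in its real span. -/
noncomputable def castLattice : (J →₀ ℤ) →+ (J →₀ ℝ) :=
  mapRange.addMonoidHom (Int.castAddHom ℝ)

@[simp] theorem castLattice_single (a : J) (z : ℤ) :
    castLattice (single a z) = single a (z : ℝ) := by simp [castLattice]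

@[simp] theorem castLattice_apply (x : J →₀ ℤ) (a : J) : castLattice x a = (x a : ℝ) := rfl

/-- The height of a path with coefficients `c`. -/
noncomputable def heightOf (C : Matrix J J ℤ) (H₀ : J → unitInterval → ℝ) (c : unitInterval → J →₀ ℝ)
    (q : J) (t : unitInterval) : ℝ :=
  H₀ q t - linearCombination ℝ (fun k => (C q k : ℝ)) (c t)

/-- Near `t`, at times for which the filter `F` says so, the coefficients `c` have slope `n x`. -/
def Germ (F : Filter unitInterval) (n : ℕ) (c : unitInterval → J →₀ ℝ) (t : unitInterval)
    (x : J →₀ ℤ) : Prop :=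
  ∀ᶠ s : unitInterval in F, c s = c t + (n * ((s : ℝ) - t)) • castLattice x

/-- The coefficients at `t` are integral up to `T x`. -/
def IntegralAt (T : ℝ) (c : unitInterval → J →₀ ℝ) (t : unitInterval) (x : J →₀ ℤ) : Prop :=
  ∃ z : J →₀ ℤ, c t = castLattice z + T • castLattice x

/-- The local structure at a time `t` in the `l`-th subinterval of the coefficients of a
concatenation of `n` Lakshmibai--Seshadri paths. -/
def LSAt (C : Matrix J J ℤ) (Λ : (J →₀ ℤ) →ₗ[ℤ] ℤ) (n l : ℕ) (c : unitInterval → J →₀ ℝ)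
    (t : unitInterval) : Prop :=
  ∃ xl xr : J →₀ ℤ,
    ((l : ℝ) < n * (t : ℝ) → Germ (𝓝[<] t) n c t xl ∧ IntegralAt (n * (t : ℝ) - l) c t xl ∧
      (inversions C Λ xl).Finite) ∧
    ((n * (t : ℝ) < l + 1) → Germ (𝓝[>] t) n c t xr ∧ IntegralAt (n * (t : ℝ) - l) c t xr ∧
      (inversions C Λ xr).Finite) ∧
    ((l : ℝ) < n * (t : ℝ) → (n * (t : ℝ) < l + 1) → Chain C Λ (n * (t : ℝ) - l) xr xl)

/-- The coefficients of a concatenation of `n` Lakshmibai--Seshadri paths. -/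
def IsLS (C : Matrix J J ℤ) {n : ℕ} (Λ : Fin n → (J →₀ ℤ) →ₗ[ℤ] ℤ) (c : unitInterval → J →₀ ℝ) : Prop :=
  ∀ (l : Fin n) (t : unitInterval), (l : ℝ) ≤ n * (t : ℝ) → n * (t : ℝ) ≤ l + 1 →
    LSAt C (Λ l) n l c t

/-- The heights `H₀` belong to a concatenation of straight lines with the weights `Λ l`. -/
def IsBaseHeight {n : ℕ} (Λ : Fin n → (J →₀ ℤ) →ₗ[ℤ] ℤ) (H₀ : J → unitInterval → ℝ) : Prop :=
  ∀ (l : Fin n) (q : J), ∃ z : ℤ, ∀ t : unitInterval, (l : ℝ) ≤ n * (t : ℝ) → n * (t : ℝ) ≤ l + 1 →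
    H₀ q t = z + (n * (t : ℝ) - l) * Λ l (single q 1)

theorem isLS_zero (C : Matrix J J ℤ) {n : ℕ} (Λ : Fin n → (J →₀ ℤ) →ₗ[ℤ] ℤ)
    (hΛ : ∀ l, (inversions C (Λ l) 0).Finite) : IsLS C Λ 0 := by
  intro l t _ _
  have hg : ∀ F, Germ F n (0 : unitInterval → J →₀ ℝ) t 0 := fun F =>
    Eventually.of_forall fun s => by simp
  have hi : IntegralAt (n * (t : ℝ) - l) (0 : unitInterval → J →₀ ℝ) t 0 := ⟨0, by simp⟩
  exact ⟨0, 0, fun _ => ⟨hg _, hi, hΛ l⟩, fun _ => ⟨hg _, hi, hΛ l⟩,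
    fun _ _ => Relation.ReflTransGen.refl⟩

section

variable {C : Matrix J J ℤ} {n : ℕ} {Λ : Fin n → (J →₀ ℤ) →ₗ[ℤ] ℤ} {H₀ : J → unitInterval → ℝ}
  {c : unitInterval → J →₀ ℝ} {l : Fin n} {t : unitInterval} {x : J →₀ ℤ}

theorem linearCombination_castLattice (C : Matrix J J ℤ) (q : J) (x : J →₀ ℤ) :
    linearCombination ℝ (fun k => (C q k : ℝ)) (castLattice x) = pairing C x (single q 1) := by
  induction x using Finsupp.induction_linear with
  | zero => simp
  | add x y hx hy => simp [hx, hy]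
  | single a z => simp [pairing]

theorem IsBaseHeight.height_eq_of_germ (hH : IsBaseHeight Λ H₀) (q : J)
    (h1 : (l : ℝ) ≤ n * (t : ℝ)) (h2 : n * (t : ℝ) ≤ l + 1) {s : unitInterval}
    (h1' : (l : ℝ) ≤ n * (s : ℝ)) (h2' : n * (s : ℝ) ≤ l + 1)
    (hc : c s = c t + (n * ((s : ℝ) - t)) • castLattice x) :
    heightOf C H₀ c q s = heightOf C H₀ c q t + n * ((s : ℝ) - t) * ht C (Λ l) x (single q 1) := by
  obtain ⟨z, hz⟩ := hH l q
  rw [heightOf, heightOf, hz t h1 h2, hz s h1' h2', hc, map_add, map_smul,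
    linearCombination_castLattice, ht, smul_eq_mul]
  push_cast
  ring

theorem IsBaseHeight.height_right (hH : IsBaseHeight Λ H₀) (q : J)
    (h1 : (l : ℝ) ≤ n * (t : ℝ)) (h2 : n * (t : ℝ) < l + 1) (hg : Germ (𝓝[>] t) n c t x) :
    ∀ᶠ s : unitInterval in 𝓝[>] t,
      heightOf C H₀ c q s = heightOf C H₀ c q t + n * ((s : ℝ) - t) * ht C (Λ l) x (single q 1) := by
  have ev : ∀ᶠ s : unitInterval in 𝓝 t, n * (s : ℝ) < l + 1 :=
    (continuous_const.mul continuous_subtype_val).tendsto t |>.eventually (Iio_mem_nhds h2)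
  filter_upwards [hg, nhdsWithin_le_nhds ev, self_mem_nhdsWithin] with s hs hs' hts
  have : (t : ℝ) ≤ s := le_of_lt hts
  exact hH.height_eq_of_germ q h1 h2.le (h1.trans (by gcongr)) hs'.le hs

theorem IsBaseHeight.height_left (hH : IsBaseHeight Λ H₀) (q : J)
    (h1 : (l : ℝ) < n * (t : ℝ)) (h2 : n * (t : ℝ) ≤ l + 1) (hg : Germ (𝓝[<] t) n c t x) :
    ∀ᶠ s : unitInterval in 𝓝[<] t,
      heightOf C H₀ c q s = heightOf C H₀ c q t + n * ((s : ℝ) - t) * ht C (Λ l) x (single q 1) := by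
  have ev : ∀ᶠ s : unitInterval in 𝓝 t, (l : ℝ) < n * (s : ℝ) :=
    (continuous_const.mul continuous_subtype_val).tendsto t |>.eventually (Ioi_mem_nhds h1)
  filter_upwards [hg, nhdsWithin_le_nhds ev, self_mem_nhdsWithin] with s hs hs' hts
  have : (s : ℝ) ≤ t := le_of_lt hts
  exact hH.height_eq_of_germ q h1.le h2 hs'.le (le_trans (by gcongr) h2) hs

theorem IsBaseHeight.height_int (hH : IsBaseHeight Λ H₀) (q : J)
    (h1 : (l : ℝ) ≤ n * (t : ℝ)) (h2 : n * (t : ℝ) ≤ l + 1)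
    (hi : IntegralAt (n * (t : ℝ) - l) c t x) :
    ∃ z : ℤ, heightOf C H₀ c q t = z + (n * (t : ℝ) - l) * ht C (Λ l) x (single q 1) := by
  obtain ⟨z, hz⟩ := hH l q
  obtain ⟨y, hy⟩ := hi
  refine ⟨z - pairing C y (single q 1), ?_⟩
  rw [heightOf, hz t h1 h2, hy, map_add, map_smul, linearCombination_castLattice,
    linearCombination_castLattice, ht, smul_eq_mul]
  push_cast
  ring

theorem exists_segment (hn : 0 < n) (t : unitInterval) :
    ∃ l : Fin n, (l : ℝ) ≤ n * (t : ℝ) ∧ n * (t : ℝ) ≤ l + 1 := by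
  have hn' : (0 : ℝ) < n := by exact_mod_cast hn
  have h0 : 0 ≤ n * (t : ℝ) := mul_nonneg hn'.le t.2.1
  rcases eq_or_lt_of_le t.2.2 with h1 | h1
  -- At `t = 1` the floor of `n * t` is `n`, which is out of range, so the last segment is taken.
  · refine ⟨⟨n - 1, by omega⟩, ?_⟩
    have : ((n - 1 : ℕ) : ℝ) = n - 1 := by
      rw [Nat.cast_sub hn, Nat.cast_one]
    rw [h1]
    dsimp only
    rw [this]
    constructor <;> linarith
  · have hlt : n * (t : ℝ) < n := by nlinarith
    refine ⟨⟨⌊n * (t : ℝ)⌋₊, (Nat.floor_lt h0).2 hlt⟩, Nat.floor_le h0, (Nat.lt_floor_add_one _).le⟩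

theorem lt_one_of_segment (h2 : n * (t : ℝ) < l + 1) : t < 1 := by
  rw [← unitInterval.coe_lt_one]
  have hl : (l : ℝ) + 1 ≤ n := by exact_mod_cast l.2
  have hn' : (0 : ℝ) < n := by exact_mod_cast l.pos
  by_contra hc
  nlinarith [not_lt.1 hc]

theorem pos_of_segment (h1 : (l : ℝ) < n * (t : ℝ)) : 0 < t := by
  rw [← unitInterval.coe_pos]
  have hl : (0 : ℝ) ≤ l := Nat.cast_nonneg _
  have hn' : (0 : ℝ) < n := by exact_mod_cast l.pos
  by_contra hc
  nlinarith [not_lt.1 hc]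

/-- At a joint the local time `n * t - l` is 0 or 1, so integrality up to a multiple of `x` by it is
plain integrality. -/
theorem IsLS.exists_int_of_joint (hH : IsBaseHeight Λ H₀) (hc : IsLS C Λ c) (q : J)
    (h : n * (t : ℝ) = l ∨ n * (t : ℝ) = l + 1) : ∃ z : ℤ, heightOf C H₀ c q t = z := by
  rcases h with h | h
  · have h1 : (l : ℝ) ≤ n * (t : ℝ) := h.ge
    have h2 : n * (t : ℝ) < l + 1 := by linarith
    obtain ⟨xl, xr, -, hr, -⟩ := hc l t h1 h2.le
    obtain ⟨z, hz⟩ := hH.height_int (C := C) q h1 h2.le (hr h2).2.1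
    exact ⟨z, by rw [hz, h, sub_self, zero_mul, add_zero]⟩
  · have h1 : (l : ℝ) < n * (t : ℝ) := by linarith
    have h2 : n * (t : ℝ) ≤ l + 1 := h.le
    obtain ⟨xl, xr, hl, -⟩ := hc l t h1.le h2
    obtain ⟨z, hz⟩ := hH.height_int (C := C) q h1.le h2 (hl h1).2.1
    exact ⟨z + ht C (Λ l) xl (single q 1), by rw [hz, h]; push_cast; ring⟩

variable (hd : ∀ j, C j j = 2) (hC : IsBorcherdsCartan C)

include hd hC in
/-- Local minima of the heights are integers. -/
theorem IsLS.exists_int_of_isLocalMin (hn : 0 < n) (hH : IsBaseHeight Λ H₀) (hc : IsLS C Λ c) (q : J)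
    (hmin : ∀ᶠ s in 𝓝 t, heightOf C H₀ c q t ≤ heightOf C H₀ c q s) :
    ∃ z : ℤ, heightOf C H₀ c q t = z := by
  obtain ⟨l, h1, h2⟩ := exists_segment hn t
  rcases h1.eq_or_lt with h1' | h1'
  · exact hc.exists_int_of_joint hH q (Or.inl h1'.symm)
  rcases h2.eq_or_lt with h2' | h2'
  · exact hc.exists_int_of_joint hH q (Or.inr h2')
  obtain ⟨xl, xr, hl, hr, hch⟩ := hc l t h1 h2
  have : (𝓝[>] t).NeBot := nhdsGT_neBot_of_exists_gt ⟨1, lt_one_of_segment h2'⟩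
  have : (𝓝[<] t).NeBot := nhdsLT_neBot_of_exists_lt ⟨0, pos_of_segment h1'⟩
  have dr := slope_right_nonneg hn (hH.height_right (C := C) q h1 h2' (hr h2').1)
    (hmin.filter_mono nhdsWithin_le_nhds).frequently
  have dl := slope_left_nonpos hn (hH.height_left (C := C) q h1' h2 (hl h1').1)
    (hmin.filter_mono nhdsWithin_le_nhds).frequently
  -- At a local minimum the slope is nonpositive on the left and nonnegative on the right, so the
  -- chain from `xr` to `xl` changes sign and local time times slope is an integer.
  obtain ⟨z, hz⟩ := (hch h1' h2').exists_int_of_sign_change hd hC (a := q)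
    (by exact_mod_cast dr) (by exact_mod_cast dl)
  obtain ⟨w, hw⟩ := hH.height_int (C := C) q h1 h2 (hr h2').2.1
  exact ⟨w + z, by rw [hw, hz]; push_cast; ring⟩

end

end CartanRoot

/-! ### Root operators preserve the Lakshmibai-Seshadri property. -/

open Filter Topology

namespace CartanRoot

open Finsupp

variable {J : Type*} {C : Matrix J J ℤ} {n : ℕ} {Λ : Fin n → (J →₀ ℤ) →ₗ[ℤ] ℤ}
  {H₀ : J → unitInterval → ℝ} {c : unitInterval → J →₀ ℝ} {l : Fin n} {t : unitInterval}
  {x : J →₀ ℤ} (hd : ∀ j, C j j = 2) (hC : IsBorcherdsCartan C)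
  (hn : 0 < n) (hH : IsBaseHeight Λ H₀) (hc : IsLS C Λ c)
  {a : J} {m : ℤ} {fp fm : unitInterval} (hP : IsProfile (heightOf C H₀ c a) m fp fm)

-- By definition `m` is only the least integral value. The global minimum is a local minimum, hence
-- integral, so it equals `m`.
include hd hC hn hH hc hP in
theorem minHeight_le_height (t : unitInterval) : (m : ℝ) ≤ heightOf C H₀ c a t := by
  obtain ⟨s, -, hs⟩ := isCompact_univ.exists_isMinOn Set.univ_nonempty hP.continuous.continuousOn
  have hs' : ∀ u, heightOf C H₀ c a s ≤ heightOf C H₀ c a u := fun u => hs (Set.mem_univ u)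
  obtain ⟨z, hz⟩ := hc.exists_int_of_isLocalMin hd hC hn hH a (Eventually.of_forall hs')
  have : (m : ℝ) ≤ z := by exact_mod_cast hP.isLeast.2 ⟨s, hz⟩
  linarith [hs' t]

-- A decrease would put a minimum over `[s, fm]` strictly inside this interval. It would be an
-- integer strictly between `m` and `m + 1`.
include hd hC hn hH hc hP in
theorem height_le_height {s t : unitInterval} (h1 : fp < s) (h2 : s ≤ t) (h3 : t < fm) :
    heightOf C H₀ c a s ≤ heightOf C H₀ c a t := by
  by_contra hlt
  rw [not_le] at hlt
  obtain ⟨u, hu, hmin⟩ := isCompact_Icc.exists_isMinOn (Set.nonempty_Icc.2 (h2.trans h3.le))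
    hP.continuous.continuousOn
  have hut : heightOf C H₀ c a u ≤ heightOf C H₀ c a t := hmin ⟨h2, h3.le⟩
  have hs1 := hP.height_lt h1.le (h2.trans_lt h3)
  have hfm : heightOf C H₀ c a fm = m + 1 := hP.isLeast'.1.2
  have hsu : s < u := lt_of_le_of_ne hu.1 (by rintro rfl; linarith)
  have hum : u < fm := lt_of_le_of_ne hu.2 (by rintro rfl; linarith)
  obtain ⟨z, hz⟩ := hc.exists_int_of_isLocalMin (t := u) hd hC hn hH a (by
    filter_upwards [Icc_mem_nhds hsu hum] with v hv using hmin hv)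
  have hu1 := hP.height_lt (h1.trans hsu).le hum
  have hu2 := hP.lt_height (h1.trans hsu)
  rw [hz] at hu1 hu2
  norm_cast at hu1 hu2
  omega

include hP in
theorem bump_right_of_active (h1 : fp ≤ t) (h2 : t < fm) {d : ℝ}
    (hg : ∀ᶠ s : unitInterval in 𝓝[>] t,
      heightOf C H₀ c a s = heightOf C H₀ c a t + n * ((s : ℝ) - t) * d) :
    ∀ᶠ s : unitInterval in 𝓝[>] t, bump (heightOf C H₀ c a) m fp fm s =
      bump (heightOf C H₀ c a) m fp fm t + n * ((s : ℝ) - t) * d := by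
  filter_upwards [hg, nhdsWithin_le_nhds (Iio_mem_nhds h2), self_mem_nhdsWithin] with s hs hs2 hs1
  rw [hP.bump_of_mem h1 h2.le, hP.bump_of_mem (h1.trans (le_of_lt hs1)) (le_of_lt hs2), hs]
  ring

include hP in
theorem bump_left_of_active (h1 : fp < t) (h2 : t ≤ fm) {d : ℝ}
    (hg : ∀ᶠ s : unitInterval in 𝓝[<] t,
      heightOf C H₀ c a s = heightOf C H₀ c a t + n * ((s : ℝ) - t) * d) :
    ∀ᶠ s : unitInterval in 𝓝[<] t, bump (heightOf C H₀ c a) m fp fm s =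
      bump (heightOf C H₀ c a) m fp fm t + n * ((s : ℝ) - t) * d := by
  filter_upwards [hg, nhdsWithin_le_nhds (Ioi_mem_nhds h1), self_mem_nhdsWithin] with s hs hs1 hs2
  rw [hP.bump_of_mem h1.le h2, hP.bump_of_mem (le_of_lt hs1) ((le_of_lt hs2).trans h2), hs]
  ring

include hP in
theorem bump_right_of_inactive (h : ¬ (fp ≤ t ∧ t < fm)) :
    ∀ᶠ s : unitInterval in 𝓝[>] t, bump (heightOf C H₀ c a) m fp fm s =
      bump (heightOf C H₀ c a) m fp fm t := by
  rcases lt_or_ge t fp with h1 | h1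
  · filter_upwards [nhdsWithin_le_nhds (Iio_mem_nhds h1)] with s hs
    rw [hP.bump_of_le h1.le, hP.bump_of_le (le_of_lt hs)]
  · have h2 : fm ≤ t := not_lt.1 fun h2 => h ⟨h1, h2⟩
    filter_upwards [self_mem_nhdsWithin] with s hs
    rw [hP.bump_of_ge h2, hP.bump_of_ge (h2.trans (le_of_lt hs))]

include hP in
theorem bump_left_of_inactive (h : ¬ (fp < t ∧ t ≤ fm)) :
    ∀ᶠ s : unitInterval in 𝓝[<] t, bump (heightOf C H₀ c a) m fp fm s =
      bump (heightOf C H₀ c a) m fp fm t := by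
  rcases le_or_gt t fp with h1 | h1
  · filter_upwards [self_mem_nhdsWithin] with s hs
    rw [hP.bump_of_le h1, hP.bump_of_le ((le_of_lt hs).trans h1)]
  · have h2 : fm < t := not_le.1 fun h2 => h ⟨h1, h2⟩
    filter_upwards [nhdsWithin_le_nhds (Ioi_mem_nhds h2)] with s hs
    rw [hP.bump_of_ge h2.le, hP.bump_of_ge (le_of_lt hs)]

theorem castLattice_move (Λ : (J →₀ ℤ) →ₗ[ℤ] ℤ) (a : J) (x : J →₀ ℤ) :
    castLattice (move C Λ (simple a) x) =
      castLattice x + (ht C Λ x (single a 1) : ℝ) • single a 1 := by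
  rw [move, map_add, simple]
  simp

/-- When the added coefficient grows with the slope of the height, the velocity undergoes exactly
the simple reflection. -/
theorem Germ.add_bump {F : Filter unitInterval} (hg : Germ F n c t x) (Λ : (J →₀ ℤ) →ₗ[ℤ] ℤ)
    {b : unitInterval → ℝ} (hb : ∀ᶠ s : unitInterval in F,
      b s = b t + n * ((s : ℝ) - t) * ht C Λ x (single a 1)) :
    Germ F n (fun s => c s + single a (b s)) t (move C Λ (simple a) x) := by
  filter_upwards [hg, hb] with s h1 h2
  rw [h1, h2, castLattice_move, smul_add, smul_smul, single_add, smul_single_one]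
  abel

theorem Germ.add_const {F : Filter unitInterval} (hg : Germ F n c t x)
    {b : unitInterval → ℝ} (hb : ∀ᶠ s : unitInterval in F, b s = b t) :
    Germ F n (fun s => c s + single a (b s)) t x := by
  filter_upwards [hg, hb] with s h1 h2
  rw [h1, h2]
  abel

theorem IntegralAt.add_bump {T : ℝ} (hi : IntegralAt T c t x) (Λ : (J →₀ ℤ) →ₗ[ℤ] ℤ)
    {b : unitInterval → ℝ} {z : ℤ} (hb : b t = z + T * ht C Λ x (single a 1)) :
    IntegralAt T (fun s => c s + single a (b s)) t (move C Λ (simple a) x) := by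
  obtain ⟨y, hy⟩ := hi
  refine ⟨y + single a z, ?_⟩
  dsimp only
  rw [hy, hb, castLattice_move, map_add, castLattice_single, smul_add, smul_smul, single_add,
    smul_single_one]
  abel

theorem IntegralAt.add_int {T : ℝ} (hi : IntegralAt T c t x)
    {b : unitInterval → ℝ} {z : ℤ} (hb : b t = z) :
    IntegralAt T (fun s => c s + single a (b s)) t x := by
  obtain ⟨y, hy⟩ := hi
  refine ⟨y + single a z, ?_⟩
  dsimp only
  rw [hy, hb, map_add, castLattice_single]
  abel

include hd hC hn hH hc hP in
/-- Root operators preserve concatenations of Lakshmibai--Seshadri paths. -/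
theorem IsLS.add_bump :
    IsLS C Λ fun s => c s + single a (bump (heightOf C H₀ c a) m fp fm s) := by
  classical
  intro l t h1 h2
  obtain ⟨xl, xr, hl, hr, hch⟩ := hc l t h1 h2
  have hfp : heightOf C H₀ c a fp = m := hP.isGreatest.1
  have hfm : heightOf C H₀ c a fm = m + 1 := hP.isLeast'.1.2
  have bint : ∀ {x}, IntegralAt (n * (t : ℝ) - l) c t x → fp ≤ t → t ≤ fm → ∃ z : ℤ,
      bump (heightOf C H₀ c a) m fp fm t =
        z + (n * (t : ℝ) - l) * ht C (Λ l) x (single a 1) := by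
    intro x hi ht ht'
    obtain ⟨z, hz⟩ := hH.height_int (C := C) a h1 h2 hi
    exact ⟨z - m, by rw [hP.bump_of_mem ht ht', hz]; push_cast; ring⟩
  have bint' : t ≤ fp ∨ fm ≤ t → ∃ z : ℤ, bump (heightOf C H₀ c a) m fp fm t = z := by
    rintro (h | h)
    · exact ⟨0, by rw [hP.bump_of_le h]; simp⟩
    · exact ⟨1, by rw [hP.bump_of_ge h]; simp⟩
  have sr : n * (t : ℝ) < l + 1 → fp ≤ t → t < fm → 0 ≤ ht C (Λ l) xr (single a 1) := by
    intro h2' ht ht'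
    have : (𝓝[>] t).NeBot := nhdsGT_neBot_of_exists_gt ⟨1, lt_one_of_segment h2'⟩
    have hev : ∀ᶠ s in 𝓝[>] t, heightOf C H₀ c a t ≤ heightOf C H₀ c a s := by
      filter_upwards [nhdsWithin_le_nhds (Iio_mem_nhds ht'), self_mem_nhdsWithin] with s hs1 hs2
      rcases ht.eq_or_lt with rfl | ht
      · rw [hfp]; exact (hP.lt_height hs2).le
      · exact height_le_height hd hC hn hH hc hP ht (le_of_lt hs2) hs1
    exact_mod_cast slope_right_nonneg hn (hH.height_right (C := C) a h1 h2' (hr h2').1) hev.frequently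
  have sl : (l : ℝ) < n * (t : ℝ) → fp < t → t ≤ fm → 0 ≤ ht C (Λ l) xl (single a 1) := by
    intro h1' ht ht'
    have : (𝓝[<] t).NeBot := nhdsLT_neBot_of_exists_lt ⟨0, pos_of_segment h1'⟩
    have hev : ∀ᶠ s in 𝓝[<] t, heightOf C H₀ c a s ≤ heightOf C H₀ c a t := by
      filter_upwards [nhdsWithin_le_nhds (Ioi_mem_nhds ht), self_mem_nhdsWithin] with s hs1 hs2
      rcases ht'.eq_or_lt with rfl | ht'
      · rw [hfm]; exact (hP.height_lt (le_of_lt hs1) hs2).le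
      · exact height_le_height hd hC hn hH hc hP hs1 (le_of_lt hs2) ht'
    exact_mod_cast slope_left_nonneg hn (hH.height_left (C := C) a h1' h2 (hl h1').1) hev.frequently
  -- A velocity is reflected precisely when its side of `t` lies in the interval from `fp` to `fm`,
  -- which explains the different strict inequalities.
  refine ⟨if fp < t ∧ t ≤ fm then move C (Λ l) (simple a) xl else xl,
    if fp ≤ t ∧ t < fm then move C (Λ l) (simple a) xr else xr, fun h1' => ?_, fun h2' => ?_,
    fun h1' h2' => ?_⟩
  · obtain ⟨hg, hi, hf⟩ := hl h1'
    split_ifs with ha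
    · obtain ⟨z, hz⟩ := bint hi ha.1.le ha.2
      exact ⟨hg.add_bump (Λ l) (bump_left_of_active hP ha.1 ha.2 (hH.height_left a h1' h2 hg)),
        hi.add_bump (Λ l) hz, finite_inversions_move_simple hd hC hf a⟩
    · obtain ⟨z, hz⟩ := bint' (by
        by_contra hcon
        rw [not_or, not_le, not_le] at hcon
        exact ha ⟨hcon.1, hcon.2.le⟩)
      exact ⟨hg.add_const (bump_left_of_inactive hP ha), hi.add_int hz, hf⟩
  · obtain ⟨hg, hi, hf⟩ := hr h2'
    split_ifs with ha
    · obtain ⟨z, hz⟩ := bint hi ha.1 ha.2.le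
      exact ⟨hg.add_bump (Λ l) (bump_right_of_active hP ha.1 ha.2 (hH.height_right a h1 h2' hg)),
        hi.add_bump (Λ l) hz, finite_inversions_move_simple hd hC hf a⟩
    · obtain ⟨z, hz⟩ := bint' (by
        by_contra hcon
        rw [not_or, not_le, not_le] at hcon
        exact ha ⟨hcon.1.le, hcon.2⟩)
      exact ⟨hg.add_const (bump_right_of_inactive hP ha), hi.add_int hz, hf⟩
  · have hch' := hch h1' h2'
    have hff := hP.lt
    rcases lt_trichotomy t fp with ht | rfl | ht
    · rwa [if_neg (fun h => absurd h.1 (not_le.2 ht)), if_neg (fun h => absurd h.1 (not_lt.2 ht.le))]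
    · rw [if_pos ⟨le_rfl, hff⟩, if_neg (fun h => lt_irrefl _ h.1)]
      -- Since `fp` is a global minimum, the left slope there is nonpositive and the right slope is
      -- nonnegative.
      refine hch'.move_left hd hC (sr h2' le_rfl hff) ?_
      have : (𝓝[<] t).NeBot := nhdsLT_neBot_of_exists_lt ⟨0, pos_of_segment h1'⟩
      have hev : ∀ᶠ s in 𝓝[<] t, heightOf C H₀ c a t ≤ heightOf C H₀ c a s :=
        Eventually.of_forall fun s => by
          rw [hfp]; exact minHeight_le_height hd hC hn hH hc hP s
      exact_mod_cast slope_left_nonpos hn (hH.height_left (C := C) a h1' h2 (hl h1').1) hev.frequently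
    · rcases lt_trichotomy t fm with ht' | rfl | ht'
      · rw [if_pos ⟨ht.le, ht'⟩, if_pos ⟨ht, ht'.le⟩]
        exact hch'.move_both hd hC (hl h1').2.2 (sr h2' ht.le ht') (sl h1' ht ht'.le)
      · rw [if_neg (fun h => lt_irrefl _ h.2), if_pos ⟨ht, le_rfl⟩]
        refine hch'.move_right hd hC (hl h1').2.2 (sl h1' ht le_rfl) ?_
        -- The integrality required for the extra step comes from the integral height `m + 1` at
        -- `fm`.
        obtain ⟨z, hz⟩ := hH.height_int (C := C) a h1 h2 (hl h1').2.1
        rw [hfm] at hz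
        exact ⟨m + 1 - z, by push_cast; linarith⟩
      · rwa [if_neg (fun h => absurd h.2 (not_lt.2 ht'.le)), if_neg (fun h => absurd h.2 (not_le.2 ht'))]

end CartanRoot

/-! ### Monotone heights, and passage from local to global on the unit interval. -/

open Filter Topology

/-- The function `τ ↦ min 1 (a τ)` on `[0,1]`; it is `1` for `a = ⊤`. -/
noncomputable def ramp (a : ℕ∞) (τ : ℝ) : ℝ :=
  open Classical in if a = ⊤ then 1 else min 1 (a.toNat * τ)

/-- Here `m = 0`, so the height vanishes up to `fp` and is at least 1 from `fm` on. -/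
theorem IsProfile.bump_eq_min {h : unitInterval → ℝ} {m : ℤ} {fp fm : unitInterval}
    (H : IsProfile h m fp fm) (hmono : Monotone h) (h0 : h 0 = 0) (t : unitInterval) :
    bump h m fp fm t = min 1 (h t) := by
  have hnn : ∀ t, 0 ≤ h t := fun t => h0 ▸ hmono (bot_le : (0 : unitInterval) ≤ t)
  have hfp : h fp = m := H.isGreatest.1
  have hfm : h fm = m + 1 := H.isLeast'.1.2
  have hm : m = 0 := by
    have h1 : m ≤ 0 := H.isLeast.2 ⟨0, by simpa using h0⟩
    have h2 : (0 : ℝ) ≤ m := hfp ▸ hnn fp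
    have h3 : 0 ≤ m := by exact_mod_cast h2
    omega
  subst hm
  simp only [Int.cast_zero, zero_add] at hfp hfm
  rcases le_total t fp with h1 | h1
  · have : h t = 0 := le_antisymm (hfp ▸ hmono h1) (hnn t)
    rw [H.bump_of_le h1, this]; simp
  rcases le_total t fm with h2 | h2
  · rw [H.bump_of_mem h1 h2, min_eq_right (hfm ▸ hmono h2)]; simp
  · rw [H.bump_of_ge h2, min_eq_left (hfm ▸ hmono h2)]

theorem eq_of_slope_right {f : ℝ} {n : ℕ} (hn : 0 < n) {h : unitInterval → ℝ} {t : unitInterval}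
    {d d' : ℝ} (ht : t < 1)
    (hg : ∀ᶠ s : unitInterval in 𝓝[>] t, h s = f + n * ((s : ℝ) - t) * d)
    (hg' : ∀ᶠ s : unitInterval in 𝓝[>] t, h s = f + n * ((s : ℝ) - t) * d') : d = d' := by
  have : (𝓝[>] t).NeBot := nhdsGT_neBot_of_exists_gt ⟨1, ht⟩
  obtain ⟨s, ⟨h1, h2⟩, h3⟩ := ((hg.and hg').and self_mem_nhdsWithin).exists
  have : (t : ℝ) < s := h3
  have hpos : (n * ((s : ℝ) - t)) ≠ 0 :=
    (mul_pos (by exact_mod_cast hn) (by linarith) : (0 : ℝ) < n * ((s : ℝ) - t)).ne'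
  exact mul_left_cancel₀ hpos (by linarith)

theorem eq_of_slope_left {f : ℝ} {n : ℕ} (hn : 0 < n) {h : unitInterval → ℝ} {t : unitInterval}
    {d d' : ℝ} (ht : 0 < t)
    (hg : ∀ᶠ s : unitInterval in 𝓝[<] t, h s = f + n * ((s : ℝ) - t) * d)
    (hg' : ∀ᶠ s : unitInterval in 𝓝[<] t, h s = f + n * ((s : ℝ) - t) * d') : d = d' := by
  have : (𝓝[<] t).NeBot := nhdsLT_neBot_of_exists_lt ⟨0, ht⟩
  obtain ⟨s, ⟨h1, h2⟩, h3⟩ := ((hg.and hg').and self_mem_nhdsWithin).exists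
  have : (s : ℝ) < t := h3
  have hpos : (n * ((s : ℝ) - t)) ≠ 0 :=
    (mul_neg_of_pos_of_neg (by exact_mod_cast hn) (by linarith) : n * ((s : ℝ) - t) < 0).ne
  exact mul_left_cancel₀ hpos (by linarith)

theorem monotone_of_eventually_le {h : unitInterval → ℝ} (hcont : Continuous h)
    (hloc : ∀ t < 1, ∀ᶠ s in 𝓝[>] t, h t ≤ h s) : Monotone h := by
  intro a b hab
  have hcl : IsClosed ({t | h a ≤ h t} ∩ Set.Icc a b) :=
    (isClosed_le continuous_const hcont).inter isClosed_Icc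
  refine hcl.Icc_subset_of_forall_exists_gt (le_refl (h a)) ?_ ⟨hab, le_rfl⟩
  rintro t ⟨hat, ht⟩ y hy
  have ht1 : t < 1 := ht.2.trans_le le_top
  have : (𝓝[>] t).NeBot := nhdsGT_neBot_of_exists_gt ⟨1, ht1⟩
  obtain ⟨s, hs, hs'⟩ := ((hloc t ht1).and (Ioc_mem_nhdsGT hy)).exists
  exact ⟨s, le_trans hat hs, hs'⟩

/-- Propagation of an identity from left to right along an interval. -/
theorem eqOn_Icc_of_forall_eventually {f g : unitInterval → ℝ} (hf : Continuous f) (hg : Continuous g)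
    {a b : unitInterval} (ha : f a = g a)
    (h : ∀ t, a ≤ t → t < b → (∀ u, a ≤ u → u ≤ t → f u = g u) → ∀ᶠ s in 𝓝[>] t, f s = g s) :
    ∀ t, a ≤ t → t ≤ b → f t = g t := by
  intro t hat htb
  let E : Set unitInterval := {t | ∀ u, a ≤ u → u ≤ t → f u = g u}
  have hcl : IsClosed (E ∩ Set.Icc a b) := by
    refine isClosed_of_closure_subset fun t ht => ?_
    have ht' : t ∈ Set.Icc a b :=
      closure_minimal Set.inter_subset_right isClosed_Icc ht
    have ht2 : f t = g t := closure_minimal (s := E ∩ Set.Icc a b) (t := {t | f t = g t})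
      (fun u hu => hu.1 u hu.2.1 le_rfl) (isClosed_eq hf hg) ht
    refine ⟨fun u hau hut => ?_, ht'⟩
    rcases hut.eq_or_lt with rfl | hut
    · exact ht2
    · obtain ⟨v, hv, hvE⟩ := mem_closure_iff.1 ht (Set.Ioi u) isOpen_Ioi hut
      exact hvE.1 u hau (le_of_lt hv)
  refine hcl.Icc_subset_of_forall_exists_gt ?_ ?_ ⟨hat, htb⟩ t hat le_rfl
  · intro u h1 h2
    rw [le_antisymm h2 h1, ha]
  · rintro s ⟨hs, has, hsb⟩ y hy
    obtain ⟨v, hv, hvs⟩ := (mem_nhdsGT_iff_exists_Ioo_subset' hsb).1 (h s has hsb hs)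
    obtain ⟨w, hw1, hw2⟩ := exists_between (lt_min hv (Set.mem_Ioi.1 hy))
    refine ⟨w, fun u hau huw => ?_, hw1, (hw2.trans_le (min_le_right _ _)).le⟩
    rcases le_or_gt u s with h1 | h1
    · exact hs u hau h1
    · exact hvs ⟨h1, huw.trans_lt (hw2.trans_le (min_le_left _ _))⟩

/-! ### Heights of unused copies of an imaginary index. -/

namespace CartanRoot

open Finsupp

variable {J : Type*} {C : Matrix J J ℤ} {n : ℕ} {Λ : Fin n → (J →₀ ℤ) →ₗ[ℤ] ℤ}
  {H₀ : J → unitInterval → ℝ} {c : unitInterval → J →₀ ℝ} {l : Fin n} {t : unitInterval}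
  {x : J →₀ ℤ}

/-- An infinite set of indices which the path with coefficients `c` does not distinguish
and which do not occur in it. -/
structure IsFresh (C : Matrix J J ℤ) {n : ℕ} (Λ : Fin n → (J →₀ ℤ) →ₗ[ℤ] ℤ)
    (c : unitInterval → J →₀ ℝ) (S : Set J) : Prop where
  infinite : S.Infinite
  row_eq : ∀ q ∈ S, ∀ q' ∈ S, ∀ k ∉ S, C q k = C q' k
  weight_eq : ∀ q ∈ S, ∀ q' ∈ S, ∀ l, Λ l (single q 1) = Λ l (single q' 1)
  coeff_eq_zero : ∀ q ∈ S, ∀ t, c t q = 0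

theorem pairing_single_right (C : Matrix J J ℤ) (x : J →₀ ℤ) (q : J) :
    pairing C x (single q 1) = x.sum fun k z => z * C q k := by
  rw [pairing, linearCombination_apply, Finsupp.sum, LinearMap.sum_apply, Finsupp.sum]
  simp

theorem simple_injective : Function.Injective (simple : J → _) := by
  intro a b h
  exact single_left_injective one_ne_zero (congrArg Prod.fst h)

namespace IsFresh

variable {S : Set J} (hS : IsFresh C Λ c S) {q : J} (hq : q ∈ S)

include hS

theorem apply_eq_zero_of_germ {F : Filter unitInterval} [F.NeBot] (hn : 0 < n)
    (hF : ∀ᶠ s in F, s ≠ t) (hg : Germ F n c t x) {q : J} (hq : q ∈ S) : x q = 0 := by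
  obtain ⟨s, hs, hne⟩ := (hg.and hF).exists
  have := congrArg (fun f => f q) hs
  simp only [hS.coeff_eq_zero q hq, coe_add, coe_smul, Pi.add_apply, Pi.smul_apply, zero_add,
    castLattice_apply, smul_eq_mul] at this
  have hne' : (s : ℝ) - t ≠ 0 := sub_ne_zero.2 fun h => hne (Subtype.ext h)
  have hn' : (n : ℝ) ≠ 0 := by exact_mod_cast hn.ne'
  rcases mul_eq_zero.1 this.symm with h | h
  · exact absurd h (mul_ne_zero hn' hne')
  · exact_mod_cast h

/-- All members of `S` take the same value, because `x` has no component in `S` and their rows agree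
outside `S`. A negative value would make infinitely many simple roots inversions. -/
theorem ht_nonneg (hx : ∀ q ∈ S, x q = 0) (hfin : (inversions C (Λ l) x).Finite) {q : J}
    (hq : q ∈ S) : 0 ≤ ht C (Λ l) x (single q 1) := by
  by_contra hneg
  refine (hS.infinite.image (f := simple) simple_injective.injOn) (hfin.subset ?_)
  rintro _ ⟨q', hq', rfl⟩
  refine ⟨isPosRoot_simple q', ?_⟩
  have : ht C (Λ l) x (single q' 1) = ht C (Λ l) x (single q 1) := by
    rw [ht, ht, hS.weight_eq q' hq' q hq l, pairing_single_right, pairing_single_right]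
    congr 1
    refine Finsupp.sum_congr fun k hk => ?_
    rw [hS.row_eq q' hq' q hq k fun hkS => mem_support_iff.1 hk (hx k hkS)]
  change ht C (Λ l) x (single q' 1) < 0
  rw [this]
  exact not_le.1 hneg

theorem right_germ (hn : 0 < n) (hc : IsLS C Λ c) (hH : IsBaseHeight Λ H₀)
    (h1 : (l : ℝ) ≤ n * (t : ℝ)) (h2 : n * (t : ℝ) < l + 1) {q : J} (hq : q ∈ S) :
    ∃ d : ℤ, 0 ≤ d ∧ (∀ᶠ s : unitInterval in 𝓝[>] t,
      heightOf C H₀ c q s = heightOf C H₀ c q t + n * ((s : ℝ) - t) * d) ∧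
      ∃ z : ℤ, heightOf C H₀ c q t = z + (n * (t : ℝ) - l) * d := by
  obtain ⟨xl, xr, hl, hr, hch⟩ := hc l t h1 h2.le
  obtain ⟨hg, hi, hf⟩ := hr h2
  have : (𝓝[>] t).NeBot := nhdsGT_neBot_of_exists_gt ⟨1, lt_one_of_segment h2⟩
  have hx : ∀ q ∈ S, xr q = 0 := fun q hq => hS.apply_eq_zero_of_germ hn
    (by filter_upwards [self_mem_nhdsWithin] with s hs using ne_of_gt hs) hg hq
  exact ⟨_, hS.ht_nonneg hx hf hq, hH.height_right q h1 h2 hg, hH.height_int q h1 h2.le hi⟩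

/-- The slopes of the height do not increase within a subinterval. -/
theorem kink (hn : 0 < n) (hc : IsLS C Λ c) (hH : IsBaseHeight Λ H₀)
    (h1 : (l : ℝ) < n * (t : ℝ)) (h2 : n * (t : ℝ) < l + 1) {q : J} (hq : q ∈ S)
    (hrow : ∀ k, k ≠ q → C q k ≤ 0) :
    ∃ d d' : ℤ, d' ≤ d ∧
      (∀ᶠ s : unitInterval in 𝓝[<] t,
        heightOf C H₀ c q s = heightOf C H₀ c q t + n * ((s : ℝ) - t) * d) ∧
      (∀ᶠ s : unitInterval in 𝓝[>] t,
        heightOf C H₀ c q s = heightOf C H₀ c q t + n * ((s : ℝ) - t) * d') := by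
  obtain ⟨xl, xr, hl, hr, hch⟩ := hc l t h1.le h2.le
  obtain ⟨hg, -, -⟩ := hr h2
  obtain ⟨hg', -, -⟩ := hl h1
  have : (𝓝[>] t).NeBot := nhdsGT_neBot_of_exists_gt ⟨1, lt_one_of_segment h2⟩
  have : (𝓝[<] t).NeBot := nhdsLT_neBot_of_exists_lt ⟨0, pos_of_segment h1⟩
  have hx : xr q = 0 := hS.apply_eq_zero_of_germ hn
    (by filter_upwards [self_mem_nhdsWithin] with s hs using ne_of_gt hs) hg hq
  have hx' : xl q = 0 := hS.apply_eq_zero_of_germ hn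
    (by filter_upwards [self_mem_nhdsWithin] with s hs using ne_of_lt hs) hg' hq
  refine ⟨_, _, ?_, hH.height_left q h1 h2.le hg', hH.height_right q h1.le h2 hg⟩
  have hle := (hch h1 h2).le
  -- The chain makes `xl - xr` nonnegative, and its coefficient at `q` is zero, so only nonpositive
  -- off-diagonal entries contribute.
  have : pairing C (xl - xr) (single q 1) ≤ 0 := by
    rw [pairing_single_right]
    refine Finset.sum_nonpos fun k _ => ?_
    by_cases hk : k = q
    · subst hk; simp [hx, hx']
    · exact mul_nonpos_of_nonneg_of_nonpos (sub_nonneg.2 (hle k)) (hrow k hk)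
  rw [map_sub, LinearMap.sub_apply] at this
  rw [ht, ht]
  omega

theorem monotone_height (hn : 0 < n) (hc : IsLS C Λ c) (hH : IsBaseHeight Λ H₀) {q : J} (hq : q ∈ S)
    (hcont : Continuous (heightOf C H₀ c q)) : Monotone (heightOf C H₀ c q) := by
  refine monotone_of_eventually_le hcont fun t ht => ?_
  have hn' : (0 : ℝ) < n := by exact_mod_cast hn
  have h0 : 0 ≤ n * (t : ℝ) := mul_nonneg hn'.le t.2.1
  have ht' : (t : ℝ) < 1 := ht
  obtain ⟨d, hd, hg, -⟩ := hS.right_germ hn hc hH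
    (l := ⟨⌊n * (t : ℝ)⌋₊, (Nat.floor_lt h0).2 (by nlinarith)⟩) (Nat.floor_le h0)
    (Nat.lt_floor_add_one _) hq
  filter_upwards [hg, self_mem_nhdsWithin] with s hs hts
  have : (t : ℝ) < s := hts
  have : (0 : ℝ) ≤ n * ((s : ℝ) - t) * d :=
    mul_nonneg (mul_nonneg hn'.le (by linarith)) (by exact_mod_cast hd)
  linarith

/-- On each subinterval, the minimum of `1` and the height is a ramp. -/
theorem exists_ramp (hn : 0 < n) (hc : IsLS C Λ c) (hH : IsBaseHeight Λ H₀) {q : J} (hq : q ∈ S)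
    (hrow : ∀ k, k ≠ q → C q k ≤ 0) (hcont : Continuous (heightOf C H₀ c q))
    (h0 : heightOf C H₀ c q 0 = 0) (l : Fin n) :
    ∃ a : ℕ∞, ∀ t : unitInterval, (l : ℝ) ≤ n * (t : ℝ) → n * (t : ℝ) ≤ l + 1 →
      min 1 (heightOf C H₀ c q t) = ramp a (n * (t : ℝ) - l) := by
  have hmono := hS.monotone_height hn hc hH hq hcont
  have hnn : ∀ t, 0 ≤ heightOf C H₀ c q t := fun t => h0 ▸ hmono (bot_le : (0 : unitInterval) ≤ t)
  have hn' : (0 : ℝ) < n := by exact_mod_cast hn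
  have hl0 : (0 : ℝ) ≤ l := Nat.cast_nonneg _
  have hln : (l : ℝ) + 1 ≤ n := by exact_mod_cast l.2
  let s₀ : unitInterval := ⟨l / n, div_nonneg hl0 hn'.le, (div_le_one hn').2 (by linarith)⟩
  have hs₀ : n * (s₀ : ℝ) = l := mul_div_cancel₀ _ hn'.ne'
  have hle : ∀ t : unitInterval, (l : ℝ) ≤ n * (t : ℝ) → s₀ ≤ t := fun t ht =>
    (div_le_iff₀' hn').2 ht
  obtain ⟨d, hd, hg, z, hz⟩ := hS.right_germ (t := s₀) hn hc hH hs₀.ge (by linarith) hq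
  rw [hs₀, sub_self, zero_mul, add_zero] at hz
  have hz0 : 0 ≤ z := by
    have := hnn s₀
    rw [hz] at this
    exact_mod_cast this
  -- The height at the left end is a nonnegative integer `z`. If it is positive, monotonicity keeps
  -- the minimum equal to 1 and the ramp is `⊤`.
  rcases hz0.eq_or_lt with rfl | hzpos
  swap
  · refine ⟨⊤, fun t h1 _ => ?_⟩
    have h2 := hmono (hle t h1)
    have h3 : (1 : ℝ) ≤ z := by exact_mod_cast hzpos
    rw [ramp, if_pos rfl, min_eq_left (by linarith)]
  rw [Int.cast_zero] at hz
  have hd' : (0 : ℝ) ≤ d := by exact_mod_cast hd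
  -- Starting from 0 with slope `d`, the height cannot leave its initial line while that line is at
  -- most 1.
  have claim : ∀ b : unitInterval, (l : ℝ) ≤ n * (b : ℝ) → n * (b : ℝ) ≤ l + 1 →
      d * (n * (b : ℝ) - l) ≤ 1 → heightOf C H₀ c q b = d * (n * (b : ℝ) - l) := by
    intro b hb1 hb2 hb
    refine eqOn_Icc_of_forall_eventually (g := fun t => d * (n * (t : ℝ) - l)) (a := s₀) hcont
      (by fun_prop) (by simp [hz, hs₀]) ?_ b (hle b hb1) le_rfl
    intro t h1 h2 heq
    have h1' : (s₀ : ℝ) ≤ t := h1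
    have h2' : (t : ℝ) < b := h2
    have ht1 : (l : ℝ) ≤ n * (t : ℝ) := by rw [← hs₀]; gcongr
    have ht2 : n * (t : ℝ) < n * (b : ℝ) := by gcongr
    have ht3 : n * (t : ℝ) < l + 1 := by linarith
    obtain ⟨dr, hdr, hgr, w, hw⟩ := hS.right_germ hn hc hH ht1 ht3 hq
    have htd := heq t h1 le_rfl
    suffices dr = d by
      filter_upwards [hgr] with s hs
      rw [hs, this, htd]; ring
    rcases h1.eq_or_lt with rfl | hlt
    · have := eq_of_slope_right hn (lt_one_of_segment ht3) hgr hg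
      exact_mod_cast this
    have hlt' : (s₀ : ℝ) < t := hlt
    have ht1' : (l : ℝ) < n * (t : ℝ) := by rw [← hs₀]; gcongr
    obtain ⟨e, e', hee, hge, hge'⟩ := hS.kink hn hc hH ht1' ht3 hq hrow
    have he' : (dr : ℝ) = e' := eq_of_slope_right hn (lt_one_of_segment ht3) hgr hge'
    have he : (e : ℝ) = d := by
      refine eq_of_slope_left hn (pos_of_segment ht1') hge ?_
      filter_upwards [Ioo_mem_nhdsLT hlt] with s hs
      rw [heq s hs.1.le hs.2.le, htd]; ring
    have he2 : dr = e' := by exact_mod_cast he'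
    have he3 : e = d := by exact_mod_cast he
    have hdrd : dr ≤ d := by omega
    -- The drop in slope times the local time is an integer. It is nonnegative, and less than 1
    -- because the line has not yet reached 1 at `t`; hence there is no drop.
    have hw' : (n * (t : ℝ) - l) * ((d : ℝ) - dr) = w := by rw [htd] at hw; linarith
    have htpos : 0 < n * (t : ℝ) - l := by linarith
    have hdrd' : (dr : ℝ) ≤ d := by exact_mod_cast hdrd
    have hdr' : (0 : ℝ) ≤ dr := by exact_mod_cast hdr
    have hw0 : (0 : ℝ) ≤ w := by rw [← hw']; exact mul_nonneg htpos.le (by linarith)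
    have hw1 : (w : ℝ) < 1 := by
      rw [← hw']
      rcases hd'.eq_or_lt with h0 | hpos
      · have : (d : ℝ) - dr = 0 := by linarith
        rw [this]; simp
      · have h5 : d * (n * (t : ℝ) - l) < d * (n * (b : ℝ) - l) := by gcongr
        nlinarith [mul_nonneg htpos.le hdr']
    have hw2 : w = 0 := by
      have h6 : 0 ≤ w := by exact_mod_cast hw0
      have h7 : w < 1 := by exact_mod_cast hw1
      omega
    rw [hw2, Int.cast_zero] at hw'
    have : (d : ℝ) - dr = 0 := (mul_eq_zero.1 hw').resolve_left htpos.ne'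
    have : (dr : ℝ) = d := by linarith
    exact_mod_cast this
  refine ⟨(d.toNat : ℕ∞), fun t h1 h2 => ?_⟩
  have hcast : ((d.toNat : ℕ) : ℝ) = d := by
    have : ((d.toNat : ℕ) : ℤ) = d := Int.toNat_of_nonneg hd
    exact_mod_cast this
  rw [ramp, if_neg (ENat.natCast_ne_top _), ENat.toNat_natCast, hcast]
  rcases le_or_gt (d * (n * (t : ℝ) - l)) 1 with h3 | h3
  · rw [claim t h1 h2 h3]
  · have hdpos : (0 : ℝ) < d := by
      rcases hd'.eq_or_lt with h | h
      · rw [← h, zero_mul] at h3; linarith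
      · exact h
    have hb0 : n * (((l : ℝ) + 1 / d) / n) = l + 1 / d := mul_div_cancel₀ _ hn'.ne'
    have hbt : ((l : ℝ) + 1 / d) / n ≤ t := by
      rw [div_le_iff₀' hn']
      have : 1 / (d : ℝ) ≤ n * t - l := by rw [div_le_iff₀' hdpos]; exact h3.le
      linarith
    -- This is the time at which the line of slope `d` reaches 1; after it monotonicity suffices.
    let b : unitInterval := ⟨((l : ℝ) + 1 / d) / n, by positivity, hbt.trans t.2.2⟩
    have hb : n * (b : ℝ) = l + 1 / d := hb0
    have hb1 : (l : ℝ) ≤ n * (b : ℝ) := by rw [hb]; linarith [one_div_pos.2 hdpos]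
    have hbt' : n * (b : ℝ) ≤ n * (t : ℝ) := by
      have : (b : ℝ) ≤ t := hbt
      gcongr
    have hd1 : d * (n * (b : ℝ) - l) = 1 := by
      rw [hb]; field_simp; ring
    have h4 := claim b hb1 (hbt'.trans h2) hd1.le
    have h5 := hmono (show b ≤ t from hbt)
    rw [min_eq_left h3.le, min_eq_left (by linarith)]

end IsFresh

end CartanRoot

/-! ### Recovering ramps from their sum. -/

theorem ramp_top (τ : ℝ) : ramp ⊤ τ = 1 := if_pos rfl

theorem ramp_natCast (a : ℕ) (τ : ℝ) : ramp a τ = min 1 (a * τ) := by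
  rw [ramp, if_neg (ENat.natCast_ne_top _), ENat.toNat_natCast]

/-- Sampling at `1 / k` turns a ramp into the truncation of its slope at `k`, so the analytic data
become natural numbers. -/
theorem mul_ramp_one_div (a : ℕ∞) {k : ℕ} (hk : 0 < k) :
    (k : ℝ) * ramp a (1 / k) = ((min (k : ℕ∞) a).toNat : ℝ) := by
  have hk' : (0 : ℝ) < k := by exact_mod_cast hk
  induction a using ENat.recTopCoe with
  | top => simp [ramp_top]
  | coe a =>
    have h : (min (k : ℕ∞) a) = ((min k a : ℕ) : ℕ∞) := by
      rcases le_total k a with h | h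
      · rw [min_eq_left h, min_eq_left (by exact_mod_cast h)]
      · rw [min_eq_right h, min_eq_right (by exact_mod_cast h)]
    rw [ramp_natCast, h, ENat.toNat_natCast, mul_min_of_nonneg _ _ hk'.le, Nat.cast_min]
    congr 1
    · ring
    · field_simp

theorem le_of_forall_ramp_le {a b : ℕ∞}
    (h : ∀ τ : ℝ, 0 ≤ τ → τ ≤ 1 → ramp a τ ≤ ramp b τ) : a ≤ b := by
  refine ENat.forall_natCast_le_iff_le.1 fun k hk => ?_
  rcases Nat.eq_zero_or_pos k with rfl | hk0
  · simp
  have hk' : (0 : ℝ) < k := by exact_mod_cast hk0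
  have hk1 : (1 : ℝ) ≤ k := by exact_mod_cast hk0
  have h1 := mul_le_mul_of_nonneg_left
    (h (1 / k) (by positivity) (by rw [div_le_one hk']; exact hk1)) hk'.le
  rw [mul_ramp_one_div a hk0, mul_ramp_one_div b hk0, min_eq_left hk, ENat.toNat_natCast] at h1
  have h2 : k ≤ (min (k : ℕ∞) b).toNat := by exact_mod_cast h1
  have h3 : (k : ℕ∞) ≤ ((min (k : ℕ∞) b).toNat : ℕ∞) := by exact_mod_cast h2
  rw [ENat.coe_toNat (ne_top_of_le_ne_top (ENat.natCast_ne_top k) (min_le_left _ _))] at h3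
  exact h3.trans (min_le_right _ _)

/-- A sum of ramps determines the ramps up to order. -/
theorem eq_of_sum_ramp_eq {N : ℕ} {a b : Fin N → ℕ∞} (ha : Monotone a) (hb : Monotone b)
    (h : ∀ τ : ℝ, 0 ≤ τ → τ ≤ 1 → ∑ m, ramp (a m) τ = ∑ m, ramp (b m) τ) : a = b := by
  classical
  have hmin : ∀ k : ℕ, ∑ m, (min (k : ℕ∞) (a m)).toNat = ∑ m, (min (k : ℕ∞) (b m)).toNat := by
    intro k
    rcases Nat.eq_zero_or_pos k with rfl | hk
    · simp
    have hk' : (0 : ℝ) < k := by exact_mod_cast hk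
    have hk1 : (1 : ℝ) ≤ k := by exact_mod_cast hk
    have h1 := congrArg (fun x => (k : ℝ) * x)
      (h (1 / k) (by positivity) (by rw [div_le_one hk']; exact hk1))
    simp only [Finset.mul_sum, mul_ramp_one_div _ hk] at h1
    exact_mod_cast h1
  -- Raising the truncation level from `k` to `k + 1` adds 1 for each slope larger than `k`, so the
  -- truncated sums determine how many such slopes there are.
  have hcount : ∀ (a : Fin N → ℕ∞) (k : ℕ),
      ∑ m, (min ((k + 1 : ℕ) : ℕ∞) (a m)).toNat =
        ∑ m, (min (k : ℕ∞) (a m)).toNat + (Finset.univ.filter fun m => (k : ℕ∞) < a m).card := by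
    intro a k
    rw [Finset.card_filter, ← Finset.sum_add_distrib]
    refine Finset.sum_congr rfl fun m _ => ?_
    generalize a m = x
    induction x using ENat.recTopCoe with
    | top => simp
    | coe x =>
      have h : ∀ k : ℕ, (min (k : ℕ∞) x).toNat = min k x := by
        intro k
        rcases le_total k x with h | h
        · rw [min_eq_left h, min_eq_left (by exact_mod_cast h), ENat.toNat_natCast]
        · rw [min_eq_right h, min_eq_right (by exact_mod_cast h), ENat.toNat_natCast]
      simp only [h, Nat.cast_lt]
      split_ifs <;> omega
  have hcard : ∀ k : ℕ, (Finset.univ.filter fun m => (k : ℕ∞) < a m).card =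
      (Finset.univ.filter fun m => (k : ℕ∞) < b m).card := by
    intro k
    have h1 := hcount a k
    have h2 := hcount b k
    rw [hmin, hmin] at h1
    omega
  -- Both sets are upper sets in a linear order, so one contains the other, and equal cardinality
  -- makes them equal.
  have hset : ∀ k : ℕ, (Finset.univ.filter fun m => (k : ℕ∞) < a m) =
      (Finset.univ.filter fun m => (k : ℕ∞) < b m) := by
    intro k
    by_cases hsub : (Finset.univ.filter fun m => (k : ℕ∞) < a m) ⊆
        (Finset.univ.filter fun m => (k : ℕ∞) < b m)
    · exact Finset.eq_of_subset_of_card_le hsub (hcard k).ge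
    · symm
      refine Finset.eq_of_subset_of_card_le (fun m hm => ?_) (hcard k).le
      obtain ⟨m', hm', hmb'⟩ := Finset.not_subset.1 hsub
      simp only [Finset.mem_filter, Finset.mem_univ, true_and] at hm hm' hmb' ⊢
      refine hm'.trans_le (ha ?_)
      by_contra hlt
      exact hmb' (hm.trans_le (hb (not_le.1 hlt).le))
  have hiff : ∀ (k : ℕ) m, (k : ℕ∞) < a m ↔ (k : ℕ∞) < b m := by
    intro k m
    have := congrArg (fun s => m ∈ s) (hset k)
    simpa using this
  funext m
  have key : ∀ x y : ℕ∞, (∀ k : ℕ, (k : ℕ∞) < x ↔ (k : ℕ∞) < y) → x ≤ y := by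
    intro x y hxy
    by_contra hlt
    rw [not_le] at hlt
    lift y to ℕ using ne_top_of_lt hlt
    exact lt_irrefl _ ((hxy y).1 hlt)
  exact le_antisymm (key _ _ fun k => hiff k m) (key _ _ fun k => (hiff k m).symm)

/-! ### Weights in the Tits cone -/

section TitsCone

open Finsupp CartanRoot

variable {I : Type*} {A : Matrix I I ℤ} {Y : Type*} [AddCommGroup Y]

/-- The linear form on the coroot lattice of `Ã` that a weight of the original datum defines. -/
noncomputable def BorcherdsCartanDatum.tildeForm (D : BorcherdsCartanDatum A Y)
    (ν : Module.Dual ℤ Y) : (TildeIndex A →₀ ℤ) →ₗ[ℤ] ℤ :=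
  linearCombination ℤ fun q => ν (D.coroot q.1.1)

theorem tildeMatrix_self (q : TildeIndex A) : tildeMatrix A q q = 2 := if_pos rfl

theorem tildeMatrix_of_ne {q r : TildeIndex A} (h : q ≠ r) : tildeMatrix A q r = A q.1.1 r.1.1 :=
  if_neg h

theorem tildeIndex_eq_of_real {q r : TildeIndex A} (h : q.1.1 = r.1.1) (hr : A r.1.1 r.1.1 = 2) :
    q = r :=
  Subtype.ext (Prod.ext h ((q.2.2 (by rw [h]; exact hr)).trans (r.2.2 hr).symm))

theorem tildeMatrix_real {r : TildeIndex A} (hr : A r.1.1 r.1.1 = 2) (q : TildeIndex A) :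
    tildeMatrix A q r = A q.1.1 r.1.1 := by
  by_cases h : q = r
  · rw [h, tildeMatrix_self, hr]
  · exact tildeMatrix_of_ne h

/-- The `m`-th copy, counted from `0`, of an imaginary index. -/
def imaginaryIndex (A : Matrix I I ℤ) (i : I) (hi : A i i ≤ 0) (m : ℕ) : TildeIndex A :=
  ⟨(i, m + 1), by simp, fun h => by dsimp only at h; omega⟩

theorem imaginaryIndex_injective (i : I) (hi : A i i ≤ 0) :
    Function.Injective (imaginaryIndex A i hi) := by
  intro m m' h
  have := congrArg (fun q : TildeIndex A => q.1.2) h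
  simpa [imaginaryIndex] using this

variable (D : BorcherdsCartanDatum A Y)

theorem tildeForm_single (ν : Module.Dual ℤ Y) (q : TildeIndex A) :
    D.tildeForm ν (single q 1) = ν (D.coroot q.1.1) := by
  simp [BorcherdsCartanDatum.tildeForm]

theorem tildeForm_nonneg {ν : Module.Dual ℤ Y} (h : ∀ i, 0 ≤ ν (D.coroot i))
    {y : TildeIndex A →₀ ℤ} (hy : 0 ≤ y) : 0 ≤ D.tildeForm ν y := by
  rw [BorcherdsCartanDatum.tildeForm, linearCombination_apply]
  exact Finset.sum_nonneg fun q _ => mul_nonneg (hy q) (h _)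

/-- The column of a real index is the same in both matrices, since this index has a single copy and
diagonal entry 2. -/
theorem tildeForm_reflection_real {i : I} (hi : A i i = 2) (ν : Module.Dual ℤ Y)
    (y : TildeIndex A →₀ ℤ) :
    D.tildeForm (D.reflection i ν) y =
      D.tildeForm ν (sy (tildeMatrix A) ⟨(i, 1), le_rfl, fun _ => rfl⟩ y) := by
  induction y using Finsupp.induction_linear with
  | zero => simp
  | add x y hx hy => simp only [map_add, hx, hy]
  | single q z =>
    rw [← mul_one z, ← smul_eq_mul, ← smul_single, map_smul, map_smul, map_smul]
    congr 1
    rw [sy_apply, map_sub, map_smul, tildeForm_single, tildeForm_single, tildeForm_single,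
      pairing_single, tildeMatrix_real (r := ⟨(i, 1), le_rfl, fun _ => rfl⟩) hi]
    change ν (D.coroot q.1.1) - ν (D.coroot i) * D.root i (D.coroot q.1.1) = _
    rw [D.root_coroot, smul_eq_mul, mul_comm]

/-- A nonnegative multiple of an imaginary simple root is subtracted, and this root is nonpositive
at every simple coroot, including its own. -/
theorem tildeForm_le_reflection_imaginary {i : I} (hi : A i i ≤ 0) {ν : Module.Dual ℤ Y}
    (hν : 0 ≤ ν (D.coroot i)) {y : TildeIndex A →₀ ℤ} (hy : 0 ≤ y) :
    D.tildeForm ν y ≤ D.tildeForm (D.reflection i ν) y := by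
  rw [BorcherdsCartanDatum.tildeForm, BorcherdsCartanDatum.tildeForm, linearCombination_apply,
    linearCombination_apply]
  refine Finset.sum_le_sum fun q _ => mul_le_mul_of_nonneg_left ?_ (hy q)
  change ν (D.coroot q.1.1) ≤ ν (D.coroot q.1.1) - ν (D.coroot i) * D.root i (D.coroot q.1.1)
  rw [D.root_coroot]
  have : A q.1.1 i ≤ 0 := by
    by_cases h : q.1.1 = i
    · rw [h]; exact hi
    · exact D.isBorcherdsCartan.offDiag _ _ h
  nlinarith [mul_nonneg hν (neg_nonneg.2 this)]

/-- A dominant weight has no inversions, and a real reflection permutes all positive roots but one.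
For an imaginary `i`, finiteness forces a nonnegative value at the coroot of `i`, because infinitely
many copies share it; the reflection then only removes inversions. -/
theorem finite_inversions_titsCone (hC : IsBorcherdsCartan (tildeMatrix A)) {ν : Module.Dual ℤ Y}
    (hν : ν ∈ D.titsCone) : (inversions (tildeMatrix A) (D.tildeForm ν) 0).Finite := by
  obtain ⟨w, hw, μ, hμ, rfl⟩ := hν
  have hinv : ∀ {ν ρ}, ρ ∈ inversions (tildeMatrix A) (D.tildeForm ν) 0 ↔
      IsPosRoot (tildeMatrix A) ρ ∧ D.tildeForm ν ρ.2 < 0 := by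
    intro ν ρ
    simp [inversions, ht]
  suffices H : ∀ ν, (inversions (tildeMatrix A) (D.tildeForm ν) 0).Finite →
      (inversions (tildeMatrix A) (D.tildeForm (w ν)) 0).Finite by
    refine H μ (Set.Finite.subset Set.finite_empty fun ρ hρ => ?_)
    obtain ⟨hp, hn⟩ := hinv.1 hρ
    exact absurd (tildeForm_nonneg D hμ hp.2.2) (not_le.2 hn)
  induction hw using Submonoid.closure_induction with
  | one => exact fun ν h => h
  | mul u v _ _ hu hv => exact fun ν h => hu _ (hv ν h)
  | mem w hw =>
    obtain ⟨i, rfl⟩ := hw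
    intro ν h
    rcases D.isBorcherdsCartan.diag i with hi | hi
    · set a : TildeIndex A := ⟨(i, 1), le_rfl, fun _ => rfl⟩
      have h2 := pairing_simple (C := tildeMatrix A) tildeMatrix_self a
      refine ((h.image (reflect (tildeMatrix A) (simple a))).insert (simple a)).subset ?_
      intro ρ hρ
      obtain ⟨hp, hn⟩ := hinv.1 hρ
      rw [tildeForm_reflection_real D hi] at hn
      by_cases hρa : ρ = simple a
      · exact Or.inl hρa
      · exact Or.inr ⟨_, hinv.2 ⟨hp.reflect_simple tildeMatrix_self hC hρa, hn⟩,
          reflect_reflect h2 _⟩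
    · have hνi : 0 ≤ ν (D.coroot i) := by
        by_contra hneg
        have hinj : Function.Injective fun m => simple (imaginaryIndex A i hi m) := fun m m' hm =>
          imaginaryIndex_injective i hi (simple_injective hm)
        refine Set.infinite_range_of_injective hinj (h.subset ?_)
        rintro _ ⟨m, rfl⟩
        refine hinv.2 ⟨isPosRoot_simple _, ?_⟩
        change D.tildeForm ν (single (imaginaryIndex A i hi m) 1) < 0
        rw [tildeForm_single]
        exact not_le.1 hneg
      refine h.subset fun ρ hρ => ?_
      obtain ⟨hp, hn⟩ := hinv.1 hρ
      exact hinv.2 ⟨hp, (tildeForm_le_reflection_imaginary D hi hνi hp.2.2).trans_lt hn⟩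

end TitsCone

/-! ### From data and words to coefficients. -/

open Finsupp CartanRoot

section Datum

variable {I : Type*} {A : Matrix I I ℤ} {Y : Type*} [AddCommGroup Y]

theorem BorcherdsCartanDatum.linearIndependent_realWeight (D : BorcherdsCartanDatum A Y) :
    LinearIndependent ℝ fun i => realWeight (D.root i) := by
  rw [linearIndependent_iff]
  intro x hx
  have h := linearIndependent_iff.1 D.linearIndependent_root
    (x.mapRange (fun r : ℝ => (r : ℂ)) Complex.ofReal_zero) (by
      ext y
      have h1 := congrArg (fun g : Y →ₗ[ℤ] ℝ => ((g y : ℝ) : ℂ)) hx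
      rw [linearCombination_apply, Finsupp.sum_mapRange_index (by simp), Finsupp.sum]
      rw [linearCombination_apply, Finsupp.sum] at h1
      simpa [LinearMap.sum_apply, realWeight_apply] using h1)
  ext i
  have := DFunLike.congr_fun h i
  simpa using this

theorem BorcherdsCartanDatum.word_cons (D : BorcherdsCartanDatum A Y) (i : I) (l : List I)
    (x : Option (WeightPath Y)) : (D.word (i :: l)).1 x = D.f i ((D.word l).1 x) := by
  rw [BorcherdsCartanDatum.word, List.map_cons, List.prod_cons]
  rfl

theorem BorcherdsCartanDatum.exists_word (D : BorcherdsCartanDatum A Y) (F : D.rootMonoid) :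
    ∃ l, F = D.word l := by
  obtain ⟨F, hF⟩ := F
  induction hF using Submonoid.closure_induction_left with
  | one => exact ⟨[], rfl⟩
  | mul_left f hf F _ ih =>
    obtain ⟨i, rfl⟩ := hf
    obtain ⟨l, hl⟩ := ih
    refine ⟨i :: l, ?_⟩
    rw [BorcherdsCartanDatum.word, List.map_cons, List.prod_cons]
    exact Subtype.ext (congrArg (fun G : D.rootMonoid => D.f i * G.1) hl)

theorem BorcherdsCartanDatum.isProfile (D : BorcherdsCartanDatum A Y) (i : I) (p : WeightPath Y)
    (h : D.fPlus i p < 1) :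
    IsProfile (D.height i p) (D.minHeight i p) (D.fPlus i p) (D.fMinus i p) where
  continuous := D.continuous_height i p
  exists_int_one := by
    obtain ⟨μ, hμ⟩ := p.map_one
    exact ⟨μ (D.coroot i), by rw [BorcherdsCartanDatum.height, hμ, realWeight_apply]⟩
  isLeast := D.isLeast_minHeight i p
  isGreatest := D.isGreatest_fPlus i p
  lt_one := h
  isLeast' := D.isLeast_fMinus i p h

theorem BorcherdsCartanDatum.exists_rootOperator (D : BorcherdsCartanDatum A Y) (i : I)
    (p : WeightPath Y) (h : D.fPlus i p < 1) :
    ∃ p₁, D.rootOperator i p = some p₁ ∧ ∀ t, p₁.toFun t = p.toFun t -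
      bump (D.height i p) (D.minHeight i p) (D.fPlus i p) (D.fMinus i p) t •
        realWeight (D.root i) := by
  rw [BorcherdsCartanDatum.rootOperator, dif_pos h]
  refine ⟨_, rfl, fun t => ?_⟩
  dsimp only
  rw [bump]
  split_ifs <;> simp

theorem BorcherdsCartanDatum.rootOperator_eq_none (D : BorcherdsCartanDatum A Y) (i : I)
    (p : WeightPath Y) (h : ¬ D.fPlus i p < 1) : D.rootOperator i p = none := dif_neg h

theorem WeightPath.ofWeights_apply {n : ℕ} (μ : Fin n → Module.Dual ℤ Y) (t : unitInterval) (y : Y) :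
    (WeightPath.ofWeights μ).toFun t y = ∑ l : Fin n,
      (Set.projIcc (0 : ℝ) 1 zero_le_one ((n : ℝ) * (t : ℝ) - ((l : ℕ) : ℝ)) : ℝ) * (μ l y : ℝ) := by
  simp [WeightPath.ofWeights, WeightPath.concat, WeightPath.straight, LinearMap.sum_apply,
    realWeight_apply]

theorem WeightPath.ofWeights_segment {n : ℕ} (μ : Fin n → Module.Dual ℤ Y) (l : Fin n) (y : Y) :
    ∃ z : ℤ, ∀ t : unitInterval, (l : ℝ) ≤ n * (t : ℝ) → n * (t : ℝ) ≤ l + 1 →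
      (WeightPath.ofWeights μ).toFun t y = z + (n * (t : ℝ) - l) * (μ l y : ℝ) := by
  classical
  -- The integer collects the end points of the segments already traversed; later segments
  -- contribute nothing yet.
  refine ⟨∑ k : Fin n, if k < l then μ k y else 0, fun t h1 h2 => ?_⟩
  rw [WeightPath.ofWeights_apply]
  have : ∀ k : Fin n,
      (Set.projIcc (0 : ℝ) 1 zero_le_one ((n : ℝ) * (t : ℝ) - ((k : ℕ) : ℝ)) : ℝ) * (μ k y : ℝ) =
        ((if k < l then μ k y else 0 : ℤ) : ℝ) +
          if k = l then (n * (t : ℝ) - l) * (μ l y : ℝ) else 0 := by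
    intro k
    rcases lt_trichotomy k l with hk | rfl | hk
    · have hk' : ((k : ℕ) : ℝ) + 1 ≤ ((l : ℕ) : ℝ) := by exact_mod_cast hk
      rw [Set.projIcc_of_right_le _ (by linarith), if_pos hk, if_neg hk.ne]
      simp
    · rw [Set.projIcc_of_mem _ ⟨by linarith, by linarith⟩, if_neg (lt_irrefl _), if_pos rfl]
      simp
    · have hk' : ((l : ℕ) : ℝ) + 1 ≤ ((k : ℕ) : ℝ) := by exact_mod_cast hk
      rw [Set.projIcc_of_le_left _ (by linarith), if_neg (not_lt.2 hk.le), if_neg hk.ne']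
      simp
  rw [Finset.sum_congr rfl fun k _ => this k, Finset.sum_add_distrib, Finset.sum_ite_eq']
  simp

end Datum

theorem mapDomain_eq_sum_fiber {α β : Type*} (f : α → β) (x : α →₀ ℝ) (b : β)
    (F : Finset α) (h1 : ∀ a ∈ F, f a = b) (h2 : ∀ a, f a = b → a ∉ F → x a = 0) :
    mapDomain f x b = ∑ a ∈ F, x a := by
  classical
  rw [mapDomain, Finsupp.sum_apply, Finsupp.sum]
  have h3 : ∀ a ∈ x.support, (single (f a) (x a)) b = if a ∈ F then x a else 0 := by
    intro a ha
    by_cases hF : a ∈ F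
    · rw [if_pos hF, h1 a hF, single_eq_same]
    · rw [if_neg hF]
      exact single_eq_of_ne fun he => mem_support_iff.1 ha (h2 a he.symm hF)
  rw [Finset.sum_congr rfl h3, Finset.sum_ite_mem]
  refine Finset.sum_subset Finset.inter_subset_right fun a ha hna => ?_
  by_contra hne
  exact hna (Finset.mem_inter.2 ⟨mem_support_iff.2 hne, ha⟩)

/-! ### Common coefficients of the two paths of a word. -/

section Twin

variable {I : Type*} {A : Matrix I I ℤ} {Y : Type*} [AddCommGroup Y] (D : BorcherdsCartanDatum A Y)
  {Y' : Type*} [AddCommGroup Y'] (D' : BorcherdsCartanDatum (tildeMatrix A) Y')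
  {n : ℕ} (wt : Fin n → Module.Dual ℤ Y) (wt' : Fin n → Module.Dual ℤ Y')

/-- The path `p` and the path `p'` are obtained from the initial paths by subtracting the same
multiples of simple roots. -/
structure Realizes (p : WeightPath Y) (p' : WeightPath Y') (c : unitInterval → TildeIndex A →₀ ℝ) :
    Prop where
  left : ∀ t, p.toFun t = (WeightPath.ofWeights wt).toFun t -
    linearCombination ℝ (fun q : TildeIndex A => realWeight (D.root q.1.1)) (c t)
  right : ∀ t, p'.toFun t = (WeightPath.ofWeights wt').toFun t -
    linearCombination ℝ (fun q : TildeIndex A => realWeight (D'.root q)) (c t)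

/-- The heights of the initial path of the Cartan datum. -/
noncomputable def baseHeight (q : TildeIndex A) (t : unitInterval) : ℝ :=
  (WeightPath.ofWeights wt').toFun t (D'.coroot q)

/-- The height for an index of the Borcherds--Cartan datum of a path with coefficients `c`. -/
noncomputable def originalHeight (c : unitInterval → TildeIndex A →₀ ℝ) (i : I) (t : unitInterval) : ℝ :=
  (WeightPath.ofWeights wt).toFun t (D.coroot i) -
    linearCombination ℝ (fun q : TildeIndex A => (A i q.1.1 : ℝ)) (c t)

theorem linearCombination_realWeight_apply {J Z : Type*} [AddCommGroup Z] (v : J → Module.Dual ℤ Z)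
    (x : J →₀ ℝ) (z : Z) :
    linearCombination ℝ (fun q => realWeight (v q)) x z =
      linearCombination ℝ (fun q => (v q z : ℝ)) x := by
  simp [linearCombination_apply, Finsupp.sum, LinearMap.sum_apply, realWeight_apply]

variable {D D' wt wt'}
variable {p : WeightPath Y} {p' : WeightPath Y'} {c : unitInterval → TildeIndex A →₀ ℝ}

theorem Realizes.height_right (h : Realizes D D' wt wt' p p' c) (q : TildeIndex A) :
    D'.height q p' = heightOf (tildeMatrix A) (baseHeight D' wt') c q := by
  funext t
  rw [BorcherdsCartanDatum.height, h.right, LinearMap.sub_apply,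
    linearCombination_realWeight_apply]
  simp only [D'.root_coroot]
  rfl

theorem Realizes.height_left (h : Realizes D D' wt wt' p p' c) (i : I) :
    D.height i p = originalHeight D wt c i := by
  funext t
  rw [BorcherdsCartanDatum.height, h.left, LinearMap.sub_apply,
    linearCombination_realWeight_apply]
  simp only [D.root_coroot]
  rfl

variable (hwt' : ∀ l (q : TildeIndex A), wt' l (D'.coroot q) = wt l (D.coroot q.1.1))

include hwt'

theorem baseHeight_eq (q : TildeIndex A) (t : unitInterval) :
    baseHeight D' wt' q t = (WeightPath.ofWeights wt).toFun t (D.coroot q.1.1) := by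
  simp only [baseHeight, WeightPath.ofWeights_apply, hwt']

/-- Distinct copies of an imaginary `i` already have entry `A i i`. The matrices thus differ only at
the diagonal entries of imaginary copies, and for `q` that entry is multiplied by a vanishing
coefficient. -/
theorem heightOf_eq_originalHeight {q : TildeIndex A} (hq : A q.1.1 q.1.1 = 2 ∨ ∀ t, c t q = 0) :
    heightOf (tildeMatrix A) (baseHeight D' wt') c q = originalHeight D wt c q.1.1 := by
  funext t
  rw [heightOf, originalHeight, baseHeight_eq hwt', linearCombination_apply, linearCombination_apply]
  congr 1
  refine Finsupp.sum_congr fun k hk => ?_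
  by_cases hkq : q = k
  · subst hkq
    rw [tildeMatrix_self, hq.resolve_right fun h => mem_support_iff.1 hk (h t)]
  · rw [tildeMatrix_of_ne hkq]

theorem isBaseHeight_baseHeight :
    IsBaseHeight (fun l => D.tildeForm (wt l)) (baseHeight D' wt') := by
  intro l q
  obtain ⟨z, hz⟩ := WeightPath.ofWeights_segment wt' l (D'.coroot q)
  refine ⟨z, fun t h1 h2 => ?_⟩
  rw [baseHeight, hz t h1 h2, hwt', tildeForm_single]

omit hwt'

/-- Every root operator raises the heights of imaginary indices, so a bound of a coefficient by such
a height survives later operators. -/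
theorem originalHeight_le_add {i : I} (hi : A i i ≤ 0) (hA : IsBorcherdsCartan A) {q : TildeIndex A}
    {b : unitInterval → ℝ} (hb : ∀ t, 0 ≤ b t) (t : unitInterval) :
    originalHeight D wt c i t ≤ originalHeight D wt (fun s => c s + single q (b s)) i t := by
  have hiq : A i q.1.1 ≤ 0 := by
    by_cases h : i = q.1.1
    · rw [← h]; exact hi
    · exact hA.offDiag _ _ h
  have hiq' : (A i q.1.1 : ℝ) ≤ 0 := by exact_mod_cast hiq
  rw [originalHeight, originalHeight, map_add, linearCombination_single, smul_eq_mul]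
  nlinarith [mul_nonneg (hb t) (neg_nonneg.2 hiq')]

open Classical in
/-- The properties of the coefficients of the paths that a word `w` produces. -/
structure IsWordCoeff (D : BorcherdsCartanDatum A Y) (wt : Fin n → Module.Dual ℤ Y) (w : List I)
    (c : unitInterval → TildeIndex A →₀ ℝ) : Prop where
  isLS : IsLS (tildeMatrix A) (fun l => D.tildeForm (wt l)) c
  eq_zero : ∀ i hi m, w.count i ≤ m → ∀ t, c t (imaginaryIndex A i hi m) = 0
  monotone : ∀ i hi m m', m ≤ m' → m' < w.count i → ∀ t,
    c t (imaginaryIndex A i hi m) ≤ c t (imaginaryIndex A i hi m')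
  -- The right-hand side is the coefficient that the next copy of `i` would receive, so this bound
  -- keeps the copies ordered.
  le : ∀ i hi m, m < w.count i → ∀ t,
    c t (imaginaryIndex A i hi m) ≤ min 1 (originalHeight D wt c i t)
  ramp : ∀ i hi m, m < w.count i → ∀ l : Fin n, ∃ a : ℕ∞, ∀ t : unitInterval,
    (l : ℝ) ≤ n * (t : ℝ) → n * (t : ℝ) ≤ l + 1 →
      c t (imaginaryIndex A i hi m) = ramp a (n * (t : ℝ) - l)
  one : ∀ i hi m, m < w.count i → c 1 (imaginaryIndex A i hi m) = 1

theorem isWordCoeff_nil (hC : IsBorcherdsCartan (tildeMatrix A)) (hwt : ∀ l, wt l ∈ D.titsCone) :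
    IsWordCoeff D wt [] (0 : unitInterval → TildeIndex A →₀ ℝ) where
  isLS := isLS_zero _ _ fun l => finite_inversions_titsCone D hC (hwt l)
  eq_zero _ _ _ _ _ := rfl
  monotone _ _ _ _ _ h := by simp at h
  le _ _ _ h := by simp at h
  ramp _ _ _ h := by simp at h
  one _ _ _ h := by simp at h

open Classical in
theorem nextIndex_imaginary {i : I} (hi : A i i ≤ 0) (w : List I) :
    nextIndex A i w = imaginaryIndex A i hi (w.count i) := by
  have : A i i ≠ 2 := by omega
  simp [nextIndex, imaginaryIndex, this]

theorem nextIndex_fst (i : I) (w : List I) : (nextIndex A i w).1.1 = i := rfl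

open Classical in
theorem IsWordCoeff.isFresh {w : List I} (h : IsWordCoeff D wt w c) {i : I} (hi : A i i ≤ 0) :
    IsFresh (tildeMatrix A) (fun l => D.tildeForm (wt l)) c
      (imaginaryIndex A i hi '' Set.Ici (w.count i)) where
  infinite := (Set.Ici_infinite _).image (imaginaryIndex_injective i hi).injOn
  row_eq := by
    rintro q hq q' hq' k hk
    rw [tildeMatrix_of_ne (ne_of_mem_of_not_mem hq hk), tildeMatrix_of_ne (ne_of_mem_of_not_mem hq' hk)]
    obtain ⟨m, -, rfl⟩ := hq
    obtain ⟨m', -, rfl⟩ := hq'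
    rfl
  weight_eq := by
    rintro _ ⟨m, -, rfl⟩ _ ⟨m', -, rfl⟩ l
    rw [tildeForm_single, tildeForm_single]
    rfl
  coeff_eq_zero := by
    rintro _ ⟨m, hm, rfl⟩ t
    exact h.eq_zero i hi m hm t

include hwt' in
theorem IsWordCoeff.heightOf_nextIndex {w : List I} (h : IsWordCoeff D wt w c) (i : I) :
    heightOf (tildeMatrix A) (baseHeight D' wt') c (nextIndex A i w) = originalHeight D wt c i := by
  classical
  refine heightOf_eq_originalHeight hwt' (q := nextIndex A i w) ?_
  rcases D.isBorcherdsCartan.diag i with hi | hi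
  · exact Or.inl hi
  · right
    rw [nextIndex_imaginary hi]
    exact h.eq_zero i hi _ le_rfl

-- For imaginary `i` the new coefficient is the minimum of 1 and the height of `i` before the
-- operator, since that height is monotone. It dominates the older copies by the field `le` and is a
-- ramp by `IsFresh.exists_ramp`; the coefficients of all other copies are unchanged.
include hwt' in
theorem IsWordCoeff.cons {w : List I} (h : IsWordCoeff D wt w c) (hn : 0 < n) {i : I}
    {m : ℤ} {fp fm : unitInterval}
    (hP : IsProfile (heightOf (tildeMatrix A) (baseHeight D' wt') c (nextIndex A i w)) m fp fm)
    (h0 : heightOf (tildeMatrix A) (baseHeight D' wt') c (nextIndex A i w) 0 = 0) :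
    IsWordCoeff D wt (i :: w) fun s => c s + single (nextIndex A i w)
      (bump (heightOf (tildeMatrix A) (baseHeight D' wt') c (nextIndex A i w)) m fp fm s) := by
  classical
  have hC := D'.isBorcherdsCartan
  have hH := isBaseHeight_baseHeight (D := D) (D' := D') hwt'
  have hA := D.isBorcherdsCartan
  have hLS := h.isLS.add_bump tildeMatrix_self hC hn hH hP
  have hoh := h.heightOf_nextIndex hwt' i
  set b := bump (heightOf (tildeMatrix A) (baseHeight D' wt') c (nextIndex A i w)) m fp fm with hb
  have hb0 : ∀ t, 0 ≤ b t := fun t => hP.bump_nonneg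
  have hle : ∀ j, A j j ≤ 0 → ∀ t, min 1 (originalHeight D wt c j t) ≤
      min 1 (originalHeight D wt (fun s => c s + single (nextIndex A i w) (b s)) j t) :=
    fun j hj t => min_le_min_left _ (originalHeight_le_add hj hA hb0 t)
  have hold : ∀ j hj k, (j = i → k ≠ w.count i) → ∀ t,
      (c t + single (nextIndex A i w) (b t)) (imaginaryIndex A j hj k) =
        c t (imaginaryIndex A j hj k) := by
    intro j hj k hk t
    have hne : nextIndex A i w ≠ imaginaryIndex A j hj k := by
      intro he
      have hij : i = j := congrArg (fun q : TildeIndex A => q.1.1) he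
      subst hij
      rw [nextIndex_imaginary hj] at he
      exact hk rfl (imaginaryIndex_injective _ hj he).symm
    rw [Finsupp.add_apply, single_eq_of_ne' hne, add_zero]
  have hcount : ∀ j, (j ≠ i ∧ (i :: w).count j = w.count j) ∨
      (j = i ∧ (i :: w).count j = w.count i + 1) := by
    intro j
    by_cases hj : j = i
    · subst hj; exact Or.inr ⟨rfl, List.count_cons_self⟩
    · exact Or.inl ⟨hj, List.count_cons_of_ne (Ne.symm hj)⟩
  have hnew : ∀ hi t, (c t + single (nextIndex A i w) (b t)) (imaginaryIndex A i hi (w.count i)) =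
      min 1 (originalHeight D wt c i t) := by
    intro hi t
    have hq : nextIndex A i w ∈ imaginaryIndex A i hi '' Set.Ici (w.count i) :=
      ⟨_, Set.mem_Ici.2 le_rfl, (nextIndex_imaginary hi w).symm⟩
    have hmono := (h.isFresh hi).monotone_height hn h.isLS hH hq hP.continuous
    rw [← nextIndex_imaginary hi, Finsupp.add_apply, single_eq_same, hb, hP.bump_eq_min hmono h0, hoh,
      nextIndex_imaginary hi, h.eq_zero i hi _ le_rfl, zero_add]
  constructor
  · exact hLS
  · intro j hj k hk t
    rcases hcount j with ⟨hji, e⟩ | ⟨rfl, e⟩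
    · rw [hold j hj k (fun h => absurd h hji), h.eq_zero j hj k (e ▸ hk)]
    · rw [hold j hj k (by omega), h.eq_zero j hj k (by omega)]
  · intro j hj k k' hkk' hk' t
    rcases hcount j with ⟨hji, e⟩ | ⟨rfl, e⟩
    · rw [hold j hj k (fun h => absurd h hji), hold j hj k' (fun h => absurd h hji)]
      exact h.monotone j hj k k' hkk' (e ▸ hk') t
    · rcases Nat.lt_or_ge k' (w.count j) with h1 | h1
      · rw [hold j hj k (by omega), hold j hj k' (by omega)]
        exact h.monotone j hj k k' hkk' h1 t
      · have hk'' : k' = w.count j := by omega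
        subst hk''
        rw [hnew]
        rcases hkk'.eq_or_lt with rfl | h2
        · rw [hnew]
        · rw [hold j hj k (by omega)]
          exact h.le j hj k h2 t
  · intro j hj k hk t
    refine le_trans ?_ (hle j hj t)
    rcases hcount j with ⟨hji, e⟩ | ⟨rfl, e⟩
    · rw [hold j hj k (fun h => absurd h hji)]
      exact h.le j hj k (e ▸ hk) t
    · rcases Nat.lt_or_ge k (w.count j) with h1 | h1
      · rw [hold j hj k (by omega)]
        exact h.le j hj k h1 t
      · have hk'' : k = w.count j := by omega
        subst hk''
        rw [hnew]
  · intro j hj k hk l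
    rcases hcount j with ⟨hji, e⟩ | ⟨rfl, e⟩
    · simp only [hold j hj k (fun h => absurd h hji)]
      exact h.ramp j hj k (e ▸ hk) l
    · rcases Nat.lt_or_ge k (w.count j) with h1 | h1
      · simp only [hold j hj k (by omega)]
        exact h.ramp j hj k h1 l
      · have hk'' : k = w.count j := by omega
        subst hk''
        have hq : nextIndex A j w ∈ imaginaryIndex A j hj '' Set.Ici (w.count j) :=
          ⟨_, Set.mem_Ici.2 le_rfl, (nextIndex_imaginary hj w).symm⟩
        obtain ⟨a, ha⟩ := (h.isFresh hj).exists_ramp hn h.isLS hH hq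
          (fun q hq => hC.offDiag _ _ hq.symm) hP.continuous h0 l
        refine ⟨a, fun t h1 h2 => ?_⟩
        rw [hnew, ← hoh, ha t h1 h2]
  · intro j hj k hk
    rcases hcount j with ⟨hji, e⟩ | ⟨rfl, e⟩
    · rw [hold j hj k (fun h => absurd h hji), h.one j hj k (e ▸ hk)]
    · rcases Nat.lt_or_ge k (w.count j) with h1 | h1
      · rw [hold j hj k (by omega), h.one j hj k h1]
      · have hk'' : k = w.count j := by omega
        subst hk''
        rw [Finsupp.add_apply, h.eq_zero j hj _ le_rfl, ← nextIndex_imaginary hj, single_eq_same, hb,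
          hP.bump_one, zero_add]

end Twin

/-! ### Comparison of the two paths and construction of the map. -/

open Finsupp CartanRoot

section Twin

variable {I : Type*} {A : Matrix I I ℤ} {Y : Type*} [AddCommGroup Y] {D : BorcherdsCartanDatum A Y}
  {Y' : Type*} [AddCommGroup Y'] {D' : BorcherdsCartanDatum (tildeMatrix A) Y'}
  {n : ℕ} {wt : Fin n → Module.Dual ℤ Y} {wt' : Fin n → Module.Dual ℤ Y'}

/-- The root operators depend on the height only. -/
theorem minHeight_congr {I₁ I₂ : Type*} {A₁ : Matrix I₁ I₁ ℤ} {A₂ : Matrix I₂ I₂ ℤ} {Y₁ Y₂ : Type*}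
    [AddCommGroup Y₁] [AddCommGroup Y₂] {D₁ : BorcherdsCartanDatum A₁ Y₁}
    {D₂ : BorcherdsCartanDatum A₂ Y₂} {i₁ : I₁} {i₂ : I₂} {p₁ : WeightPath Y₁} {p₂ : WeightPath Y₂}
    (h : D₁.height i₁ p₁ = D₂.height i₂ p₂) :
    D₁.minHeight i₁ p₁ = D₂.minHeight i₂ p₂ ∧ D₁.fPlus i₁ p₁ = D₂.fPlus i₂ p₂ ∧
      D₁.fMinus i₁ p₁ = D₂.fMinus i₂ p₂ := by
  have h1 : D₁.minHeight i₁ p₁ = D₂.minHeight i₂ p₂ := by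
    rw [BorcherdsCartanDatum.minHeight, BorcherdsCartanDatum.minHeight, h]
  have h2 : D₁.fPlus i₁ p₁ = D₂.fPlus i₂ p₂ := by
    rw [BorcherdsCartanDatum.fPlus, BorcherdsCartanDatum.fPlus, h, h1]
  refine ⟨h1, h2, ?_⟩
  rw [BorcherdsCartanDatum.fMinus, BorcherdsCartanDatum.fMinus, h, h1, h2]

/-- The two paths of a word and of its ordered index vanish simultaneously, and otherwise have
common coefficients. -/
theorem word_twin (hn : 0 < n) (hwt : ∀ l, wt l ∈ D.titsCone)
    (hwt' : ∀ l (q : TildeIndex A), wt' l (D'.coroot q) = wt l (D.coroot q.1.1)) (w : List I) :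
    ((D.word w).1 (some (WeightPath.ofWeights wt)) = none ∧
      (D'.word (orderedIndex A w)).1 (some (WeightPath.ofWeights wt')) = none) ∨
    ∃ p p' c, (D.word w).1 (some (WeightPath.ofWeights wt)) = some p ∧
      (D'.word (orderedIndex A w)).1 (some (WeightPath.ofWeights wt')) = some p' ∧
      Realizes D D' wt wt' p p' c ∧ IsWordCoeff D wt w c := by
  induction w with
  | nil =>
    exact Or.inr ⟨_, _, 0, rfl, rfl, ⟨fun t => by simp, fun t => by simp⟩,
      isWordCoeff_nil D'.isBorcherdsCartan hwt⟩
  | cons i w ih =>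
    rw [orderedIndex, D.word_cons, D'.word_cons]
    rcases ih with ⟨h1, h2⟩ | ⟨p, p', c, h1, h2, hR, hW⟩
    · left
      rw [h1, h2]
      exact ⟨rfl, rfl⟩
    rw [h1, h2]
    have hr := hR.height_right (nextIndex A i w)
    have hh : D.height i p = D'.height (nextIndex A i w) p' := by
      rw [hR.height_left, hr, hW.heightOf_nextIndex hwt']
    obtain ⟨e1, e2, e3⟩ := minHeight_congr hh
    by_cases hlt : D.fPlus i p < 1
    · right
      have hlt' : D'.fPlus (nextIndex A i w) p' < 1 := e2 ▸ hlt
      obtain ⟨p₁, hp₁, ht₁⟩ := D.exists_rootOperator i p hlt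
      obtain ⟨p₂, hp₂, ht₂⟩ := D'.exists_rootOperator _ p' hlt'
      have hP := D'.isProfile _ p' hlt'
      rw [hr] at hP ht₂
      rw [hh, hr, e1, e2, e3] at ht₁
      have h0 : heightOf (tildeMatrix A) (baseHeight D' wt') c (nextIndex A i w) 0 = 0 := by
        rw [← hr, BorcherdsCartanDatum.height, p'.map_zero, LinearMap.zero_apply]
      refine ⟨p₁, p₂, _, hp₁, hp₂, ⟨fun t => ?_, fun t => ?_⟩, hW.cons hwt' hn hP h0⟩
      · rw [ht₁, hR.left, map_add, linearCombination_single, nextIndex_fst, sub_sub]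
      · rw [ht₂, hR.right, map_add, linearCombination_single, sub_sub]
    · exact Or.inl ⟨D.rootOperator_eq_none i p hlt, D'.rootOperator_eq_none _ p' (e2 ▸ hlt)⟩

/-- The simple roots of the Cartan datum separate the copies, so the twin determines all
coefficients. -/
theorem Realizes.eq_of_eq_right {p₁ p₂ : WeightPath Y} {p' : WeightPath Y'}
    {c₁ c₂ : unitInterval → TildeIndex A →₀ ℝ} (h₁ : Realizes D D' wt wt' p₁ p' c₁)
    (h₂ : Realizes D D' wt wt' p₂ p' c₂) : p₁ = p₂ := by
  have hc : ∀ t, c₁ t = c₂ t := fun t =>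
    D'.linearIndependent_realWeight (sub_right_injective ((h₁.right t).symm.trans (h₂.right t)))
  refine WeightPath.ext (funext fun t => ?_)
  rw [h₁.left, h₂.left, hc]

-- Independence of the original simple roots recovers only `mapDomain` of the coefficients, which
-- for an imaginary index is the sum over its used copies.
open Classical in
theorem IsWordCoeff.mapDomain_imaginary {w : List I} {c : unitInterval → TildeIndex A →₀ ℝ}
    (h : IsWordCoeff D wt w c) {i : I} (hi : A i i ≤ 0) (t : unitInterval) :
    mapDomain (fun q : TildeIndex A => q.1.1) (c t) i =
      ∑ m : Fin (w.count i), c t (imaginaryIndex A i hi m) := by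
  rw [Fin.sum_univ_eq_sum_range (fun m => c t (imaginaryIndex A i hi m)),
    ← Finset.sum_image (g := imaginaryIndex A i hi) (f := fun q => c t q)
      (imaginaryIndex_injective i hi).injOn]
  refine mapDomain_eq_sum_fiber _ _ _ _ ?_ ?_
  · intro q hq
    obtain ⟨m, -, rfl⟩ := Finset.mem_image.1 hq
    rfl
  · rintro ⟨⟨j, m⟩, hm, hm'⟩ rfl hq
    obtain ⟨k, rfl⟩ := Nat.exists_eq_add_of_le' hm
    refine h.eq_zero j hi k ?_ t
    by_contra hk
    exact hq (Finset.mem_image.2 ⟨k, Finset.mem_range.2 (not_le.1 hk), rfl⟩)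

theorem mapDomain_real (x : TildeIndex A →₀ ℝ) (q : TildeIndex A) (hq : A q.1.1 q.1.1 = 2) :
    mapDomain (fun q : TildeIndex A => q.1.1) x q.1.1 = x q := by
  rw [mapDomain_eq_sum_fiber _ _ _ {q} (by simp)
    (fun r hr hrq => absurd (Finset.mem_singleton.2 (tildeIndex_eq_of_real hr hq)) hrq)]
  simp

/-- The path determines the coefficients of its twin. -/
theorem Realizes.eq_of_eq_left (hn : 0 < n) {p : WeightPath Y} {p₁ p₂ : WeightPath Y'}
    {w₁ w₂ : List I} {c₁ c₂ : unitInterval → TildeIndex A →₀ ℝ}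
    (h₁ : Realizes D D' wt wt' p p₁ c₁) (h₂ : Realizes D D' wt wt' p p₂ c₂)
    (hw₁ : IsWordCoeff D wt w₁ c₁) (hw₂ : IsWordCoeff D wt w₂ c₂) : p₁ = p₂ := by
  classical
  have hn' : (0 : ℝ) < n := by exact_mod_cast hn
  have hdom : ∀ t, mapDomain (fun q : TildeIndex A => q.1.1) (c₁ t) =
      mapDomain (fun q : TildeIndex A => q.1.1) (c₂ t) := by
    intro t
    apply D.linearIndependent_realWeight
    rw [linearCombination_mapDomain, linearCombination_mapDomain]
    exact sub_right_injective ((h₁.left t).symm.trans (h₂.left t))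
  -- At time 1 every used copy has coefficient 1, so the sum counts the occurrences of `i`.
  have hcount : ∀ i, A i i ≤ 0 → w₁.count i = w₂.count i := by
    intro i hi
    have h := DFunLike.congr_fun (hdom 1) i
    rw [hw₁.mapDomain_imaginary hi, hw₂.mapDomain_imaginary hi,
      Finset.sum_congr rfl (fun (m : Fin (w₁.count i)) _ => hw₁.one i hi m m.2),
      Finset.sum_congr rfl (fun (m : Fin (w₂.count i)) _ => hw₂.one i hi m m.2)] at h
    simpa using h
  have hc : ∀ t, c₁ t = c₂ t := by
    intro t
    ext q
    rcases D.isBorcherdsCartan.diag q.1.1 with hq | hq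
    · rw [← mapDomain_real _ q hq, hdom, mapDomain_real _ q hq]
    obtain ⟨⟨i, m⟩, hm, hm'⟩ := q
    obtain ⟨k, rfl⟩ := Nat.exists_eq_add_of_le' hm
    change c₁ t (imaginaryIndex A i hq k) = c₂ t (imaginaryIndex A i hq k)
    have hN := hcount i hq
    rcases Nat.lt_or_ge k (w₁.count i) with hk | hk
    swap
    · rw [hw₁.eq_zero i hq k hk, hw₂.eq_zero i hq k (hN ▸ hk)]
    obtain ⟨l, hl1, hl2⟩ := exists_segment hn t
    choose a ha using fun m : Fin (w₁.count i) => hw₁.ramp i hq m m.2 l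
    choose b hb using fun m : Fin (w₁.count i) => hw₂.ramp i hq m (hN ▸ m.2) l
    -- Every local time in `[0, 1]` is attained in the segment, as the comparison of ramps requires.
    have htime : ∀ τ : ℝ, 0 ≤ τ → τ ≤ 1 → ∃ s : unitInterval, n * (s : ℝ) - l = τ ∧
        (l : ℝ) ≤ n * (s : ℝ) ∧ n * (s : ℝ) ≤ l + 1 := by
      intro τ h0 h1
      have hln : (l : ℝ) + 1 ≤ n := by exact_mod_cast l.2
      have hl0 : (0 : ℝ) ≤ l := Nat.cast_nonneg _
      have e : n * (((l : ℝ) + τ) / n) = l + τ := mul_div_cancel₀ _ hn'.ne'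
      refine ⟨⟨((l : ℝ) + τ) / n, by positivity, (div_le_one hn').2 (by linarith)⟩, ?_⟩
      dsimp only
      rw [e]
      refine ⟨by ring, by linarith, by linarith⟩
    have hab : a = b := by
      refine eq_of_sum_ramp_eq (fun m m' hmm' => le_of_forall_ramp_le fun τ h0 h1 => ?_)
        (fun m m' hmm' => le_of_forall_ramp_le fun τ h0 h1 => ?_) fun τ h0 h1 => ?_
      · obtain ⟨s, rfl, h3, h4⟩ := htime τ h0 h1
        rw [← ha m s h3 h4, ← ha m' s h3 h4]
        exact hw₁.monotone i hq m m' hmm' m'.2 s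
      · obtain ⟨s, rfl, h3, h4⟩ := htime τ h0 h1
        rw [← hb m s h3 h4, ← hb m' s h3 h4]
        exact hw₂.monotone i hq m m' hmm' (hN ▸ m'.2) s
      · obtain ⟨s, rfl, h3, h4⟩ := htime τ h0 h1
        have h := DFunLike.congr_fun (hdom s) i
        rw [hw₁.mapDomain_imaginary hq, hw₂.mapDomain_imaginary hq, ← hN] at h
        rw [Finset.sum_congr rfl (fun m _ => (ha m s h3 h4).symm),
          Finset.sum_congr rfl (fun m _ => (hb m s h3 h4).symm)]
        exact h
    have h5 := ha ⟨k, hk⟩ t hl1 hl2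
    have h6 := hb ⟨k, hk⟩ t hl1 hl2
    rw [h5, h6, hab]
  refine WeightPath.ext (funext fun t => ?_)
  rw [h₁.right, h₂.right, hc]

end Twin

theorem quasiEmbedding_of_pos {I : Type*} {A : Matrix I I ℤ}
    {Y : Type*} [AddCommGroup Y] (D : BorcherdsCartanDatum A Y)
    {Y' : Type*} [AddCommGroup Y'] (D' : BorcherdsCartanDatum (tildeMatrix A) Y')
    {n : ℕ} (hn : 0 < n) (wt : Fin n → Module.Dual ℤ Y) (hwt : ∀ l, wt l ∈ D.titsCone)
    (wt' : Fin n → Module.Dual ℤ Y')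
    (hwt' : ∀ l (q : TildeIndex A), wt' l (D'.coroot q) = wt l (D.coroot q.1.1)) :
    ∃ Φ : D.orbit (WeightPath.ofWeights wt) → D'.orbit (WeightPath.ofWeights wt'),
      (∀ l : List I, Φ (D.applyWord l (WeightPath.ofWeights wt)) =
        D'.applyWord (orderedIndex A l) (WeightPath.ofWeights wt')) ∧
      Function.Injective Φ ∧
      (∀ (i : I) (hi : A i i = 2) (x : D.orbit (WeightPath.ofWeights wt)),
        Φ (D.fOrbit i x) = D'.fOrbit ⟨(i, 1), le_rfl, fun _ => rfl⟩ (Φ x)) ∧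
      (∀ (i : I) (hi : A i i ≤ 0) (l : List I),
        Φ (D.fOrbit i (D.applyWord l (WeightPath.ofWeights wt))) =
          D'.fOrbit (nextIndex A i l) (Φ (D.applyWord l (WeightPath.ofWeights wt)))) := by
  have twin := word_twin hn hwt hwt'
  have hsurj : ∀ x : D.orbit (WeightPath.ofWeights wt),
      ∃ w, x = D.applyWord w (WeightPath.ofWeights wt) := by
    rintro ⟨x, F, rfl⟩
    obtain ⟨w, rfl⟩ := D.exists_word F
    exact ⟨w, rfl⟩
  -- The forward direction makes the map well defined, the backward direction makes it injective.
  have hiff : ∀ w₁ w₂, D.applyWord w₁ (WeightPath.ofWeights wt) =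
        D.applyWord w₂ (WeightPath.ofWeights wt) ↔
      D'.applyWord (orderedIndex A w₁) (WeightPath.ofWeights wt') =
        D'.applyWord (orderedIndex A w₂) (WeightPath.ofWeights wt') := by
    intro w₁ w₂
    rw [Subtype.ext_iff, Subtype.ext_iff]
    simp only [BorcherdsCartanDatum.applyWord]
    rcases twin w₁ with ⟨h1, h1'⟩ | ⟨p₁, p₁', c₁, h1, h1', hR₁, hW₁⟩ <;>
      rcases twin w₂ with ⟨h2, h2'⟩ | ⟨p₂, p₂', c₂, h2, h2', hR₂, hW₂⟩ <;>
      rw [h1, h1', h2, h2']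
    · simp
    · simp
    · simp
    · rw [Option.some_inj, Option.some_inj]
      constructor
      · rintro rfl
        exact hR₁.eq_of_eq_left hn hR₂ hW₁ hW₂
      · rintro rfl
        exact hR₁.eq_of_eq_right hR₂
  -- The choice of a word for each element is immaterial, by `hiff`.
  choose word hword using hsurj
  have hcons : ∀ (i : I) (w : List I), D.fOrbit i (D.applyWord w (WeightPath.ofWeights wt)) =
      D.applyWord (i :: w) (WeightPath.ofWeights wt) := fun i w =>
    Subtype.ext (D.word_cons i w _).symm
  have hcons' : ∀ q w, D'.fOrbit q (D'.applyWord w (WeightPath.ofWeights wt')) =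
      D'.applyWord (q :: w) (WeightPath.ofWeights wt') := fun q w =>
    Subtype.ext (D'.word_cons q w _).symm
  have hΦ : ∀ w, D'.applyWord (orderedIndex A (word (D.applyWord w (WeightPath.ofWeights wt))))
      (WeightPath.ofWeights wt') = D'.applyWord (orderedIndex A w) (WeightPath.ofWeights wt') :=
    fun w => (hiff _ _).1 (hword _).symm
  refine ⟨fun x => D'.applyWord (orderedIndex A (word x)) (WeightPath.ofWeights wt'), hΦ,
    fun x y hxy => ?_, fun i hi x => ?_, fun i hi w => ?_⟩
  · rw [hword x, hword y]
    exact (hiff _ _).2 hxy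
  · have h1 : D.fOrbit i x = D.applyWord (i :: word x) (WeightPath.ofWeights wt) := by
      conv_lhs => rw [hword x]
      exact hcons i _
    rw [h1]
    beta_reduce
    rw [hΦ, orderedIndex, hcons']
    congr 2
    exact Subtype.ext (Prod.ext rfl (if_pos hi))
  · rw [hcons]
    beta_reduce
    rw [hΦ, hΦ, hcons', orderedIndex]

/-- An empty concatenation is the zero path, as is the line of weight 0. Since 0 is dominant, the
case without segments reduces to one segment. -/
theorem WeightPath.ofWeights_of_eq_zero {Y : Type*} [AddCommGroup Y] (μ : Fin 0 → Module.Dual ℤ Y) :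
    WeightPath.ofWeights μ = WeightPath.ofWeights (fun _ : Fin 1 => (0 : Module.Dual ℤ Y)) := by
  refine WeightPath.ext (funext fun t => LinearMap.ext fun y => ?_)
  rw [WeightPath.ofWeights_apply, WeightPath.ofWeights_apply]
  simp

theorem proposition4p1p2 {I : Type*} [Countable I] {A : Matrix I I ℤ}
    {Y : Type*} [AddCommGroup Y] [Module.Free ℤ Y] (D : BorcherdsCartanDatum A Y)
    {Y' : Type*} [AddCommGroup Y'] [Module.Free ℤ Y']
    (D' : BorcherdsCartanDatum (tildeMatrix A) Y')
    {n : ℕ} (wt : Fin n → Module.Dual ℤ Y) (hwt : ∀ l, wt l ∈ D.titsCone)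
    (wt' : Fin n → Module.Dual ℤ Y')
    (hwt' : ∀ l (q : TildeIndex A), wt' l (D'.coroot q) = wt l (D.coroot q.1.1)) :
    ∃ Φ : D.orbit (WeightPath.ofWeights wt) → D'.orbit (WeightPath.ofWeights wt'),
      (∀ l : List I, Φ (D.applyWord l (WeightPath.ofWeights wt)) =
        D'.applyWord (orderedIndex A l) (WeightPath.ofWeights wt')) ∧
      Function.Injective Φ ∧
      (∀ (i : I) (hi : A i i = 2) (x : D.orbit (WeightPath.ofWeights wt)),
        Φ (D.fOrbit i x) = D'.fOrbit ⟨(i, 1), le_rfl, fun _ => rfl⟩ (Φ x)) ∧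
      (∀ (i : I) (hi : A i i ≤ 0) (l : List I),
        Φ (D.fOrbit i (D.applyWord l (WeightPath.ofWeights wt))) =
          D'.fOrbit (nextIndex A i l) (Φ (D.applyWord l (WeightPath.ofWeights wt)))) := by
  rcases Nat.eq_zero_or_pos n with rfl | hn
  · rw [WeightPath.ofWeights_of_eq_zero wt, WeightPath.ofWeights_of_eq_zero wt']
    exact quasiEmbedding_of_pos D D' one_pos _
      (fun _ => ⟨1, Submonoid.one_mem _, 0, fun i => le_rfl, rfl⟩) _ fun _ _ => rfl
  · exact quasiEmbedding_of_pos D D' hn wt hwt wt' hwt'
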